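/- Let $Z$ be a random vector in $\mathbb R^q$ with true law $P_0\ll\mu$, $\mu$ a fixed $\sigma$-finite measure. For $j=1,\dots,J$ let $X^{(j)}$ be a proper (possibly empty) subvector of $Z$ and let $g_j:\mathbb R^q\times\mathbb R^d\to\mathbb R^{p_j}$ be measurable in its first argument; put $p=p_1+\dots+p_J$. Let $\theta_0$ be an interior point of $\Theta\subset\mathbb R^d$ and suppose that $\theta_0$ is the only $\theta\in\Theta$ for which $E_{P_0}[g_j(Z,\theta)\mid X^{(j)}]=0$ a.s. for all $j$. Let $\mathcal P$ be the model of all pairs $(\theta,P)$, $\theta\in\Theta$, $P\ll\mu$ a probability measure, with $E_P[g_j(Z,\theta)\mid X^{(j)}]=0$ a.s., $j=1,\dots,J$. Information. For a model given by (conditional or unconditional) moment restrictions with moment functions $m_i(Z,\theta)$, a regular submodel is a family $(\theta_t,P_t)$, $|t|<\varepsilon$, in the model, equal to $(\theta_0,P_0)$ at $t=0$, with $\theta_t$ differentiable at $0$, $P_t$ differentiable in quadratic mean at $t=0$ with score $s\in L^2(P_0)$, and $E_{P_t}[m_i(Z,\theta_t)^2]$ bounded for $t$ near $0$. The information on $\theta_0$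 at $P_0$ is the symmetric matrix $I$ such that, for each $a\in\mathbb R^d$, $a'Ia$ is the infimum of $E_{P_0}[s^2]$ over all regular submodels with $\dot\theta_0=a$. Assume the following. (R) For every $j$ and every $a\in L^2(P_{X^{(j)}})$, the functions $a(X^{(j)})g_j(Z,\theta)$ are in $L^2(P_0)$ for $\theta$ near $\theta_0$ and depend continuously on $\theta$ at $\theta_0$ in $L^2(P_0)$, and $\theta\mapsto E_{P_0}[a(X^{(j)})g_j(Z,\theta)]$ is differentiable at $\theta_0$. (T) There is a measurable $A\subset\operatorname{supp}Z$ such that all $g_{i,A}=g_i(Z,\theta_0)\mathbf 1_{\{Z\in A\}}$ are bounded and, with $X=(X^{(1)},\dots,X^{(J)})$, $g_{-i,A}$ the vector stacking the $g_{j,A}$, $j\neq i$, and $$r_i=g_{i,A}-E[g_{i,A}g_{-i,A}'\mid X]\,E[g_{-i,A}g_{-i,A}'\mid X]^{-1}g_{-i,A},$$ the random matrices $E[g_{-i,A}g_{-i,A}'\mid X]$ and $E[r_ir_i'\mid X^{(i)}]$ are a.s. invertible with essentially bounded inverses, for every $i$. (SP) There is a score $\dot\ell\in L^2(P_0)^d$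 such that for every $a\in\mathbb R^d$ and every score $h$ of a regular submodel of $\mathcal P$ with $\theta_t\equiv\theta_0$ there is a regular submodel of $\mathcal P$ with $\theta_t=\theta_0+ta$ and score $a'\dot\ell+h$. Then the information $I_{\theta_0}$ on $\theta_0$ in $\mathcal P$ exists. Let $\mathcal B$ be the set of $d\times p$ matrices $b=(b_1(X^{(1)}),\dots,b_J(X^{(J)}))$, with $b_j$ of size $d\times p_j$ and entries in $L^2(P_{X^{(j)}})$. For every $b\in\mathcal B$ the information $I_{\theta_0}(b)$ in the unconditional moment model $E[b_j(X^{(j)})g_j(Z,\theta)]=0$, $j=1,\dots,J$, exists, and in the order of symmetric matrices ($M\le N$ iff $N-M$ is positive semidefinite) $$I_{\theta_0}=\sup_{b\in\mathcal B}I_{\theta_0}(b).$$ The same holds when $I_{\theta_0}(b)$ is the information in the model $E\big[\sum_{j=1}^J b_j(X^{(j)})g_j(Z,\theta)\big]=0$. -/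

import Mathlib

open MeasureTheory Filter Topology
open scoped MatrixOrder NNReal ENNReal

noncomputable section

/-- The subvector of `z ∈ ℝ^q` formed by the coordinates in `c`. -/
def subvector {q : ℕ} (c : Finset (Fin q)) (z : Fin q → ℝ) : c → ℝ := fun i => z i

/-- The sigma-algebra on `ℝ^q` generated by a subvector. -/
@[reducible] def subvectorSigma {q : ℕ} (c : Finset (Fin q)) : MeasurableSpace (Fin q → ℝ) :=
  MeasurableSpace.comap (subvector c) inferInstance

/-! ### Moment restrictions -/

/-- The law `P` of `Z` satisfies `E_P[m_i(Z, θ) | 𝒢_i] = 0` almost surely, for every `i`. -/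
def ConditionalRestriction {q d : ℕ} {ι : Type} (𝒢 : ι → MeasurableSpace (Fin q → ℝ))
    (m : ι → (Fin q → ℝ) → (Fin d → ℝ) → ℝ) (θ : Fin d → ℝ) (P : Measure (Fin q → ℝ)) : Prop :=
  ∀ i, Integrable (fun z => m i z θ) P ∧ P[fun z => m i z θ | 𝒢 i] =ᵐ[P] 0

/-- The law `P` of `Z` satisfies `E_P[m_i(Z, θ)] = 0`, for every `i`. -/
def MarginalRestriction {q d : ℕ} {ι : Type}
    (m : ι → (Fin q → ℝ) → (Fin d → ℝ) → ℝ) (θ : Fin d → ℝ) (P : Measure (Fin q → ℝ)) : Prop :=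
  ∀ i, Integrable (fun z => m i z θ) P ∧ ∫ z, m i z θ ∂P = 0

/-! ### Regular submodels, scores and information

A semiparametric model is given by a relation `R θ P` (the law `P` satisfies the restrictions at the
parameter value `θ ∈ Θ`), laws being dominated by a fixed measure `μ`. -/

/-- `t ↦ (θ_t, P_t)`, defined for `t` near `0`, is a regular one-dimensional submodel through
`(θ₀, P₀)` of the model `R` based on the moment functions `m`: the laws `P_t` are dominated by `μ`
and satisfy the restrictions at `θ_t ∈ Θ`, the parameter has derivative `a` at `0`, the family is
differentiable in quadratic mean at `0` with score `s`, and the moment functions keep bounded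
second moments along it. -/
structure IsRegularSubmodel {q d : ℕ} {ι : Type} (μ P₀ : Measure (Fin q → ℝ))
    (Θ : Set (Fin d → ℝ)) (θ₀ : Fin d → ℝ)
    (R : (Fin d → ℝ) → Measure (Fin q → ℝ) → Prop)
    (m : ι → (Fin q → ℝ) → (Fin d → ℝ) → ℝ)
    (θ : ℝ → Fin d → ℝ) (P : ℝ → Measure (Fin q → ℝ))
    (a : Fin d → ℝ) (s : (Fin q → ℝ) → ℝ) : Prop where
  param_zero : θ 0 = θ₀
  law_zero : P 0 = P₀
  isProbability : ∀ᶠ t in 𝓝 (0 : ℝ), IsProbabilityMeasure (P t)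
  dominated : ∀ᶠ t in 𝓝 (0 : ℝ), P t ≪ μ
  param_mem : ∀ᶠ t in 𝓝 (0 : ℝ), θ t ∈ Θ
  restriction : ∀ᶠ t in 𝓝 (0 : ℝ), R (θ t) (P t)
  param_deriv : HasDerivAt θ a 0
  score_memLp : MemLp s 2 P₀
  quadratic_mean : Tendsto
    (fun t : ℝ => eLpNorm (fun z =>
        (√((P t).rnDeriv μ z).toReal - √(P₀.rnDeriv μ z).toReal) / t
          - s z / 2 * √(P₀.rnDeriv μ z).toReal) 2 μ)
    (𝓝[≠] 0) (𝓝 0)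
  bounded_moments : ∃ C : ℝ≥0, ∀ᶠ t in 𝓝 (0 : ℝ), ∀ i,
    eLpNorm (fun z => m i z (θ t)) 2 (P t) ≤ C

/-- The matrix `M` is the semiparametric Fisher information on `θ₀` at `P₀`: it is symmetric and, for
every direction `a`, `a' M a` is the infimum of the Fisher information `E[s²]` over all regular
submodels along which the parameter moves in the direction `a`. -/
def IsFisherInformation {q d : ℕ} {ι : Type} (μ P₀ : Measure (Fin q → ℝ))
    (Θ : Set (Fin d → ℝ)) (θ₀ : Fin d → ℝ)
    (R : (Fin d → ℝ) → Measure (Fin q → ℝ) → Prop)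
    (m : ι → (Fin q → ℝ) → (Fin d → ℝ) → ℝ)
    (M : Matrix (Fin d) (Fin d) ℝ) : Prop :=
  M.IsSymm ∧ ∀ a : Fin d → ℝ,
    IsGLB {v : ℝ | ∃ θ P s, IsRegularSubmodel μ P₀ Θ θ₀ R m θ P a s ∧ v = ∫ z, s z ^ 2 ∂P₀}
      (a ⬝ᵥ M.mulVec a)

/-- The nuisance tangent set: scores of the regular submodels in which `θ` is kept at `θ₀`. -/
def nuisanceTangentSet {q d : ℕ} {ι : Type} (μ P₀ : Measure (Fin q → ℝ))
    (Θ : Set (Fin d → ℝ)) (θ₀ : Fin d → ℝ)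
    (R : (Fin d → ℝ) → Measure (Fin q → ℝ) → Prop)
    (m : ι → (Fin q → ℝ) → (Fin d → ℝ) → ℝ) : Set ((Fin q → ℝ) → ℝ) :=
  {h | ∃ P, IsRegularSubmodel μ P₀ Θ θ₀ R m (fun _ => θ₀) P 0 h}

/-- The model has a square-integrable score `ℓ` for `θ` at `(θ₀, P₀)` such that, for every direction
`a` and every nuisance score `h`, some regular submodel with parameter `θ₀ + t a` has score
`a' ℓ + h`. -/
def HasSemiparametricScore {q d : ℕ} {ι : Type} (μ P₀ : Measure (Fin q → ℝ))
    (Θ : Set (Fin d → ℝ)) (θ₀ : Fin d → ℝ)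
    (R : (Fin d → ℝ) → Measure (Fin q → ℝ) → Prop)
    (m : ι → (Fin q → ℝ) → (Fin d → ℝ) → ℝ) : Prop :=
  ∃ ℓ : Fin d → (Fin q → ℝ) → ℝ, (∀ l, MemLp (ℓ l) 2 P₀) ∧
    ∀ a : Fin d → ℝ, ∀ h ∈ nuisanceTangentSet μ P₀ Θ θ₀ R m,
      ∃ P, IsRegularSubmodel μ P₀ Θ θ₀ R m (fun t => θ₀ + t • a) P a
        (fun z => ∑ l, a l * ℓ l z + h z)

/-! ### The conditional moment model and the instrumented models -/

/-- All the scalar moment functions `g_{j,k}`. -/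
def momentComponents {q d J : ℕ} {p : Fin J → ℕ}
    (g : (j : Fin J) → (Fin q → ℝ) → (Fin d → ℝ) → Fin (p j) → ℝ) :
    (Σ j, Fin (p j)) → (Fin q → ℝ) → (Fin d → ℝ) → ℝ :=
  fun x z θ => g x.1 z θ x.2

/-- The restrictions `E[g_j(Z, θ) | X^(j)] = 0` a.s., `j = 1, …, J`, where `X^(j)` is the subvector of
`Z` with coordinates in `c j`. -/
def conditionalModel {q d J : ℕ} {p : Fin J → ℕ} (c : Fin J → Finset (Fin q))
    (g : (j : Fin J) → (Fin q → ℝ) → (Fin d → ℝ) → Fin (p j) → ℝ) :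
    (Fin d → ℝ) → Measure (Fin q → ℝ) → Prop :=
  ConditionalRestriction (fun x : Σ j, Fin (p j) => subvectorSigma (c x.1)) (momentComponents g)

/-- Instrument matrices `b = (b_1(X^(1)), …, b_J(X^(J)))`, with `b_j` of size `d × p_j` and entries in
`L²(P_{X^(j)})`. -/
def instruments {q : ℕ} (d : ℕ) {J : ℕ} (p : Fin J → ℕ) (c : Fin J → Finset (Fin q))
    (P₀ : Measure (Fin q → ℝ)) :
    Set ((j : Fin J) → (c j → ℝ) → Matrix (Fin d) (Fin (p j)) ℝ) :=
  {b | ∀ j l k, Measurable (fun x => b j x l k) ∧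
    MemLp (fun x => b j x l k) 2 (P₀.map (subvector (c j)))}

/-- The `J d` scalar moment functions `b_j(X^(j)) g_j(Z, θ)`, `j = 1, …, J`. -/
def blockMoments {q d J : ℕ} {p : Fin J → ℕ} (c : Fin J → Finset (Fin q))
    (g : (j : Fin J) → (Fin q → ℝ) → (Fin d → ℝ) → Fin (p j) → ℝ)
    (b : (j : Fin J) → (c j → ℝ) → Matrix (Fin d) (Fin (p j)) ℝ) :
    Fin J × Fin d → (Fin q → ℝ) → (Fin d → ℝ) → ℝ :=
  fun x z θ => (b x.1 (subvector (c x.1) z)).mulVec (g x.1 z θ) x.2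

/-- The `d` scalar moment functions `b(X) g(Z, θ) = ∑_j b_j(X^(j)) g_j(Z, θ)`. -/
def compactMoments {q d J : ℕ} {p : Fin J → ℕ} (c : Fin J → Finset (Fin q))
    (g : (j : Fin J) → (Fin q → ℝ) → (Fin d → ℝ) → Fin (p j) → ℝ)
    (b : (j : Fin J) → (c j → ℝ) → Matrix (Fin d) (Fin (p j)) ℝ) :
    Fin d → (Fin q → ℝ) → (Fin d → ℝ) → ℝ :=
  fun l z θ => ∑ j, (b j (subvector (c j) z)).mulVec (g j z θ) l

/-- Regularity of the instrumented moments at `θ₀`: for every `a ∈ L²(P_{X^(j)})`, near `θ₀` the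
functions `a(X^(j)) g_j(Z, θ)` are square-integrable, they depend continuously on `θ` at `θ₀` in
`L²(P₀)`, and `θ ↦ E[a(X^(j)) g_j(Z, θ)]` is differentiable at `θ₀`. -/
def RegularMoments {q d J : ℕ} {p : Fin J → ℕ} (c : Fin J → Finset (Fin q))
    (g : (j : Fin J) → (Fin q → ℝ) → (Fin d → ℝ) → Fin (p j) → ℝ)
    (P₀ : Measure (Fin q → ℝ)) (θ₀ : Fin d → ℝ) : Prop :=
  ∀ (j : Fin J) (k : Fin (p j)) (a : (c j → ℝ) → ℝ), Measurable a →
    MemLp a 2 (P₀.map (subvector (c j))) →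
    (∀ᶠ θ in 𝓝 θ₀, MemLp (fun z => a (subvector (c j) z) * g j z θ k) 2 P₀) ∧
    Tendsto (fun θ => eLpNorm
      (fun z => a (subvector (c j) z) * g j z θ k - a (subvector (c j) z) * g j z θ₀ k) 2 P₀)
      (𝓝 θ₀) (𝓝 0) ∧
    DifferentiableAt ℝ (fun θ => ∫ z, a (subvector (c j) z) * g j z θ k ∂P₀) θ₀

/-! ### The non-degeneracy condition -/

/-- The random matrix `E[u v' | 𝒢]`. -/
def condSecondMoment {q : ℕ} {κ ν : Type} (P₀ : Measure (Fin q → ℝ))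
    (𝒢 : MeasurableSpace (Fin q → ℝ)) (u : (Fin q → ℝ) → κ → ℝ) (v : (Fin q → ℝ) → ν → ℝ)
    (z : Fin q → ℝ) : Matrix κ ν ℝ :=
  Matrix.of fun k l => (P₀[fun y => u y k * v y l | 𝒢]) z

/-- `S` is almost surely invertible, with essentially bounded inverse. -/
def HasBoundedInverse {q : ℕ} {κ : Type} [Fintype κ] [DecidableEq κ] (P₀ : Measure (Fin q → ℝ))
    (S : (Fin q → ℝ) → Matrix κ κ ℝ) : Prop :=
  ∃ K : ℝ, ∀ᵐ z ∂P₀, IsUnit (S z).det ∧ ∀ k l, |(S z)⁻¹ k l| ≤ K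

/-- `g_{i,A} = g_i(Z, θ₀) 1{Z ∈ A}`. -/
def localized {q d J : ℕ} {p : Fin J → ℕ}
    (g : (j : Fin J) → (Fin q → ℝ) → (Fin d → ℝ) → Fin (p j) → ℝ) (θ₀ : Fin d → ℝ)
    (A : Set (Fin q → ℝ)) (i : Fin J) (z : Fin q → ℝ) : Fin (p i) → ℝ :=
  A.indicator (fun y => g i y θ₀) z

/-- The vector `g_{-i,A}` stacking the `g_{j,A}` with `j ≠ i`; for `J = 2` it is `g_{j,A}` with `j` the
other index. -/
def localizedOthers {q d J : ℕ} {p : Fin J → ℕ}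
    (g : (j : Fin J) → (Fin q → ℝ) → (Fin d → ℝ) → Fin (p j) → ℝ) (θ₀ : Fin d → ℝ)
    (A : Set (Fin q → ℝ)) (i : Fin J) (z : Fin q → ℝ) :
    {x : Σ j, Fin (p j) // x.1 ≠ i} → ℝ :=
  fun x => localized g θ₀ A x.1.1 z x.1.2

/-- `b_i = g_{i,A} - E(g_{i,A} g_{-i,A}' | X) E(g_{-i,A} g_{-i,A}' | X)⁻¹ g_{-i,A}`, where
`X = (X^(1), …, X^(J))`. -/
def localizedResidual {q d J : ℕ} {p : Fin J → ℕ} (c : Fin J → Finset (Fin q))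
    (g : (j : Fin J) → (Fin q → ℝ) → (Fin d → ℝ) → Fin (p j) → ℝ)
    (P₀ : Measure (Fin q → ℝ)) (θ₀ : Fin d → ℝ)
    (A : Set (Fin q → ℝ)) (i : Fin J) (z : Fin q → ℝ) : Fin (p i) → ℝ :=
  localized g θ₀ A i z -
    (condSecondMoment P₀ (⨆ j, subvectorSigma (c j)) (localized g θ₀ A i)
        (localizedOthers g θ₀ A i) z *
      (condSecondMoment P₀ (⨆ j, subvectorSigma (c j)) (localizedOthers g θ₀ A i)
        (localizedOthers g θ₀ A i) z)⁻¹).mulVec (localizedOthers g θ₀ A i z)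

/-- For some part `A` of the support of `Z` on which all `g_j(Z, θ₀)` are bounded, the matrices
`E(g_{-i,A} g_{-i,A}' | X^(1), …, X^(J))` and `E(b_i b_i' | X^(i))` have bounded inverses. -/
def AssumptionT {q d J : ℕ} {p : Fin J → ℕ} (c : Fin J → Finset (Fin q))
    (g : (j : Fin J) → (Fin q → ℝ) → (Fin d → ℝ) → Fin (p j) → ℝ)
    (P₀ : Measure (Fin q → ℝ)) (θ₀ : Fin d → ℝ) : Prop :=
  ∃ A : Set (Fin q → ℝ), MeasurableSet A ∧ A ⊆ P₀.support ∧
    (∃ K : ℝ, ∀ i k, ∀ᵐ z ∂P₀, |localized g θ₀ A i z k| ≤ K) ∧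
    (∀ i, HasBoundedInverse P₀ (condSecondMoment P₀ (⨆ j, subvectorSigma (c j))
      (localizedOthers g θ₀ A i) (localizedOthers g θ₀ A i))) ∧
    (∀ i, HasBoundedInverse P₀ (condSecondMoment P₀ (subvectorSigma (c i))
      (localizedResidual c g P₀ θ₀ A i) (localizedResidual c g P₀ θ₀ A i)))

end

/-!
In each of the models the information is a Gram matrix of projections: if the scores of the regular
submodels in the direction `a` form a dense part of `a'ℓ + Uᗮ`, for a closed subspace `U` of `L²(P₀)`,
then the smallest second moment of a score is the squared norm of the projection of `a'ℓ` on `U`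
(`isFisherInformation_projectedGram`). Along any submodel, a restriction `E[f(Z, θ)] = 0` prescribes
the covariance of the score with `f(Z, θ₀)` (`IsRegularSubmodel.integral_mul_score`), so `U` can only
consist of the constants and the moment functions. All models share the vector `ℓ` of scores for `θ`
that is given for the conditional model: a score of the conditional model has the prescribed
covariance with `b(π_x) g_x` for every square-integrable instrument `b` (`inner_op_score`). For
indicators this is a restriction on the submodel, and both sides are continuous in the instrument, by
the theorems of Baire (`eventually_exists_multiplier`) and Banach–Steinhaus
(`exists_derivative_functional`).

For an instrumented model, `U` is spanned by the constants and finitely many functions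
`∑_x A_x(π_x) g_x`. Every function with the prescribed covariances is approximated by scores:
perturb the density in the direction of a bounded function, and restore the moments by a
correction in the span of finitely many bounded functions dual to them, which amounts to solving a
linear system (`exists_density_path`, `isFisherInformation_marginal`). Moment functions which are
linearly dependent at `θ₀` are so at all `θ`, because the instruments are determined by the moments
(`InstrumentedMoments.synthesis_injective`); so dependence imposes no further restrictions.

For the conditional model, `U` is the space of all `r + ∑_x β_x(π_x) g_x`. Two facts about it are
needed: it is closed, and the bounded functions are dense in its orthogonal complement, where a bounded
function `h` is a nuisance score through the densities `1 + t h`. The non-degeneracy condition gives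
both. It provides bounded functions `w_y` with `E[w_y g_x α ψ] = δ_xy E[α ψ]` for instruments `α` and
`ψ` (`AssumptionT.exists_dual_system`), so that subtracting `∑_y w_y E[g_y h | π_y]` makes any bounded
`h` orthogonal to all moments and keeps it bounded, while `E[f w_y | π_y]` recovers the instruments
of an element `f` of `U` (`InstrumentedMoments.orthogonal_bounded_le_normalSpace`).

The spaces of the instrumented models lie in `U`, whence the inequality between informations. The
bound is attained: as `U` is closed, the projections of the `ℓ_l` on it are themselves of the form
`r + ∑_x β_x(π_x) g_x`, and the `β` are the rows of an optimal instrument matrix.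
-/

/-! ### Square-integrable functions -/

section SquareIntegrable

variable {Ω : Type*} [MeasurableSpace Ω] {μ : Measure Ω}

theorem integral_mul_eq_inner {f g : Ω → ℝ} (hf : MemLp f 2 μ) (hg : MemLp g 2 μ) :
    ∫ z, f z * g z ∂μ = inner ℝ (hf.toLp f) (hg.toLp g) := by
  rw [L2.inner_def]
  refine integral_congr_ae ?_
  filter_upwards [hf.coeFn_toLp, hg.coeFn_toLp] with z h1 h2
  simp [h1, h2, mul_comm]

theorem abs_integral_mul_le {f g : Ω → ℝ} (hf : MemLp f 2 μ) (hg : MemLp g 2 μ) :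
    |∫ z, f z * g z ∂μ| ≤ (eLpNorm f 2 μ).toReal * (eLpNorm g 2 μ).toReal := by
  rw [integral_mul_eq_inner hf hg, ← Lp.norm_toLp f hf, ← Lp.norm_toLp g hg]
  exact abs_real_inner_le_norm _ _

theorem integrable_mul_of_memLp_two {f g : Ω → ℝ} (hf : MemLp f 2 μ) (hg : MemLp g 2 μ) :
    Integrable (fun z => f z * g z) μ := hf.integrable_mul hg

/-- Products of an `L²`-bounded family with an `L²`-null family have vanishing integrals. -/
theorem tendsto_integral_mul_zero {τ : Type*} {l : Filter τ} {f g : τ → Ω → ℝ} {C : ℝ≥0}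
    (hf : ∀ᶠ t in l, MemLp (f t) 2 μ) (hg : ∀ᶠ t in l, MemLp (g t) 2 μ)
    (hC : ∀ᶠ t in l, eLpNorm (f t) 2 μ ≤ C)
    (h0 : Tendsto (fun t => eLpNorm (g t) 2 μ) l (𝓝 0)) :
    Tendsto (fun t => ∫ z, f t z * g t z ∂μ) l (𝓝 0) := by
  have h1 : Tendsto (fun t => (C : ℝ) * (eLpNorm (g t) 2 μ).toReal) l (𝓝 0) := by
    have := (ENNReal.tendsto_toReal ENNReal.zero_ne_top).comp h0
    simpa using this.const_mul (C : ℝ)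
  refine squeeze_zero_norm' ?_ h1
  filter_upwards [hf, hg, hC] with t h1 h2 h3
  refine (abs_integral_mul_le h1 h2).trans ?_
  gcongr
  simpa using ENNReal.toReal_mono (by simp) h3

theorem eventually_memLp_of_tendsto {τ : Type*} {l : Filter τ} {f : τ → Ω → ℝ} {f₀ : Ω → ℝ}
    (hm : ∀ᶠ t in l, AEStronglyMeasurable (f t) μ) (hf₀ : MemLp f₀ 2 μ)
    (hf : Tendsto (fun t => eLpNorm (fun z => f t z - f₀ z) 2 μ) l (𝓝 0)) :
    ∀ᶠ t in l, MemLp (f t) 2 μ := by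
  filter_upwards [hm, hf.eventually (gt_mem_nhds (by norm_num : (0 : ℝ≥0∞) < 1))] with t h1 h2
  have h3 : MemLp (fun z => f t z - f₀ z) 2 μ := ⟨h1.sub hf₀.1, h2.trans (by simp)⟩
  exact (by simpa [Pi.add_def] using h3.add hf₀ : MemLp (fun z => f t z) 2 μ)

theorem eventually_eLpNorm_le_of_tendsto {τ : Type*} {l : Filter τ} {f : τ → Ω → ℝ} {f₀ : Ω → ℝ}
    (hm : ∀ᶠ t in l, AEStronglyMeasurable (f t) μ) (hf₀ : MemLp f₀ 2 μ)
    (hf : Tendsto (fun t => eLpNorm (fun z => f t z - f₀ z) 2 μ) l (𝓝 0)) :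
    ∃ C : ℝ≥0, ∀ᶠ t in l, eLpNorm (f t) 2 μ ≤ C := by
  refine ⟨(1 + eLpNorm f₀ 2 μ).toNNReal, ?_⟩
  have hfin : 1 + eLpNorm f₀ 2 μ ≠ ∞ := by simp [hf₀.2.ne]
  filter_upwards [hm, hf.eventually (gt_mem_nhds (by norm_num : (0 : ℝ≥0∞) < 1))] with t h1 h2
  rw [ENNReal.coe_toNNReal hfin]
  have : f t = (fun z => f t z - f₀ z) + f₀ := by ext; simp
  rw [this]
  refine (eLpNorm_add_le (h1.sub hf₀.1) hf₀.1 (by norm_num)).trans ?_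
  gcongr
  exact h2.le

theorem tendsto_integral_mul {τ : Type*} {l : Filter τ} {f g : τ → Ω → ℝ} {f₀ g₀ : Ω → ℝ}
    (hfm : ∀ᶠ t in l, AEStronglyMeasurable (f t) μ) (hgm : ∀ᶠ t in l, AEStronglyMeasurable (g t) μ)
    (hf₀ : MemLp f₀ 2 μ) (hg₀ : MemLp g₀ 2 μ)
    (hf : Tendsto (fun t => eLpNorm (fun z => f t z - f₀ z) 2 μ) l (𝓝 0))
    (hg : Tendsto (fun t => eLpNorm (fun z => g t z - g₀ z) 2 μ) l (𝓝 0)) :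
    Tendsto (fun t => ∫ z, f t z * g t z ∂μ) l (𝓝 (∫ z, f₀ z * g₀ z ∂μ)) := by
  have hfL := eventually_memLp_of_tendsto hfm hf₀ hf
  have hgL := eventually_memLp_of_tendsto hgm hg₀ hg
  obtain ⟨C, hC⟩ := eventually_eLpNorm_le_of_tendsto hfm hf₀ hf
  have h1 := tendsto_integral_mul_zero (g := fun t z => g t z - g₀ z) hfL
    (by filter_upwards [hgL] with t h using h.sub hg₀) hC hg
  have h2 := tendsto_integral_mul_zero (f := fun _ => g₀) (g := fun t z => f t z - f₀ z)
    (C := (eLpNorm g₀ 2 μ).toNNReal) (l := l)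
    (Eventually.of_forall fun _ => hg₀) (by filter_upwards [hfL] with t h using h.sub hf₀)
    (Eventually.of_forall fun _ => by rw [ENNReal.coe_toNNReal hg₀.2.ne]) hf
  have h3 := (h1.add h2).add_const (∫ z, f₀ z * g₀ z ∂μ)
  simp only [add_zero, zero_add] at h3
  refine h3.congr' ?_
  filter_upwards [hfL, hgL] with t hft hgt
  have e1 : (fun z => f t z * (g t z - g₀ z)) = fun z => f t z * g t z - f t z * g₀ z := by
    ext; ring
  have e2 : (fun z => g₀ z * (f t z - f₀ z)) = fun z => f t z * g₀ z - f₀ z * g₀ z := by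
    ext; ring
  rw [e1, e2, integral_sub (integrable_mul_of_memLp_two hft hgt)
    (integrable_mul_of_memLp_two hft hg₀), integral_sub (integrable_mul_of_memLp_two hft hg₀)
    (integrable_mul_of_memLp_two hf₀ hg₀)]
  ring

/-- Bounded measurable functions are dense in `L²`. -/
theorem exists_bounded_eLpNorm_sub_lt {f : Ω → ℝ} (hf : MemLp f 2 μ) {ε : ℝ≥0∞} (hε : ε ≠ 0) :
    ∃ h : Ω → ℝ, Measurable h ∧ (∃ K : ℝ, ∀ z, |h z| ≤ K) ∧ MemLp h 2 μ ∧
      eLpNorm (fun z => f z - h z) 2 μ < ε := by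
  obtain ⟨h, h1, h2⟩ := hf.exists_simpleFunc_eLpNorm_sub_lt (by norm_num) hε
  obtain ⟨K, hK⟩ := h.exists_forall_norm_le
  exact ⟨h, h.measurable, ⟨K, hK⟩, h2, h1⟩

theorem memLp_two_of_bounded [IsFiniteMeasure μ] {h : Ω → ℝ} (hm : AEStronglyMeasurable h μ)
    {K : ℝ} (hK : ∀ z, |h z| ≤ K) : MemLp h 2 μ :=
  MemLp.of_bound hm K (Eventually.of_forall hK)

end SquareIntegrable

/-! ### Differentiability in quadratic mean -/

section QuadraticMean

variable {Ω : Type*} [MeasurableSpace Ω] {μ : Measure Ω}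

theorem eLpNorm_mul_sqrt_rnDeriv [SigmaFinite μ] {P : Measure Ω} [IsFiniteMeasure P] (hP : P ≪ μ)
    {f : Ω → ℝ} (hf : Measurable f) :
    eLpNorm (fun z => f z * √(P.rnDeriv μ z).toReal) 2 μ = eLpNorm f 2 P := by
  rw [eLpNorm_eq_lintegral_rpow_enorm_toReal (by norm_num) (by norm_num),
    eLpNorm_eq_lintegral_rpow_enorm_toReal (by norm_num) (by norm_num)]
  congr 1
  rw [← lintegral_rnDeriv_mul hP (by fun_prop)]
  refine lintegral_congr_ae ?_
  filter_upwards [P.rnDeriv_lt_top μ] with z hz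
  have : (P.rnDeriv μ z) = ‖√(P.rnDeriv μ z).toReal‖ₑ ^ (2 : ℝ) := by
    rw [Real.enorm_of_nonneg (Real.sqrt_nonneg _), ENNReal.ofReal_rpow_of_nonneg
      (Real.sqrt_nonneg _) (by norm_num)]
    simp [ENNReal.ofReal_toReal hz.ne]
  simp only [ENNReal.toReal_ofNat]
  rw [enorm_mul, ENNReal.mul_rpow_of_nonneg _ _ (by norm_num), ← this, mul_comm]

theorem measurable_sqrt_rnDeriv (P : Measure Ω) :
    Measurable fun z => √(P.rnDeriv μ z).toReal :=
  (P.measurable_rnDeriv μ).ennreal_toReal.sqrt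

theorem memLp_mul_sqrt_rnDeriv [SigmaFinite μ] {P : Measure Ω} [IsFiniteMeasure P] (hP : P ≪ μ)
    {f : Ω → ℝ} (hf : Measurable f) (hfP : MemLp f 2 P) :
    MemLp (fun z => f z * √(P.rnDeriv μ z).toReal) 2 μ :=
  ⟨(hf.mul (measurable_sqrt_rnDeriv P)).aestronglyMeasurable, by
    rw [eLpNorm_mul_sqrt_rnDeriv hP hf]; exact hfP.2⟩

theorem memLp_sqrt_rnDeriv [SigmaFinite μ] {P : Measure Ω} [IsFiniteMeasure P] (hP : P ≪ μ) :
    MemLp (fun z => √(P.rnDeriv μ z).toReal) 2 μ := by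
  simpa using memLp_mul_sqrt_rnDeriv hP measurable_const (memLp_const (1 : ℝ))

theorem integral_mul_mul_rnDeriv [SigmaFinite μ] {P : Measure Ω} [IsFiniteMeasure P] (hP : P ≪ μ)
    (f h : Ω → ℝ) :
    ∫ z, (f z * √(P.rnDeriv μ z).toReal) * (h z * √(P.rnDeriv μ z).toReal) ∂μ
      = ∫ z, f z * h z ∂P := by
  rw [← integral_rnDeriv_smul hP]
  refine integral_congr_ae (Eventually.of_forall fun z => ?_)
  have := Real.mul_self_sqrt (ENNReal.toReal_nonneg (a := P.rnDeriv μ z))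
  simp only [smul_eq_mul]
  linear_combination (f z * h z) * this

theorem mul_sqrt_rnDeriv_congr [SigmaFinite μ] {P : Measure Ω} [IsFiniteMeasure P] (hP : P ≪ μ)
    {f h : Ω → ℝ} (hfh : f =ᵐ[P] h) :
    (fun z => f z * √(P.rnDeriv μ z).toReal) =ᵐ[μ] fun z => h z * √(P.rnDeriv μ z).toReal := by
  rw [← Measure.withDensity_rnDeriv_eq P μ hP, EventuallyEq,
    ae_withDensity_iff (P.measurable_rnDeriv μ)] at hfh
  filter_upwards [hfh] with z hz
  by_cases h0 : P.rnDeriv μ z = 0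
  · simp [h0]
  · rw [hz h0]

/-- Differentiation of moments along a path that is differentiable in quadratic mean: if `f_t → f₀`
in `L²(P₀)` and `f_t` is bounded in `L²(P_t)`, the difference quotients of `t ↦ ∫ f_t dP_t` caused
by the change of the law alone converge to the covariance of `f₀` with the score. -/
theorem tendsto_integral_sub_div_of_quadratic_mean [SigmaFinite μ] {P₀ : Measure Ω}
    [IsFiniteMeasure P₀] (hP₀ : P₀ ≪ μ) {P : ℝ → Measure Ω}
    (hP : ∀ᶠ t in 𝓝[≠] (0 : ℝ), IsProbabilityMeasure (P t)) (hPμ : ∀ᶠ t in 𝓝[≠] (0 : ℝ), P t ≪ μ)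
    {s : Ω → ℝ} (hs : MemLp s 2 P₀)
    (hqm : Tendsto (fun t : ℝ => eLpNorm (fun z =>
        (√((P t).rnDeriv μ z).toReal - √(P₀.rnDeriv μ z).toReal) / t
          - s z / 2 * √(P₀.rnDeriv μ z).toReal) 2 μ) (𝓝[≠] 0) (𝓝 0))
    {f : ℝ → Ω → ℝ} {f₀ : Ω → ℝ} (hf : ∀ t, Measurable (f t)) (hf₀m : Measurable f₀)
    (hf₀ : MemLp f₀ 2 P₀)
    (hcont : Tendsto (fun t => eLpNorm (fun z => f t z - f₀ z) 2 P₀) (𝓝[≠] 0) (𝓝 0))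
    (hbd : ∃ C : ℝ≥0, ∀ᶠ t in 𝓝[≠] (0 : ℝ), eLpNorm (f t) 2 (P t) ≤ C) :
    Tendsto (fun t => (∫ z, f t z ∂(P t) - ∫ z, f t z ∂P₀) / t) (𝓝[≠] 0)
      (𝓝 (∫ z, f₀ z * s z ∂P₀)) := by
  -- a measurable version of the score
  wlog hsm : Measurable s generalizing s
  · have hs' := hs.1.ae_eq_mk
    rw [integral_congr_ae (g := fun z => f₀ z * hs.1.mk s z)
      (by filter_upwards [hs'] with z hz; rw [hz])]
    refine this ((memLp_congr_ae hs').1 hs) (hqm.congr fun t => eLpNorm_congr_ae ?_)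
      hs.1.stronglyMeasurable_mk.measurable
    filter_upwards [mul_sqrt_rnDeriv_congr hP₀ hs'] with z hz
    linear_combination (-1 / 2 : ℝ) * hz
  -- with `q_t = √p_t` and `D_t = (q_t - q₀) / t → s q₀ / 2`, the difference quotient is
  -- `∫ f_t q_t D_t + ∫ f_t q₀ D_t`; in the first integral `f_t q_t` is only bounded in `L²(μ)`, but it
  -- converges weakly to `f₀ q₀`
  obtain ⟨C, hC⟩ := hbd
  set q : ℝ → Ω → ℝ := fun t z => √((P t).rnDeriv μ z).toReal with hq
  set q₀ : Ω → ℝ := fun z => √(P₀.rnDeriv μ z).toReal with hq₀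
  set D : ℝ → Ω → ℝ := fun t z => (q t z - q₀ z) / t with hD
  have hqmeas : ∀ t, Measurable (q t) := fun t => measurable_sqrt_rnDeriv _
  have hq₀meas : Measurable q₀ := measurable_sqrt_rnDeriv _
  have hqL : ∀ᶠ t in 𝓝[≠] (0 : ℝ), MemLp (q t) 2 μ := by
    filter_upwards [hP, hPμ] with t h1 h2 using memLp_sqrt_rnDeriv h2
  have hq₀L : MemLp q₀ 2 μ := memLp_sqrt_rnDeriv hP₀
  have hσ : MemLp (fun z => s z / 2 * q₀ z) 2 μ := by
    refine memLp_mul_sqrt_rnDeriv hP₀ (hsm.div_const 2) ?_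
    simpa [div_eq_inv_mul] using hs.const_mul (2⁻¹)
  have hDL : ∀ᶠ t in 𝓝[≠] (0 : ℝ), MemLp (D t) 2 μ := by
    filter_upwards [hqL] with t h
    simpa [hD, div_eq_inv_mul] using (h.sub hq₀L).const_mul (t⁻¹)
  have hqm' : Tendsto (fun t => eLpNorm (fun z => D t z - s z / 2 * q₀ z) 2 μ) (𝓝[≠] 0) (𝓝 0) :=
    hqm
  have hA : ∀ᶠ t in 𝓝[≠] (0 : ℝ), MemLp (fun z => f t z * q t z) 2 μ ∧
      eLpNorm (fun z => f t z * q t z) 2 μ ≤ C := by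
    filter_upwards [hP, hPμ, hC] with t h1 h2 h3
    have h4 := eLpNorm_mul_sqrt_rnDeriv h2 (hf t)
    exact ⟨memLp_mul_sqrt_rnDeriv h2 (hf t) ⟨(hf t).aestronglyMeasurable,
      h3.trans_lt ENNReal.coe_lt_top⟩, h4.le.trans h3⟩
  have hB₀ : MemLp (fun z => f₀ z * q₀ z) 2 μ := memLp_mul_sqrt_rnDeriv hP₀ hf₀m hf₀
  have hBm : ∀ᶠ t in 𝓝[≠] (0 : ℝ), AEStronglyMeasurable (fun z => f t z * q₀ z) μ :=
    Eventually.of_forall fun t => ((hf t).mul hq₀meas).aestronglyMeasurable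
  have hBc : Tendsto (fun t => eLpNorm (fun z => f t z * q₀ z - f₀ z * q₀ z) 2 μ) (𝓝[≠] 0)
      (𝓝 0) := by
    refine hcont.congr fun t => ?_
    have := eLpNorm_mul_sqrt_rnDeriv hP₀ ((hf t).sub hf₀m)
    simp only [Pi.sub_apply, sub_mul] at this
    exact this.symm
  have hBL := eventually_memLp_of_tendsto hBm hB₀ hBc
  -- the roots of the densities converge in `L²(μ)`
  have hqc : Tendsto (fun t => eLpNorm (fun z => q t z - q₀ z) 2 μ) (𝓝[≠] 0) (𝓝 0) := by
    obtain ⟨K, hK⟩ := eventually_eLpNorm_le_of_tendsto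
      (by filter_upwards [hDL] with t h using h.1) hσ hqm'
    have ht : Tendsto (fun t : ℝ => ‖t‖ₑ * (K : ℝ≥0∞)) (𝓝[≠] 0) (𝓝 0) := by
      have h1 : Tendsto (fun t : ℝ => ‖t‖ₑ) (𝓝[≠] 0) (𝓝 0) :=
        (by simpa using (continuous_enorm (E := ℝ)).tendsto 0 :
          Tendsto (fun t : ℝ => ‖t‖ₑ) (𝓝 0) (𝓝 0)).mono_left nhdsWithin_le_nhds
      simpa using ENNReal.Tendsto.mul_const h1 (Or.inr ENNReal.coe_ne_top)
    refine tendsto_of_tendsto_of_tendsto_of_le_of_le' tendsto_const_nhds ht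
      (Eventually.of_forall fun _ => bot_le) ?_
    filter_upwards [hK, self_mem_nhdsWithin] with t h1 (h2 : t ≠ 0)
    have : (fun z => q t z - q₀ z) = t • D t := by
      ext z; simp [hD]; field_simp
    rw [this, eLpNorm_const_smul]
    gcongr
  -- weak convergence of `f_t √p_t`, tested against a bounded multiple of `√p₀`
  have hweak : ∀ h : Ω → ℝ, Measurable h → (∃ K : ℝ, ∀ z, |h z| ≤ K) → Tendsto
      (fun t => ∫ z, (f t z * q t z) * (h z * q₀ z) ∂μ) (𝓝[≠] 0)
      (𝓝 (∫ z, (f₀ z * q₀ z) * (h z * q₀ z) ∂μ)) := by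
    rintro h hm ⟨K, hK⟩
    have hhq : MemLp (fun z => h z * q₀ z) 2 μ := memLp_mul_sqrt_rnDeriv hP₀ hm
      (memLp_two_of_bounded hm.aestronglyMeasurable hK)
    have hlim : Tendsto (fun t => eLpNorm (fun z => h z * q t z - h z * q₀ z) 2 μ) (𝓝[≠] 0)
        (𝓝 0) := by
      have h1 : Tendsto (fun t => ENNReal.ofReal K * eLpNorm (fun z => q t z - q₀ z) 2 μ)
          (𝓝[≠] 0) (𝓝 0) := by
        simpa using ENNReal.Tendsto.const_mul hqc (Or.inr ENNReal.ofReal_ne_top)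
      refine tendsto_of_tendsto_of_tendsto_of_le_of_le tendsto_const_nhds h1
        (fun _ => bot_le) fun t => ?_
      refine eLpNorm_le_mul_eLpNorm_of_ae_le_mul (Eventually.of_forall fun z => ?_) 2
      rw [← mul_sub, norm_mul]
      exact mul_le_mul_of_nonneg_right (hK z) (norm_nonneg _)
    refine (tendsto_integral_mul hBm (Eventually.of_forall fun t =>
      (hm.mul (hqmeas t)).aestronglyMeasurable) hB₀ hhq hBc hlim).congr fun t => ?_
    exact integral_congr_ae (Eventually.of_forall fun z => by simp only [Pi.mul_apply]; ring)
  have hweakσ : Tendsto (fun t => ∫ z, (f t z * q t z) * (s z / 2 * q₀ z) ∂μ) (𝓝[≠] 0)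
      (𝓝 (∫ z, (f₀ z * q₀ z) * (s z / 2 * q₀ z) ∂μ)) := by
    rw [Metric.tendsto_nhds]
    intro ε hε
    set B : ℝ := C + (eLpNorm (fun z => f₀ z * q₀ z) 2 μ).toReal + 1 with hB
    have hBpos : 0 < B := by positivity
    have hs2 : MemLp (fun z => s z / 2) 2 P₀ := by
      simpa [div_eq_inv_mul] using hs.const_mul (2⁻¹)
    obtain ⟨h, hm, hK, hL, hlt⟩ := exists_bounded_eLpNorm_sub_lt hs2
      (ε := ENNReal.ofReal (ε / (4 * B))) (by simp; positivity)
    have hhq : MemLp (fun z => h z * q₀ z) 2 μ := memLp_mul_sqrt_rnDeriv hP₀ hm hL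
    have hdiffL : MemLp (fun z => s z / 2 * q₀ z - h z * q₀ z) 2 μ := hσ.sub hhq
    have hdiff : (eLpNorm (fun z => s z / 2 * q₀ z - h z * q₀ z) 2 μ).toReal ≤ ε / (4 * B) := by
      have h1 := eLpNorm_mul_sqrt_rnDeriv hP₀ ((hsm.div_const 2).sub hm)
      have h2 : (fun z => s z / 2 * q₀ z - h z * q₀ z) = fun z => (s z / 2 - h z) * q₀ z := by
        ext; ring
      rw [h2]
      refine ENNReal.toReal_le_of_le_ofReal (by positivity) ?_
      exact h1.le.trans hlt.le
    filter_upwards [(Metric.tendsto_nhds.1 (hweak h hm hK)) (ε / 2) (by positivity), hA]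
      with t h1 h2
    have e1 : ∫ z, (f t z * q t z) * (s z / 2 * q₀ z) ∂μ
        = ∫ z, (f t z * q t z) * (h z * q₀ z) ∂μ
          + ∫ z, (f t z * q t z) * (s z / 2 * q₀ z - h z * q₀ z) ∂μ := by
      rw [← integral_add (integrable_mul_of_memLp_two h2.1 hhq)
        (integrable_mul_of_memLp_two h2.1 hdiffL)]
      exact integral_congr_ae (Eventually.of_forall fun z => by ring)
    have e2 : ∫ z, (f₀ z * q₀ z) * (s z / 2 * q₀ z) ∂μ
        = ∫ z, (f₀ z * q₀ z) * (h z * q₀ z) ∂μ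
          + ∫ z, (f₀ z * q₀ z) * (s z / 2 * q₀ z - h z * q₀ z) ∂μ := by
      rw [← integral_add (integrable_mul_of_memLp_two hB₀ hhq)
        (integrable_mul_of_memLp_two hB₀ hdiffL)]
      exact integral_congr_ae (Eventually.of_forall fun z => by ring)
    have b1 := abs_integral_mul_le h2.1 hdiffL
    have b2 := abs_integral_mul_le hB₀ hdiffL
    have c1 : (eLpNorm (fun z => f t z * q t z) 2 μ).toReal ≤ C := by
      simpa using ENNReal.toReal_mono (by simp) h2.2
    have b3 : ((eLpNorm (fun z => f t z * q t z) 2 μ).toReal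
        + (eLpNorm (fun z => f₀ z * q₀ z) 2 μ).toReal) *
          (eLpNorm (fun z => s z / 2 * q₀ z - h z * q₀ z) 2 μ).toReal ≤ ε / 4 := by
      calc _ ≤ B * (ε / (4 * B)) := by
            gcongr
            linarith
        _ = ε / 4 := by field_simp
    rw [Real.dist_eq] at h1 ⊢
    rw [e1, e2]
    rw [abs_lt] at h1 ⊢
    rw [abs_le] at b1 b2
    constructor <;> nlinarith [h1.1, h1.2, b1.1, b1.2, b2.1, b2.2]
  have T1 := (tendsto_integral_mul_zero (g := fun t z => D t z - s z / 2 * q₀ z)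
    (hA.mono fun _ h => h.1) (by filter_upwards [hDL] with t h using h.sub hσ)
    (hA.mono fun _ h => h.2) hqm').add hweakσ
  have T2 := tendsto_integral_mul hBm (by filter_upwards [hDL] with t h using h.1) hB₀ hσ hBc hqm'
  have T := T1.add T2
  have hlimit : 0 + ∫ z, (f₀ z * q₀ z) * (s z / 2 * q₀ z) ∂μ
      + ∫ z, (f₀ z * q₀ z) * (s z / 2 * q₀ z) ∂μ = ∫ z, f₀ z * s z ∂P₀ := by
    have := integral_mul_mul_rnDeriv hP₀ f₀ (fun z => s z / 2)
    rw [show ∫ z, (f₀ z * q₀ z) * (s z / 2 * q₀ z) ∂μ = ∫ z, f₀ z * (s z / 2) ∂P₀ from this]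
    have e : (fun z => f₀ z * (s z / 2)) = fun z => (f₀ z * s z) / 2 := by ext; ring
    rw [e, integral_div]
    ring
  rw [hlimit] at T
  refine T.congr' ?_
  filter_upwards [hP, hPμ, hA, hBL, hDL, hqL, self_mem_nhdsWithin]
    with t h1 h2 h3 h4 h5 h6 (h7 : t ≠ 0)
  have i1 : ∫ z, f t z ∂(P t) = ∫ z, (f t z * q t z) * q t z ∂μ := by
    have := integral_mul_mul_rnDeriv h2 (f t) (fun _ => 1)
    simp only [one_mul, mul_one] at this
    exact this.symm
  have i2 : ∫ z, f t z ∂P₀ = ∫ z, (f t z * q₀ z) * q₀ z ∂μ := by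
    have := integral_mul_mul_rnDeriv hP₀ (f t) (fun _ => 1)
    simp only [one_mul, mul_one] at this
    exact this.symm
  have j1 : Integrable (fun z => (f t z * q t z) * (D t z - s z / 2 * q₀ z)) μ :=
    integrable_mul_of_memLp_two h3.1 (h5.sub hσ)
  have j2 : Integrable (fun z => (f t z * q t z) * (s z / 2 * q₀ z)) μ :=
    integrable_mul_of_memLp_two h3.1 hσ
  have j12 : Integrable (fun z => (f t z * q t z) * (D t z - s z / 2 * q₀ z)
      + (f t z * q t z) * (s z / 2 * q₀ z)) μ := j1.add j2
  have j3 : Integrable (fun z => (f t z * q₀ z) * D t z) μ := integrable_mul_of_memLp_two h4 h5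
  have j4 : Integrable (fun z => (f t z * q t z) * q t z) μ := integrable_mul_of_memLp_two h3.1 h6
  have j5 : Integrable (fun z => (f t z * q₀ z) * q₀ z) μ := integrable_mul_of_memLp_two h4 hq₀L
  rw [← integral_add j1 j2, ← integral_add j12 j3, i1, i2, ← integral_sub j4 j5,
    ← integral_div]
  refine integral_congr_ae (Eventually.of_forall fun z => ?_)
  simp only [hD]
  field_simp
  ring

end QuadraticMean

/-! ### Paths of laws with bounded densities -/

section DensityPath

theorem integral_withDensity_ofReal {Ω : Type*} [MeasurableSpace Ω] {P : Measure Ω} {ρ : Ω → ℝ}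
    (hρ : Measurable ρ) (hρ0 : ∀ z, 0 ≤ ρ z) (f : Ω → ℝ) :
    ∫ z, f z ∂(P.withDensity fun z => ENNReal.ofReal (ρ z)) = ∫ z, ρ z * f z ∂P := by
  rw [integral_withDensity_eq_integral_toReal_smul hρ.ennreal_ofReal
    (Eventually.of_forall fun _ => ENNReal.ofReal_lt_top)]
  simp [ENNReal.toReal_ofReal (hρ0 _)]

theorem setIntegral_withDensity_ofReal {Ω : Type*} [MeasurableSpace Ω] {P : Measure Ω} {ρ : Ω → ℝ}
    (hρ : Measurable ρ) (hρ0 : ∀ z, 0 ≤ ρ z) (f : Ω → ℝ) {B : Set Ω} (hB : MeasurableSet B) :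
    ∫ z in B, f z ∂(P.withDensity fun z => ENNReal.ofReal (ρ z)) = ∫ z in B, ρ z * f z ∂P := by
  rw [setIntegral_withDensity_eq_setIntegral_toReal_smul hρ.ennreal_ofReal
    (Eventually.of_forall fun _ => ENNReal.ofReal_lt_top) _ hB]
  simp [ENNReal.toReal_ofReal (hρ0 _)]

theorem isProbabilityMeasure_withDensity_ofReal {Ω : Type*} [MeasurableSpace Ω] {P : Measure Ω}
    [IsProbabilityMeasure P] {ρ : Ω → ℝ} (hρ0 : ∀ z, 0 ≤ ρ z) (hρi : Integrable ρ P)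
    (hρ1 : ∫ z, ρ z ∂P = 1) :
    IsProbabilityMeasure (P.withDensity fun z => ENNReal.ofReal (ρ z)) := by
  constructor
  rw [withDensity_apply _ MeasurableSet.univ, Measure.restrict_univ,
    ← ofReal_integral_eq_lintegral_ofReal hρi (Eventually.of_forall hρ0), hρ1, ENNReal.ofReal_one]

theorem withDensity_ofReal_le {Ω : Type*} [MeasurableSpace Ω] {P : Measure Ω} {ρ : Ω → ℝ} {C : ℝ}
    (hρ : ∀ z, ρ z ≤ C) :
    P.withDensity (fun z => ENNReal.ofReal (ρ z)) ≤ ENNReal.ofReal C • P := by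
  rw [← withDensity_const]
  exact withDensity_mono (Eventually.of_forall fun z => ENNReal.ofReal_le_ofReal (hρ z))

theorem abs_sqrt_sub_one_div_sub_le {r t u K e : ℝ} (hr : 0 ≤ r) (ht : t ≠ 0) (hu : |u| ≤ K)
    (he : |(r - 1) / t - u| ≤ e) :
    |(√r - 1) / t - u / 2| ≤ e + K * (|t| * (K + e)) := by
  have hr1 : |r - 1| ≤ |t| * (K + e) := by
    have h1 : r - 1 = t * ((r - 1) / t) := by field_simp
    have h2 : |(r - 1) / t| ≤ K + e := by
      have := abs_add_le ((r - 1) / t - u) u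
      rw [sub_add_cancel] at this
      linarith
    rw [h1, abs_mul]
    gcongr
  have hs := Real.sqrt_nonneg r
  have hp : 0 < √r + 1 := by linarith
  have hsq : √r * √r = r := Real.mul_self_sqrt hr
  have hs1 : |√r - 1| ≤ |r - 1| := by
    have : r - 1 = (√r - 1) * (√r + 1) := by linear_combination -hsq
    rw [this, abs_mul, abs_of_pos hp]
    nlinarith [abs_nonneg (√r - 1)]
  have hK : 0 ≤ K := (abs_nonneg u).trans hu
  have key : (√r - 1) / t - u / 2
      = ((r - 1) / t - u) / (√r + 1) + u * ((1 - √r) / (2 * (√r + 1))) := by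
    field_simp
    linear_combination (2 : ℝ) * hsq
  rw [key]
  refine (abs_add_le _ _).trans (add_le_add ?_ ?_)
  · rw [abs_div, abs_of_pos hp]
    exact (div_le_self (abs_nonneg _) (by linarith)).trans he
  · rw [abs_mul, abs_div, abs_of_pos (by linarith : 0 < 2 * (√r + 1)), abs_sub_comm 1]
    refine mul_le_mul hu ?_ (by positivity) hK
    exact (div_le_self (abs_nonneg _) (by linarith)).trans (hs1.trans hr1)

variable {q d : ℕ} {ι : Type}

/-- Along a path with densities `ρ_t` with respect to `P₀` whose difference quotients at `t = 0`
converge uniformly to a bounded function `u`, the densities are eventually uniformly near `1`. -/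
theorem eventually_abs_density_sub_one_le {Ω : Type*} {ρ : ℝ → Ω → ℝ} (hρ0 : ∀ z, ρ 0 z = 1)
    {u : Ω → ℝ} {K : ℝ} (huK : ∀ z, |u z| ≤ K)
    {ε : ℝ → ℝ} (hε : Tendsto ε (𝓝[≠] 0) (𝓝 0))
    (hρε : ∀ᶠ t in 𝓝[≠] 0, ∀ z, |(ρ t z - 1) / t - u z| ≤ ε t) :
    ∀ᶠ t in 𝓝 (0 : ℝ), ∀ z, |ρ t z - 1| ≤ 1 / 2 := by
  have hid : Tendsto (fun t : ℝ => |t|) (𝓝[≠] 0) (𝓝 0) :=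
    (by simpa using (continuous_abs (G := ℝ)).tendsto 0 :
      Tendsto (fun t : ℝ => |t|) (𝓝 0) (𝓝 0)).mono_left nhdsWithin_le_nhds
  have h : Tendsto (fun t => |t| * (K + ε t)) (𝓝[≠] 0) (𝓝 0) := by
    simpa using hid.mul (hε.const_add K)
  have h1 : ∀ᶠ t in 𝓝[≠] (0 : ℝ), ∀ z, |ρ t z - 1| ≤ 1 / 2 := by
    filter_upwards [h.eventually (gt_mem_nhds (by norm_num : (0 : ℝ) < 1 / 2)), hρε,
      self_mem_nhdsWithin] with t h1 h3 (h2 : t ≠ 0) z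
    refine le_trans ?_ h1.le
    have e1 : ρ t z - 1 = t * ((ρ t z - 1) / t) := by field_simp
    have e2 : |(ρ t z - 1) / t| ≤ K + ε t := by
      have := abs_add_le ((ρ t z - 1) / t - u z) (u z)
      rw [sub_add_cancel] at this
      linarith [h3 z, huK z]
    rw [e1, abs_mul]
    gcongr
  rw [eventually_nhdsWithin_iff] at h1
  filter_upwards [h1] with t ht z
  by_cases h0 : t = 0
  · simp [h0, hρ0]
  · exact ht h0 z

/-- A path of laws whose densities with respect to `P₀` have uniformly convergent difference
quotients is a regular submodel, as soon as it satisfies the restrictions. -/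
theorem isRegularSubmodel_withDensity {μ P₀ : Measure (Fin q → ℝ)} [SigmaFinite μ]
    [IsProbabilityMeasure P₀] (hμ : P₀ ≪ μ) {Θ : Set (Fin d → ℝ)} {θ₀ : Fin d → ℝ} (hΘ : Θ ∈ 𝓝 θ₀)
    {R : (Fin d → ℝ) → Measure (Fin q → ℝ) → Prop} {m : ι → (Fin q → ℝ) → (Fin d → ℝ) → ℝ}
    {θ : ℝ → Fin d → ℝ} {a : Fin d → ℝ} (hθ0 : θ 0 = θ₀) (hθ : HasDerivAt θ a 0)
    {ρ : ℝ → (Fin q → ℝ) → ℝ} (hρm : ∀ t, Measurable (ρ t)) (hρ0 : ∀ z, ρ 0 z = 1)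
    (hρ1 : ∀ t, ∫ z, ρ t z ∂P₀ = 1) {u : (Fin q → ℝ) → ℝ} (hu : Measurable u) {K : ℝ}
    (huK : ∀ z, |u z| ≤ K) {ε : ℝ → ℝ} (hε : Tendsto ε (𝓝[≠] 0) (𝓝 0))
    (hρε : ∀ᶠ t in 𝓝[≠] 0, ∀ z, |(ρ t z - 1) / t - u z| ≤ ε t)
    (hm : ∃ C : ℝ≥0, ∀ᶠ θ in 𝓝 θ₀, ∀ i, eLpNorm (fun z => m i z θ) 2 P₀ ≤ C)
    (hR : ∀ᶠ t in 𝓝 (0 : ℝ), (∀ z, |ρ t z - 1| ≤ 1 / 2) →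
      R (θ t) (P₀.withDensity fun z => ENNReal.ofReal (ρ t z))) :
    IsRegularSubmodel μ P₀ Θ θ₀ R m θ (fun t => P₀.withDensity fun z => ENNReal.ofReal (ρ t z))
      a u := by
  have hnear := eventually_abs_density_sub_one_le hρ0 huK hε hρε
  have hθc : Tendsto θ (𝓝 0) (𝓝 θ₀) := hθ0 ▸ hθ.continuousAt.tendsto
  refine ⟨hθ0, by simp [hρ0], ?_, ?_, hθc.eventually hΘ, ?_, hθ,
    memLp_two_of_bounded hu.aestronglyMeasurable huK, ?_, ?_⟩
  · filter_upwards [hnear] with t ht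
    have h0 : ∀ z, 0 ≤ ρ t z := fun z => by have := abs_le.1 (ht z); linarith
    refine isProbabilityMeasure_withDensity_ofReal h0 ?_ (hρ1 t)
    refine Integrable.of_bound (hρm t).aestronglyMeasurable 2 (Eventually.of_forall fun z => ?_)
    have := abs_le.1 (ht z)
    rw [Real.norm_eq_abs, abs_le]
    constructor <;> linarith
  · exact Eventually.of_forall fun t => (withDensity_absolutelyContinuous _ _).trans hμ
  · filter_upwards [hnear, hR] with t h1 h2 using h2 h1
  · -- the pointwise bound `|(√ρ_t - 1)/t - u/2| ≤ δ_t`, uniformly, with `δ_t → 0`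
    set δ : ℝ → ℝ := fun t => ε t + K * (|t| * (K + ε t)) with hδ
    have hid : Tendsto (fun t : ℝ => |t|) (𝓝[≠] 0) (𝓝 0) :=
      (by simpa using (continuous_abs (G := ℝ)).tendsto 0 :
        Tendsto (fun t : ℝ => |t|) (𝓝 0) (𝓝 0)).mono_left nhdsWithin_le_nhds
    have hδ0 : Tendsto δ (𝓝[≠] 0) (𝓝 0) := by
      simpa using hε.add ((hid.mul (hε.const_add K)).const_mul K)
    set N := eLpNorm (fun z => √(P₀.rnDeriv μ z).toReal) 2 μ with hN
    have hNfin : N ≠ ∞ := (memLp_sqrt_rnDeriv hμ).2.ne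
    have hlim : Tendsto (fun t => ENNReal.ofReal (δ t) * N) (𝓝[≠] 0) (𝓝 0) := by
      have := ENNReal.Tendsto.mul_const (ENNReal.tendsto_ofReal hδ0) (Or.inr hNfin)
      simpa using this
    refine tendsto_of_tendsto_of_tendsto_of_le_of_le' tendsto_const_nhds hlim
      (Eventually.of_forall fun _ => bot_le) ?_
    filter_upwards [hnear.filter_mono nhdsWithin_le_nhds, hρε, self_mem_nhdsWithin]
      with t ht hte (h0 : t ≠ 0)
    refine eLpNorm_le_mul_eLpNorm_of_ae_le_mul ?_ 2
    filter_upwards [Measure.rnDeriv_withDensity_left_of_absolutelyContinuous hμ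
      (hρm t).ennreal_ofReal.aemeasurable] with z hz
    have hr : 0 ≤ ρ t z := by have := abs_le.1 (ht z); linarith
    have hb := abs_sqrt_sub_one_div_sub_le hr h0 (huK z) (hte z)
    rw [hz, ENNReal.toReal_mul, ENNReal.toReal_ofReal hr, Real.sqrt_mul hr]
    set p := √(P₀.rnDeriv μ z).toReal
    have e : (√(ρ t z) * p - p) / t - u z / 2 * p = ((√(ρ t z) - 1) / t - u z / 2) * p := by
      ring
    rw [e, norm_mul]
    exact mul_le_mul_of_nonneg_right hb (norm_nonneg _)
  · obtain ⟨C, hC⟩ := hm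
    refine ⟨((ENNReal.ofReal 2) ^ (1 / (2 : ℝ≥0∞)).toReal * C).toNNReal, ?_⟩
    filter_upwards [hnear, hθc.eventually hC] with t h1 h2 i
    rw [ENNReal.coe_toNNReal (ENNReal.mul_ne_top
      (ENNReal.rpow_ne_top_of_nonneg ENNReal.toReal_nonneg ENNReal.ofReal_ne_top)
      ENNReal.coe_ne_top)]
    refine (eLpNorm_mono_measure _ (withDensity_ofReal_le (C := 2) fun z => ?_)).trans ?_
    · have := abs_le.1 (h1 z); linarith
    · rw [eLpNorm_smul_measure_of_ne_top (by norm_num), smul_eq_mul]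
      gcongr
      exact h2 i

end DensityPath

/-! ### Multiplication by a moment function as an operator on the instruments -/

section Multiplier

variable {Ω X : Type*} [MeasurableSpace Ω] [MeasurableSpace X] {P : Measure Ω} {π : Ω → X}

theorem comp_ae_eq_comp (hπ : Measurable π) {α β : X → ℝ} (h : α =ᵐ[P.map π] β) :
    (fun z => α (π z)) =ᵐ[P] fun z => β (π z) :=
  ae_of_ae_map hπ.aemeasurable h

/-- Fatou's lemma makes sublevel sets of `α ↦ ‖α(π) G‖₂` closed. -/
theorem isClosed_setOf_eLpNorm_comp_mul_le (hπ : Measurable π) {G : Ω → ℝ} (hG : Measurable G)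
    (c : ℝ≥0∞) :
    IsClosed {α : Lp ℝ 2 (P.map π) | eLpNorm (fun z => α (π z) * G z) 2 P ≤ c} := by
  refine IsSeqClosed.isClosed fun u α hu hα => ?_
  obtain ⟨ns, -, hns⟩ := (tendstoInMeasure_of_tendsto_Lp hα).exists_seq_tendsto_ae
  have hae := ae_of_ae_map hπ.aemeasurable hns
  have hm : ∀ n, AEStronglyMeasurable (fun z => u (ns n) (π z) * G z) P := fun n =>
    (((Lp.stronglyMeasurable _).measurable.comp hπ).mul hG).aestronglyMeasurable
  refine (Lp.eLpNorm_lim_le_liminf_eLpNorm hm (fun z => α (π z) * G z) ?_).trans ?_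
  · filter_upwards [hae] with z hz using hz.mul_const _
  · refine (liminf_le_liminf (v := fun _ => c) (Eventually.of_forall fun n => hu (ns n))).trans ?_
    simp

/-- An everywhere defined multiplication operator between `L²` spaces that is bounded on a ball is a
continuous linear map. -/
theorem exists_multiplier_of_ball_bound (hπ : Measurable π) {G : Ω → ℝ} (hG : Measurable G)
    {r : ℝ} (hr : 0 < r) {N : ℝ≥0}
    (h : ∀ α : Lp ℝ 2 (P.map π), ‖α‖ < r → eLpNorm (fun z => α (π z) * G z) 2 P ≤ N) :
    ∃ S : Lp ℝ 2 (P.map π) →L[ℝ] Lp ℝ 2 P, ∀ α, S α =ᵐ[P] fun z => α (π z) * G z := by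
  have hm : ∀ α : Lp ℝ 2 (P.map π), AEStronglyMeasurable (fun z => α (π z) * G z) P := fun α =>
    (((Lp.stronglyMeasurable _).measurable.comp hπ).mul hG).aestronglyMeasurable
  have hL : ∀ α : Lp ℝ 2 (P.map π), MemLp (fun z => α (π z) * G z) 2 P := by
    intro α
    set c : ℝ := r / (2 * (‖α‖ + 1)) with hc
    have hc0 : 0 < c := by positivity
    have h1 : ‖c • α‖ < r := by
      rw [norm_smul, Real.norm_of_nonneg hc0.le, hc, div_mul_eq_mul_div,
        div_lt_iff₀ (by positivity)]
      nlinarith [norm_nonneg α]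
    have h2 : MemLp (fun z => (c • α) (π z) * G z) 2 P :=
      ⟨hm _, (h _ h1).trans_lt ENNReal.coe_lt_top⟩
    refine (memLp_congr_ae ?_).1 (h2.const_mul c⁻¹)
    filter_upwards [comp_ae_eq_comp hπ (Lp.coeFn_smul c α)] with z hz
    rw [hz]
    simp only [Pi.smul_apply, smul_eq_mul]
    field_simp
  let S : Lp ℝ 2 (P.map π) →ₗ[ℝ] Lp ℝ 2 P :=
    { toFun := fun α => (hL α).toLp _
      map_add' := fun α β => by
        rw [← MemLp.toLp_add]
        refine MemLp.toLp_congr _ _ ?_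
        filter_upwards [comp_ae_eq_comp hπ (Lp.coeFn_add α β)] with z hz
        rw [hz]
        simp only [Pi.add_apply]
        ring
      map_smul' := fun c α => by
        rw [RingHom.id_apply, ← MemLp.toLp_const_smul]
        refine MemLp.toLp_congr _ _ ?_
        filter_upwards [comp_ae_eq_comp hπ (Lp.coeFn_smul c α)] with z hz
        rw [hz]
        simp only [Pi.smul_apply, smul_eq_mul]
        ring }
  obtain ⟨C, hC⟩ := LinearMap.bound_of_ball_bound hr N S fun α hα => by
    change ‖(hL α).toLp _‖ ≤ N
    rw [Lp.norm_toLp]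
    simpa using ENNReal.toReal_mono (by simp) (h α (by simpa using hα))
  exact ⟨S.mkContinuous C hC, fun α => (hL α).coeFn_toLp⟩

variable {T : Type*} [PseudoMetricSpace T] {G : T → Ω → ℝ} {θ₀ : T}

/-- By Baire's theorem, moment functions whose products with every square-integrable instrument are
square-integrable near `θ₀` and continuous at `θ₀` define, for all `θ` near `θ₀`, continuous
multiplication operators on the whole space of instruments. -/
theorem eventually_exists_multiplier (hπ : Measurable π) (hGm : ∀ θ, Measurable (G θ))
    (hG : ∀ α : X → ℝ, Measurable α → MemLp α 2 (P.map π) →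
      (∀ᶠ θ in 𝓝 θ₀, MemLp (fun z => α (π z) * G θ z) 2 P) ∧
      Tendsto (fun θ => eLpNorm (fun z => α (π z) * G θ z - α (π z) * G θ₀ z) 2 P) (𝓝 θ₀) (𝓝 0)) :
    ∀ᶠ θ in 𝓝 θ₀, ∃ S : Lp ℝ 2 (P.map π) →L[ℝ] Lp ℝ 2 P,
      ∀ α, S α =ᵐ[P] fun z => α (π z) * G θ z := by
  let F : ℕ → Set (Lp ℝ 2 (P.map π)) := fun n => {α | ∀ θ ∈ Metric.ball θ₀ (1 / ((n : ℝ) + 1)),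
    eLpNorm (fun z => α (π z) * G θ z) 2 P ≤ n}
  -- the instruments whose products are bounded by `n` on a ball of radius `1 / (n + 1)`: closed sets
  -- that cover the space
  have hFc : ∀ n, IsClosed (F n) := fun n => by
    have : F n = ⋂ θ ∈ Metric.ball θ₀ (1 / ((n : ℝ) + 1)),
        {α : Lp ℝ 2 (P.map π) | eLpNorm (fun z => α (π z) * G θ z) 2 P ≤ (n : ℝ≥0∞)} := by
      ext α; simp [F]
    rw [this]
    exact isClosed_biInter fun θ _ => isClosed_setOf_eLpNorm_comp_mul_le hπ (hGm θ) _
  have hFu : ⋃ n, F n = Set.univ := by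
    refine Set.eq_univ_of_forall fun α => ?_
    have hα := (Lp.stronglyMeasurable α).measurable
    obtain ⟨h1, h2⟩ := hG α hα (Lp.memLp α)
    obtain ⟨C, hC⟩ := eventually_eLpNorm_le_of_tendsto
      (Eventually.of_forall fun θ => ((hα.comp hπ).mul (hGm θ)).aestronglyMeasurable)
      h1.self_of_nhds h2
    obtain ⟨δ, hδ, hball⟩ := Metric.eventually_nhds_iff_ball.1 hC
    obtain ⟨n, hn⟩ := exists_nat_gt (max (C : ℝ) (1 / δ))
    refine Set.mem_iUnion.2 ⟨n, fun θ hθ => (hball θ (Metric.ball_subset_ball ?_ hθ)).trans ?_⟩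
    · rw [one_div_le (by positivity) hδ]
      linarith [(le_max_right (C : ℝ) (1 / δ)).trans hn.le]
    · have : (C : ℝ) ≤ n := (le_max_left (C : ℝ) (1 / δ)).trans hn.le
      exact_mod_cast this
  obtain ⟨n, α₀, hα₀⟩ := nonempty_interior_of_iUnion_of_closed hFc hFu
  obtain ⟨r, hr, hball⟩ := Metric.mem_nhds_iff.1 (mem_interior_iff_mem_nhds.1 hα₀)
  filter_upwards [Metric.ball_mem_nhds θ₀ (by positivity : 0 < 1 / ((n : ℝ) + 1))] with θ hθ
  refine exists_multiplier_of_ball_bound hπ (hGm θ) hr (N := 2 * n) fun α hα => ?_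
  have h1 := hball (show α₀ + α ∈ Metric.ball α₀ r by simpa using hα) θ hθ
  have h2 := hball (Metric.mem_ball_self hr) θ hθ
  have hm : ∀ α : Lp ℝ 2 (P.map π), AEStronglyMeasurable (fun z => α (π z) * G θ z) P := fun α =>
    (((Lp.stronglyMeasurable _).measurable.comp hπ).mul (hGm θ)).aestronglyMeasurable
  have h3 : (fun z => α (π z) * G θ z) =ᵐ[P]
      (fun z => (α₀ + α) (π z) * G θ z) - fun z => α₀ (π z) * G θ z := by
    filter_upwards [comp_ae_eq_comp hπ (Lp.coeFn_add α₀ α)] with z hz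
    simp only [Pi.sub_apply, hz, Pi.add_apply]
    ring
  rw [eLpNorm_congr_ae h3]
  refine (eLpNorm_sub_le (hm _) (hm _) (by norm_num)).trans ((add_le_add h1 h2).trans ?_)
  simp [two_mul]

/-- A continuous linear functional on `L²` that vanishes on indicators is zero. -/
theorem clm_eq_zero_of_indicator {ν : Measure X} [IsFiniteMeasure ν] (F : Lp ℝ 2 ν →L[ℝ] ℝ)
    (h : ∀ B (hB : MeasurableSet B), F (indicatorConstLp 2 hB (measure_ne_top ν B) 1) = 0) :
    F = 0 := by
  ext α
  refine Lp.induction (by norm_num) (fun α => F α = (0 : Lp ℝ 2 ν →L[ℝ] ℝ) α) ?_ ?_ ?_ α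
  · intro c B hB hfin
    rw [Lp.simpleFunc.coe_indicatorConst]
    have : indicatorConstLp 2 hB hfin.ne c
        = c • indicatorConstLp 2 hB (measure_ne_top ν B) (1 : ℝ) := by
      refine Lp.ext ?_
      filter_upwards [indicatorConstLp_coeFn (p := 2) (hs := hB) (hμs := hfin.ne) (c := c),
        Lp.coeFn_smul c (indicatorConstLp 2 hB (measure_ne_top ν B) (1 : ℝ)),
        indicatorConstLp_coeFn (p := 2) (hs := hB) (hμs := measure_ne_top ν B) (c := (1 : ℝ))]
        with x h1 h2 h3
      rw [h1, h2, Pi.smul_apply, h3]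
      by_cases hx : x ∈ B <;> simp [hx]
    rw [this, map_smul, h B hB]
    simp
  · intro f g hf hg _ h1 h2
    rw [map_add, h1, h2]
    simp
  · exact isClosed_eq F.continuous continuous_const

/-- Square-integrable functions of `π` are instruments. -/
theorem exists_Lp_comp_ae_eq (hπ : Measurable π) {β : Ω → ℝ}
    (hβ : Measurable[MeasurableSpace.comap π inferInstance] β) (hL : MemLp β 2 P) :
    ∃ α : Lp ℝ 2 (P.map π), (fun z => α (π z)) =ᵐ[P] β := by
  obtain ⟨φ, hφ, rfl⟩ := hβ.exists_eq_measurable_comp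
  have h : MemLp φ 2 (P.map π) :=
    (memLp_map_measure_iff hφ.aestronglyMeasurable hπ.aemeasurable).2 hL
  exact ⟨h.toLp φ, comp_ae_eq_comp hπ h.coeFn_toLp⟩

theorem memLp_comp (hπ : Measurable π) (α : Lp ℝ 2 (P.map π)) :
    MemLp (fun z => α (π z)) 2 P :=
  (memLp_map_measure_iff (Lp.stronglyMeasurable α).aestronglyMeasurable hπ.aemeasurable).1
    (Lp.memLp α)

end Multiplier

section Derivative

variable {Ω X E : Type*} [MeasurableSpace Ω] [MeasurableSpace X] {P : Measure Ω}
  [IsProbabilityMeasure P] {π : Ω → X} [NormedAddCommGroup E] [NormedSpace ℝ E] {G : E → Ω → ℝ}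
  {θ₀ : E}

/-- By the Banach–Steinhaus theorem, the derivative at `θ₀` of the moments `E[α(π) G_θ]` is a
continuous function of the instrument `α`. -/
theorem exists_derivative_functional
    (hS : ∀ᶠ θ in 𝓝 θ₀, ∃ S : Lp ℝ 2 (P.map π) →L[ℝ] Lp ℝ 2 P,
      ∀ α, S α =ᵐ[P] fun z => α (π z) * G θ z)
    (hd : ∀ α : Lp ℝ 2 (P.map π),
      DifferentiableAt ℝ (fun θ => ∫ z, α (π z) * G θ z ∂P) θ₀) (a : E) :
    ∃ D : Lp ℝ 2 (P.map π) →L[ℝ] ℝ,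
      ∀ α, D α = fderiv ℝ (fun θ => ∫ z, α (π z) * G θ z ∂P) θ₀ a := by
  classical
  have hpath : HasDerivAt (fun t : ℝ => θ₀ + t • a) a 0 := by
    simpa using ((hasDerivAt_id (0 : ℝ)).smul_const a).const_add θ₀
  have hI : ∀ θ, ∃ I : Lp ℝ 2 (P.map π) →L[ℝ] ℝ,
      (∃ S : Lp ℝ 2 (P.map π) →L[ℝ] Lp ℝ 2 P, ∀ α, S α =ᵐ[P] fun z => α (π z) * G θ z) →
      ∀ α, I α = ∫ z, α (π z) * G θ z ∂P := by
    intro θ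
    by_cases h : ∃ S : Lp ℝ 2 (P.map π) →L[ℝ] Lp ℝ 2 P, ∀ α, S α =ᵐ[P] fun z => α (π z) * G θ z
    · obtain ⟨S, hS⟩ := h
      have h1 : MemLp (fun _ : Ω => (1 : ℝ)) 2 P := memLp_const 1
      refine ⟨(innerSL ℝ (h1.toLp _)).comp S, fun _ α => ?_⟩
      rw [ContinuousLinearMap.comp_apply, innerSL_apply_apply, L2.inner_def]
      refine integral_congr_ae ?_
      filter_upwards [h1.coeFn_toLp, hS α] with z e1 e2
      rw [e1, e2]
      simp
    · exact ⟨0, fun h' => absurd h' h⟩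
  choose I hI using hI
  -- the difference quotients are continuous functionals that converge pointwise
  have hlim : Tendsto (fun (t : ℝ) (α : Lp ℝ 2 (P.map π)) =>
      (t⁻¹ • (I (θ₀ + t • a) - I θ₀)) α) (𝓝[≠] 0)
      (𝓝 fun α => fderiv ℝ (fun θ => ∫ z, α (π z) * G θ z ∂P) θ₀ a) := by
    rw [tendsto_pi_nhds]
    intro α
    have h1 : HasDerivAt (fun t : ℝ => ∫ z, α (π z) * G (θ₀ + t • a) z ∂P)
        (fderiv ℝ (fun θ => ∫ z, α (π z) * G θ z ∂P) θ₀ a) 0 := by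
      have h0 : HasFDerivAt (fun θ => ∫ z, α (π z) * G θ z ∂P)
          (fderiv ℝ (fun θ => ∫ z, α (π z) * G θ z ∂P) θ₀) (θ₀ + (0 : ℝ) • a) := by
        simpa using (hd α).hasFDerivAt
      exact h0.comp_hasDerivAt (0 : ℝ) hpath
    rw [hasDerivAt_iff_tendsto_slope] at h1
    refine h1.congr' ?_
    have h2 : Tendsto (fun t : ℝ => θ₀ + t • a) (𝓝[≠] 0) (𝓝 θ₀) := by
      simpa using (hpath.continuousAt.tendsto).mono_left (nhdsWithin_le_nhds (s := {0}ᶜ))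
    filter_upwards [h2.eventually hS] with t ht
    simp only [slope, sub_zero, zero_smul, add_zero, vsub_eq_sub]
    rw [smul_apply, sub_apply, hI _ ht,
      hI _ hS.self_of_nhds]
  exact ⟨continuousLinearMapOfTendsto _ hlim, fun α => rfl⟩

end Derivative

/-! ### Bounded functions dual to the moment functions -/

section DualSystem

theorem measurable_subvector {q : ℕ} (c : Finset (Fin q)) : Measurable (subvector c) :=
  measurable_pi_lambda _ fun _ => measurable_pi_apply _

theorem subvectorSigma_le {q : ℕ} (c : Finset (Fin q)) :
    subvectorSigma c ≤ (inferInstance : MeasurableSpace (Fin q → ℝ)) :=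
  (measurable_subvector c).comap_le

/-- The sigma-algebra generated by `X = (X^(1), …, X^(J))`. -/
@[reducible] def jointSigma {q J : ℕ} (c : Fin J → Finset (Fin q)) : MeasurableSpace (Fin q → ℝ) :=
  ⨆ j, subvectorSigma (c j)

theorem jointSigma_le {q J : ℕ} (c : Fin J → Finset (Fin q)) :
    jointSigma c ≤ (inferInstance : MeasurableSpace (Fin q → ℝ)) :=
  iSup_le fun _ => subvectorSigma_le _

theorem subvectorSigma_le_jointSigma {q J : ℕ} (c : Fin J → Finset (Fin q)) (j : Fin J) :
    subvectorSigma (c j) ≤ jointSigma c :=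
  le_iSup (fun j => subvectorSigma (c j)) j

theorem measurable_matrix_det {Ω κ : Type*} {m : MeasurableSpace Ω} [Fintype κ] [DecidableEq κ]
    {S : Ω → Matrix κ κ ℝ} (hS : ∀ k l, Measurable fun z => S z k l) :
    Measurable fun z => (S z).det := by
  simp only [Matrix.det_apply']
  exact Finset.measurable_sum _ fun σ _ =>
    (Finset.measurable_prod _ fun k _ => hS _ _).const_mul _

theorem measurable_matrix_inv {Ω κ : Type*} {m : MeasurableSpace Ω} [Fintype κ] [DecidableEq κ]
    {S : Ω → Matrix κ κ ℝ} (hS : ∀ k l, Measurable fun z => S z k l) (k l : κ) :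
    Measurable fun z => (S z)⁻¹ k l := by
  simp only [Matrix.inv_def, Matrix.smul_apply, Ring.inverse_eq_inv', smul_eq_mul,
    Matrix.adjugate_apply]
  refine (measurable_matrix_det hS).inv.mul (measurable_matrix_det fun a b => ?_)
  by_cases h : a = l
  · subst h; simp
  · simpa [Matrix.updateRow_ne h] using hS a b

theorem measurable_condSecondMoment {q : ℕ} {κ ν : Type} {P₀ : Measure (Fin q → ℝ)}
    {𝒢 : MeasurableSpace (Fin q → ℝ)} (u : (Fin q → ℝ) → κ → ℝ)
    (v : (Fin q → ℝ) → ν → ℝ) (k : κ) (l : ν) :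
    Measurable[𝒢] fun z => condSecondMoment P₀ 𝒢 u v z k l :=
  stronglyMeasurable_condExp.measurable

theorem ae_abs_condExp_le {Ω : Type*} {m m₀ : MeasurableSpace Ω} {P : Measure Ω} {f : Ω → ℝ}
    {K : ℝ} (hf : ∀ᵐ z ∂P, |f z| ≤ K) : ∀ᵐ z ∂P, |(P[f | m]) z| ≤ K := by
  exact ae_bdd_abs_condExp_of_ae_bdd_abs hf

/-- An essentially bounded function agrees almost surely with a bounded one. -/
theorem exists_bounded_representative {Ω : Type*} {m m₀ : MeasurableSpace Ω} {P : Measure[m₀] Ω}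
    {f : Ω → ℝ} (hm : Measurable[m] f) {K : ℝ} (hf : ∀ᵐ z ∂P, |f z| ≤ K) :
    ∃ f' : Ω → ℝ, Measurable[m] f' ∧ (∀ z, |f' z| ≤ |K|) ∧ f' =ᵐ[P] f := by
  refine ⟨fun z => max (-|K|) (min |K| (f z)), measurable_const.max (measurable_const.min hm),
    fun z => ?_, ?_⟩
  · have := abs_nonneg K
    rw [abs_le]
    exact ⟨le_max_left _ _, max_le (by linarith) (min_le_left _ _)⟩
  · filter_upwards [hf] with z hz
    have h := abs_le.1 (hz.trans (le_abs_self K))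
    rw [min_eq_right h.2, max_eq_right h.1]

/-- Pulling a conditional expectation out of an integral. -/
theorem integral_mul_condExp {Ω : Type*} {m m₀ : MeasurableSpace Ω} {P : Measure[m₀] Ω}
    [IsProbabilityMeasure P] (hm : m ≤ m₀) {ψ f : Ω → ℝ} (hψ : Measurable[m] ψ)
    (hf : Integrable f P) (hψf : Integrable (fun z => ψ z * f z) P) :
    ∫ z, ψ z * f z ∂P = ∫ z, ψ z * (P[f | m]) z ∂P := by
  rw [← integral_condExp hm]
  exact integral_congr_ae (condExp_mul_of_stronglyMeasurable_left hψ.stronglyMeasurable hψf hf)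

theorem integrable_mul_of_ae_bounded {Ω : Type*} [MeasurableSpace Ω] {P : Measure Ω}
    {f h : Ω → ℝ} (hf : Integrable f P) (hh : AEStronglyMeasurable h P) {K : ℝ}
    (hK : ∀ᵐ z ∂P, |h z| ≤ K) : Integrable (fun z => f z * h z) P :=
  hf.mul_bdd hh hK

variable {q d J : ℕ} {p : Fin J → ℕ} {c : Fin J → Finset (Fin q)}
  {g : (j : Fin J) → (Fin q → ℝ) → (Fin d → ℝ) → Fin (p j) → ℝ}
  {P₀ : Measure (Fin q → ℝ)} {θ₀ : Fin d → ℝ} {A : Set (Fin q → ℝ)}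

theorem measurable_localized (hg : ∀ j θ k, Measurable fun z => g j z θ k) (hA : MeasurableSet A)
    (i : Fin J) (k : Fin (p i)) : Measurable fun z => localized g θ₀ A i z k := by
  have : (fun z => localized g θ₀ A i z k) = A.indicator fun z => g i z θ₀ k := by
    ext z
    by_cases hz : z ∈ A <;> simp [localized, hz]
  rw [this]
  exact (hg i θ₀ k).indicator hA

theorem localizedResidual_eq (i : Fin J) (k : Fin (p i)) (z : Fin q → ℝ) :
    localizedResidual c g P₀ θ₀ A i z k = localized g θ₀ A i z k
      - ∑ y, (condSecondMoment P₀ (⨆ j, subvectorSigma (c j)) (localized g θ₀ A i)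
        (localizedOthers g θ₀ A i) z *
      (condSecondMoment P₀ (⨆ j, subvectorSigma (c j)) (localizedOthers g θ₀ A i)
        (localizedOthers g θ₀ A i) z)⁻¹) k y * localizedOthers g θ₀ A i z y := by
  simp [localizedResidual, Matrix.mulVec, dotProduct]

theorem localizedResidual_mul_localized (i : Fin J) (k : Fin (p i)) (j : Fin J) (l : Fin (p j))
    (z : Fin q → ℝ) :
    localizedResidual c g P₀ θ₀ A i z k * localized g θ₀ A j z l
      = localizedResidual c g P₀ θ₀ A i z k * g j z θ₀ l := by
  by_cases hz : z ∈ A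
  · simp [localized, hz]
  · have : localizedResidual c g P₀ θ₀ A i z k = 0 := by
      rw [localizedResidual_eq]
      simp [localized, localizedOthers, hz]
    simp [this]

/-- The coefficients of the conditional regression of `g_{i,A}` on `g_{-i,A}` given `X` are
measurable in `X` and essentially bounded, and the residual is conditionally orthogonal to the
regressors. -/
theorem exists_regression_coefficients [IsProbabilityMeasure P₀]
    (hg : ∀ j θ k, Measurable fun z => g j z θ k) (hA : MeasurableSet A)
    {K : ℝ} (hK : ∀ i k, ∀ᵐ z ∂P₀, |localized g θ₀ A i z k| ≤ K) (i : Fin J)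
    (hW : HasBoundedInverse P₀ (condSecondMoment P₀ (jointSigma c)
      (localizedOthers g θ₀ A i) (localizedOthers g θ₀ A i))) :
    ∃ B : (Fin q → ℝ) → Matrix (Fin (p i)) {x : Σ j, Fin (p j) // x.1 ≠ i} ℝ,
      (∀ k y, Measurable[jointSigma c] fun z => B z k y) ∧
      (∃ L : ℝ, ∀ k y, ∀ᵐ z ∂P₀, |B z k y| ≤ L) ∧
      (∀ k z, localizedResidual c g P₀ θ₀ A i z k = localized g θ₀ A i z k
        - ∑ y, B z k y * localizedOthers g θ₀ A i z y) ∧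
      ∀ k y, P₀[fun z => localizedResidual c g P₀ θ₀ A i z k * localizedOthers g θ₀ A i z y |
        jointSigma c] =ᵐ[P₀] 0 := by
  have h𝒢le := jointSigma_le c
  set u := localized g θ₀ A i with hu
  set v := localizedOthers g θ₀ A i with hv
  set V := condSecondMoment P₀ (jointSigma c) u v with hV
  set W := condSecondMoment P₀ (jointSigma c) v v with hWdef
  obtain ⟨L, hL⟩ := hW
  have hum : ∀ k, Measurable fun z => u z k := measurable_localized hg hA i
  have hvm : ∀ y, Measurable fun z => v z y := fun y => measurable_localized hg hA y.1.1 y.1.2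
  have huK : ∀ k, ∀ᵐ z ∂P₀, |u z k| ≤ K := hK i
  have hvK : ∀ y, ∀ᵐ z ∂P₀, |v z y| ≤ K := fun y => hK y.1.1 y.1.2
  have hprod : ∀ {f h : (Fin q → ℝ) → ℝ}, (∀ᵐ z ∂P₀, |f z| ≤ K) → (∀ᵐ z ∂P₀, |h z| ≤ K) →
      ∀ᵐ z ∂P₀, |f z * h z| ≤ K * K := fun hf hh => by
    filter_upwards [hf, hh] with z h1 h2
    rw [abs_mul]
    exact mul_le_mul h1 h2 (abs_nonneg _) ((abs_nonneg _).trans h1)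
  have hBm : ∀ k y, Measurable[jointSigma c] fun z => (V z * (W z)⁻¹) k y := fun k y => by
    simp only [Matrix.mul_apply]
    exact Finset.measurable_sum _ fun x _ => (measurable_condSecondMoment u v k x).mul
      (measurable_matrix_inv (fun a b => measurable_condSecondMoment v v a b) x y)
  have hBb : ∃ L' : ℝ, ∀ k y, ∀ᵐ z ∂P₀, |(V z * (W z)⁻¹) k y| ≤ L' := by
    refine ⟨∑ _x : {x : Σ j, Fin (p j) // x.1 ≠ i}, K * K * L, fun k y => ?_⟩
    have hVb : ∀ᵐ z ∂P₀, ∀ x, |V z k x| ≤ K * K := by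
      rw [ae_all_iff]
      exact fun x => ae_abs_condExp_le (hprod (huK k) (hvK x))
    filter_upwards [hVb, hL] with z h1 h2
    rw [Matrix.mul_apply]
    refine (Finset.abs_sum_le_sum_abs _ _).trans (Finset.sum_le_sum fun x _ => ?_)
    rw [abs_mul]
    exact mul_le_mul (h1 x) (h2.2 x y) (abs_nonneg _) (mul_self_nonneg K)
  refine ⟨fun z => V z * (W z)⁻¹, hBm, hBb, fun k z => localizedResidual_eq i k z, fun k y => ?_⟩
  obtain ⟨L', hL'⟩ := hBb
  have hint : ∀ {f h : (Fin q → ℝ) → ℝ}, Measurable f → Measurable h → (∀ᵐ z ∂P₀, |f z| ≤ K) →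
      (∀ᵐ z ∂P₀, |h z| ≤ K) → Integrable (fun z => f z * h z) P₀ := fun hf hh hfK hhK =>
    Integrable.of_bound (hf.mul hh).aestronglyMeasurable (K * K) (hprod hfK hhK)
  have hterm : ∀ x, Integrable (fun z => (V z * (W z)⁻¹) k x * (v z x * v z y)) P₀ := fun x =>
    (hint (hvm x) (hvm y) (hvK x) (hvK y)).bdd_mul
      ((hBm k x).mono h𝒢le le_rfl).aestronglyMeasurable (hL' k x)
  have e : (fun z => localizedResidual c g P₀ θ₀ A i z k * v z y)
      = (fun z => u z k * v z y) - ∑ x, fun z => (V z * (W z)⁻¹) k x * (v z x * v z y) := by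
    ext z
    rw [localizedResidual_eq]
    simp only [Pi.sub_apply, Finset.sum_apply, sub_mul, Finset.sum_mul, mul_assoc]
    rfl
  rw [e]
  have h1 := condExp_sub (hint (hum k) (hvm y) (huK k) (hvK y))
    (integrable_finsetSum' Finset.univ fun x _ => hterm x) (jointSigma c)
  have h2 := condExp_finsetSum (s := Finset.univ) (fun x _ => hterm x) (jointSigma c)
  have h3 : ∀ᵐ z ∂P₀, ∀ x, (P₀[fun z => (V z * (W z)⁻¹) k x * (v z x * v z y) | jointSigma c]) z
      = (V z * (W z)⁻¹) k x * W z x y := by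
    rw [ae_all_iff]
    exact fun x => condExp_mul_of_stronglyMeasurable_left (hBm k x).stronglyMeasurable (hterm x)
      (hint (hvm x) (hvm y) (hvK x) (hvK y))
  filter_upwards [h1, h2, h3, hL] with z e1 e2 e3 e4
  rw [e1, Pi.sub_apply, e2, Finset.sum_apply]
  simp only [e3]
  rw [← Matrix.mul_apply, Matrix.mul_assoc, Matrix.nonsing_inv_mul _ e4.1, Matrix.mul_one]
  simp [hV, condSecondMoment]

/-- The localized residual `r_i` is bounded, conditionally on `X` it is orthogonal to the moment
functions of the other blocks, and its conditional cross moments with the functions `g_{i,A}` given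
`X^(i)` are those with itself. -/
theorem localizedResidual_orthogonality [IsProbabilityMeasure P₀]
    (hg : ∀ j θ k, Measurable fun z => g j z θ k) (hA : MeasurableSet A)
    {K : ℝ} (hK : ∀ i k, ∀ᵐ z ∂P₀, |localized g θ₀ A i z k| ≤ K) (i : Fin J)
    (hW : HasBoundedInverse P₀ (condSecondMoment P₀ (jointSigma c)
      (localizedOthers g θ₀ A i) (localizedOthers g θ₀ A i))) :
    (∀ k, Measurable fun z => localizedResidual c g P₀ θ₀ A i z k) ∧
    (∃ L : ℝ, ∀ k, ∀ᵐ z ∂P₀, |localizedResidual c g P₀ θ₀ A i z k| ≤ L) ∧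
    (∀ k y φ, Measurable[jointSigma c] φ → Integrable φ P₀ →
      ∫ z, φ z * (localizedResidual c g P₀ θ₀ A i z k * localizedOthers g θ₀ A i z y) ∂P₀ = 0) ∧
    (∀ k l φ, Measurable[subvectorSigma (c i)] φ → Integrable φ P₀ →
      ∫ z, φ z * (localizedResidual c g P₀ θ₀ A i z k * localized g θ₀ A i z l) ∂P₀
        = ∫ z, φ z * condSecondMoment P₀ (subvectorSigma (c i))
            (localizedResidual c g P₀ θ₀ A i) (localizedResidual c g P₀ θ₀ A i) z k l ∂P₀) := by
  obtain ⟨B, hBm, ⟨L', hL'⟩, hBr, hB0⟩ := exists_regression_coefficients hg hA hK i hW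
  set r := localizedResidual c g P₀ θ₀ A i with hr
  set u := localized g θ₀ A i with hu
  set v := localizedOthers g θ₀ A i with hv
  have hum : ∀ k, Measurable fun z => u z k := measurable_localized hg hA i
  have hvm : ∀ y, Measurable fun z => v z y := fun y => measurable_localized hg hA y.1.1 y.1.2
  have huK : ∀ k, ∀ᵐ z ∂P₀, |u z k| ≤ K := hK i
  have hvK : ∀ y, ∀ᵐ z ∂P₀, |v z y| ≤ K := fun y => hK y.1.1 y.1.2
  have hBm' : ∀ k y, Measurable fun z => B z k y := fun k y =>
    (hBm k y).mono (jointSigma_le c) le_rfl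
  have hrm : ∀ k, Measurable fun z => r z k := fun k => by
    simp only [hBr]
    exact (hum k).sub (Finset.measurable_sum _ fun y _ => (hBm' k y).mul (hvm y))
  have hrb : ∃ L : ℝ, ∀ k, ∀ᵐ z ∂P₀, |r z k| ≤ L := by
    refine ⟨K + ∑ _y : {x : Σ j, Fin (p j) // x.1 ≠ i}, L' * K, fun k => ?_⟩
    filter_upwards [huK k, ae_all_iff.2 hvK, ae_all_iff.2 (hL' k)] with z h1 h2 h3
    rw [hBr]
    refine (abs_sub _ _).trans (add_le_add h1 ((Finset.abs_sum_le_sum_abs _ _).trans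
      (Finset.sum_le_sum fun y _ => ?_)))
    rw [abs_mul]
    exact mul_le_mul (h3 y) (h2 y) (abs_nonneg _) ((abs_nonneg _).trans (h3 y))
  obtain ⟨L, hL⟩ := hrb
  have hprod : ∀ k {f : (Fin q → ℝ) → ℝ} {N : ℝ}, (∀ᵐ z ∂P₀, |f z| ≤ N) →
      ∀ᵐ z ∂P₀, |r z k * f z| ≤ L * N := fun k f N hf => by
    filter_upwards [hL k, hf] with z h1 h2
    rw [abs_mul]
    exact mul_le_mul h1 h2 (abs_nonneg _) ((abs_nonneg _).trans h1)
  have horth : ∀ k y φ, Measurable[jointSigma c] φ → Integrable φ P₀ →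
      ∫ z, φ z * (r z k * v z y) ∂P₀ = 0 := fun k y φ hφ hφi => by
    have hm : AEStronglyMeasurable (fun z => r z k * v z y) P₀ :=
      ((hrm k).mul (hvm y)).aestronglyMeasurable
    rw [integral_mul_condExp (jointSigma_le c) hφ
      (Integrable.of_bound hm (L * K) (hprod k (hvK y)))
      (integrable_mul_of_ae_bounded hφi hm (hprod k (hvK y))),
      integral_congr_ae (g := fun _ => 0), integral_zero]
    filter_upwards [hB0 k y] with z hz
    simp [hz]
  refine ⟨hrm, ⟨L, hL⟩, horth, fun k l φ hφ hφi => ?_⟩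
  have hrr : AEStronglyMeasurable (fun z => r z k * r z l) P₀ :=
    ((hrm k).mul (hrm l)).aestronglyMeasurable
  have hφ' := hφ.mono (subvectorSigma_le_jointSigma c i) le_rfl
  have e : ∫ z, φ z * (r z k * u z l) ∂P₀ = ∫ z, φ z * (r z k * r z l) ∂P₀ := by
    have hterm : ∀ y, Integrable (fun z => (φ z * B z l y) * (r z k * v z y)) P₀ := fun y =>
      integrable_mul_of_ae_bounded (integrable_mul_of_ae_bounded hφi
        (hBm' l y).aestronglyMeasurable (hL' l y)) ((hrm k).mul (hvm y)).aestronglyMeasurable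
        (hprod k (hvK y))
    have hsum : (fun z => φ z * (r z k * u z l)) = fun z => φ z * (r z k * r z l)
        + ∑ y, (φ z * B z l y) * (r z k * v z y) := by
      ext z
      rw [hBr l z, mul_sub, mul_sub, Finset.mul_sum, Finset.mul_sum, sub_add_eq_add_sub,
        add_sub_assoc, ← Finset.sum_sub_distrib]
      rw [Finset.sum_eq_zero, add_zero]
      intro y _
      ring
    rw [hsum, integral_add (integrable_mul_of_ae_bounded hφi hrr (hprod k (hL l)))
      (integrable_finsetSum _ fun y _ => hterm y), integral_finsetSum _ fun y _ => hterm y,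
      Finset.sum_eq_zero, add_zero]
    intro y _
    exact horth k y _ (hφ'.mul (hBm l y)) (integrable_mul_of_ae_bounded hφi
      (hBm' l y).aestronglyMeasurable (hL' l y))
  rw [e]
  exact integral_mul_condExp (subvectorSigma_le _) hφ
    (Integrable.of_bound hrr (L * L) (hprod k (hL l)))
    (integrable_mul_of_ae_bounded hφi hrr (hprod k (hL l)))

/-- A system of bounded functions `w_y` dual to the moment functions `g_x`: for instruments
`α(X^(j))` and `ψ(X^(i))`, the expectation of `α ψ w_y g_x` is `E[α ψ]` if `x = y`, and `0` otherwise.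
The functions are `w_i = E[r_i r_i' | X^(i)]⁻¹ r_i` with `r_i` the localized residuals. -/
theorem AssumptionT.exists_dual_system [IsProbabilityMeasure P₀]
    (hg : ∀ j θ k, Measurable fun z => g j z θ k) (hT : AssumptionT c g P₀ θ₀) :
    ∃ w : (Σ j, Fin (p j)) → (Fin q → ℝ) → ℝ, (∀ y, Measurable (w y)) ∧
      (∃ K : ℝ, ∀ y z, |w y z| ≤ K) ∧
      (∀ x y, ∀ α ψ : (Fin q → ℝ) → ℝ, Measurable[subvectorSigma (c x.1)] α →
        Measurable[subvectorSigma (c y.1)] ψ → Integrable (fun z => α z * ψ z) P₀ →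
        Integrable (fun z => (α z * ψ z) * (w y z * g x.1 z θ₀ x.2)) P₀ ∧
        ∫ z, (α z * ψ z) * (w y z * g x.1 z θ₀ x.2) ∂P₀
          = if x = y then ∫ z, α z * ψ z ∂P₀ else 0) := by
  obtain ⟨A, hA, -, ⟨K, hK⟩, hW, hM⟩ := hT
  have hr := fun i => localizedResidual_orthogonality (c := c) hg hA hK i (hW i)
  -- the functions `w_y` before truncation
  let M := fun i => condSecondMoment P₀ (subvectorSigma (c i))
    (localizedResidual c g P₀ θ₀ A i) (localizedResidual c g P₀ θ₀ A i)
  let w : (Σ j, Fin (p j)) → (Fin q → ℝ) → ℝ := fun y z =>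
    ∑ k, (M y.1 z)⁻¹ k y.2 * localizedResidual c g P₀ θ₀ A y.1 z k
  have hMm : ∀ i k l, Measurable[subvectorSigma (c i)] fun z => (M i z)⁻¹ k l := fun i =>
    measurable_matrix_inv fun a b => measurable_condSecondMoment _ _ a b
  have hMm' : ∀ i k l, Measurable fun z => (M i z)⁻¹ k l := fun i k l =>
    (hMm i k l).mono (subvectorSigma_le _) le_rfl
  have hwm : ∀ y, Measurable (w y) := fun y =>
    Finset.measurable_sum _ fun k _ => (hMm' _ _ _).mul ((hr y.1).1 k)
  have hwb : ∀ y, ∃ N : ℝ, ∀ᵐ z ∂P₀, |w y z| ≤ N := fun y => by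
    obtain ⟨L, hL⟩ := (hr y.1).2.1
    obtain ⟨N, hN⟩ := hM y.1
    refine ⟨∑ _k : Fin (p y.1), N * L, ?_⟩
    filter_upwards [ae_all_iff.2 hL, hN] with z h1 h2
    refine (Finset.abs_sum_le_sum_abs _ _).trans (Finset.sum_le_sum fun k _ => ?_)
    rw [abs_mul]
    exact mul_le_mul (h2.2 k _) (h1 k) (abs_nonneg _) ((abs_nonneg _).trans (h2.2 k y.2))
  choose N hN using hwb
  choose w' hw'm hw'b hw'e using fun y => exists_bounded_representative (P := P₀) (hwm y) (hN y)
  have hwg : ∀ (x y : Σ j, Fin (p j)) z, w y z * g x.1 z θ₀ x.2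
      = ∑ k, (M y.1 z)⁻¹ k y.2 * (localizedResidual c g P₀ θ₀ A y.1 z k
        * localized g θ₀ A x.1 z x.2) := fun x y z => by
    simp only [w, Finset.sum_mul, mul_assoc, localizedResidual_mul_localized]
  have hwgA : ∀ (x y : Σ j, Fin (p j)) z, w y z * g x.1 z θ₀ x.2
      = w y z * localized g θ₀ A x.1 z x.2 :=
    fun x y z => by
      rw [hwg]
      simp only [w, Finset.sum_mul, mul_assoc]
  have hwgm : ∀ (x y : Σ j, Fin (p j)),
      AEStronglyMeasurable (fun z => w y z * g x.1 z θ₀ x.2) P₀ := fun x y =>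
    ((hwm y).mul (hg _ _ _)).aestronglyMeasurable
  have hwgb : ∀ (x y : Σ j, Fin (p j)),
      ∀ᵐ z ∂P₀, |w y z * g x.1 z θ₀ x.2| ≤ N y * K := fun x y => by
    filter_upwards [hN y, hK x.1 x.2] with z h1 h2
    rw [hwgA, abs_mul]
    exact mul_le_mul h1 h2 (abs_nonneg _) ((abs_nonneg _).trans h1)
  refine ⟨w', hw'm, ⟨∑ y, |N y|, fun y z => (hw'b y z).trans
    (Finset.single_le_sum (f := fun y => |N y|) (fun _ _ => abs_nonneg _) (Finset.mem_univ y))⟩,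
    fun x y α ψ hα hψ hαψ => ?_⟩
  have hww' : (fun z => (α z * ψ z) * (w' y z * g x.1 z θ₀ x.2)) =ᵐ[P₀]
      fun z => (α z * ψ z) * (w y z * g x.1 z θ₀ x.2) := by
    filter_upwards [hw'e y] with z hz
    rw [hz]
  refine ⟨(integrable_congr hww').2 (integrable_mul_of_ae_bounded hαψ (hwgm x y) (hwgb x y)), ?_⟩
  rw [integral_congr_ae hww']
  obtain ⟨i, l⟩ := y
  obtain ⟨L, hL⟩ := (hr i).2.1
  obtain ⟨Q, hQ⟩ := hM i
  have hφi : ∀ k, Integrable (fun z => (α z * ψ z) * (M i z)⁻¹ k l) P₀ := fun k =>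
    integrable_mul_of_ae_bounded hαψ (hMm' i k l).aestronglyMeasurable
      (by filter_upwards [hQ] with z hz using hz.2 k l)
  have hterm : ∀ k, Integrable (fun z => ((α z * ψ z) * (M i z)⁻¹ k l) *
      (localizedResidual c g P₀ θ₀ A i z k * localized g θ₀ A x.1 z x.2)) P₀ := fun k => by
    refine integrable_mul_of_ae_bounded (K := L * K) (hφi k)
      (((hr i).1 k).mul (measurable_localized hg hA _ _)).aestronglyMeasurable ?_
    filter_upwards [hL k, hK x.1 x.2] with z h1 h2
    rw [abs_mul]
    exact mul_le_mul h1 h2 (abs_nonneg _) ((abs_nonneg _).trans h1)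
  have hsum : ∫ z, (α z * ψ z) * (w ⟨i, l⟩ z * g x.1 z θ₀ x.2) ∂P₀
      = ∑ k, ∫ z, ((α z * ψ z) * (M i z)⁻¹ k l) *
      (localizedResidual c g P₀ θ₀ A i z k * localized g θ₀ A x.1 z x.2) ∂P₀ := by
    rw [← integral_finsetSum _ fun k _ => hterm k]
    refine integral_congr_ae (Eventually.of_forall fun z => ?_)
    simp only [hwg, Finset.mul_sum, mul_assoc]
  rw [hsum]
  obtain ⟨j, m⟩ := x
  -- within a block, `E[r_i r_i' | X^(i)]⁻¹` normalizes; across blocks, the residual is orthogonal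
  by_cases hji : j = i
  · subst hji
    have hφm : ∀ k, Measurable[subvectorSigma (c j)] fun z => (α z * ψ z) * (M j z)⁻¹ k l :=
      fun k => (hα.mul hψ).mul (hMm j k l)
    have hB : ∀ k, Integrable (fun z => ((α z * ψ z) * (M j z)⁻¹ k l) * M j z k m) P₀ := fun k => by
      refine integrable_mul_of_ae_bounded (hφi k) ((measurable_condSecondMoment _ _ _ _).mono
        (subvectorSigma_le _) le_rfl).aestronglyMeasurable (K := L * L) (ae_abs_condExp_le ?_)
      filter_upwards [hL k, hL m] with z h1 h2
      rw [abs_mul]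
      exact mul_le_mul h1 h2 (abs_nonneg _) ((abs_nonneg _).trans h1)
    simp only [(hr j).2.2.2 _ _ _ (hφm _) (hφi _)]
    rw [← integral_finsetSum _ fun k _ => hB k]
    have hsymm : ∀ z k, M j z k m = M j z m k := fun z k => by
      simp only [M, condSecondMoment, Matrix.of_apply, mul_comm]
    have hone : (fun z => ∑ k, ((α z * ψ z) * (M j z)⁻¹ k l) * M j z k m) =ᵐ[P₀]
        fun z => (α z * ψ z) * (1 : Matrix (Fin (p j)) (Fin (p j)) ℝ) m l := by
      filter_upwards [hQ] with z hz
      rw [← Matrix.mul_nonsing_inv _ hz.1, Matrix.mul_apply, Finset.mul_sum]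
      refine Finset.sum_congr rfl fun k _ => ?_
      rw [hsymm z k]
      change _ = _ * (M j z m k * (M j z)⁻¹ k l)
      ring
    rw [integral_congr_ae hone]
    by_cases hml : m = l
    · subst hml; simp
    · simp [hml]
  · rw [if_neg (fun h => hji (congrArg Sigma.fst h))]
    refine Finset.sum_eq_zero fun k _ => ?_
    refine (hr i).2.2.1 k ⟨⟨j, m⟩, hji⟩ _ ?_ (hφi k)
    exact ((hα.mono (subvectorSigma_le_jointSigma c j) le_rfl).mul
      (hψ.mono (subvectorSigma_le_jointSigma c i) le_rfl)).mul
      ((hMm i k l).mono (subvectorSigma_le_jointSigma c i) le_rfl)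

end DualSystem

/-! ### Bounded elements of `L²` -/

section BoundedElements

variable {Ω : Type*} [MeasurableSpace Ω] {P : Measure Ω}

theorem memLp_two_mul_bounded {f h : Ω → ℝ} (hf : MemLp f 2 P) (hh : AEStronglyMeasurable h P)
    {K : ℝ} (hK : ∀ z, |h z| ≤ K) : MemLp (fun z => f z * h z) 2 P :=
  hf.of_le_mul (c := K) (hf.1.mul hh) (Eventually.of_forall fun z => by
    rw [norm_mul, mul_comm]
    exact mul_le_mul_of_nonneg_right (hK z) (norm_nonneg _))

/-- The elements of `L²(P)` that have a bounded measurable representative. -/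
def boundedLp (P : Measure Ω) : Submodule ℝ (Lp ℝ 2 P) where
  carrier := {f | ∃ h : Ω → ℝ, Measurable h ∧ (∃ K : ℝ, ∀ z, |h z| ≤ K) ∧ f =ᵐ[P] h}
  zero_mem' := ⟨fun _ => 0, measurable_const, ⟨0, by simp⟩, Lp.coeFn_zero _ _ _⟩
  add_mem' := by
    rintro f f' ⟨h, hm, ⟨K, hK⟩, e⟩ ⟨h', hm', ⟨K', hK'⟩, e'⟩
    refine ⟨h + h', hm.add hm', ⟨K + K', fun z => (abs_add_le _ _).trans
      (add_le_add (hK z) (hK' z))⟩, ?_⟩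
    exact (Lp.coeFn_add f f').trans (e.add e')
  smul_mem' := by
    rintro r f ⟨h, hm, ⟨K, hK⟩, e⟩
    refine ⟨r • h, hm.const_smul r, ⟨|r| * K, fun z => ?_⟩, ?_⟩
    · rw [Pi.smul_apply, smul_eq_mul, abs_mul]
      exact mul_le_mul_of_nonneg_left (hK z) (abs_nonneg _)
    · filter_upwards [Lp.coeFn_smul r f, e] with z h1 h2
      rw [h1, Pi.smul_apply, h2, Pi.smul_apply]

theorem exists_mem_boundedLp_norm_sub_lt (f : Lp ℝ 2 P) {ε : ℝ} (hε : 0 < ε) :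
    ∃ h ∈ boundedLp P, ‖f - h‖ < ε := by
  obtain ⟨h, hm, hb, hL, hlt⟩ := exists_bounded_eLpNorm_sub_lt (Lp.memLp f)
    (ε := ENNReal.ofReal ε) (by simpa using hε)
  refine ⟨hL.toLp h, ⟨h, hm, hb, hL.coeFn_toLp⟩, ?_⟩
  rw [← Lp.toLp_coeFn f (Lp.memLp f), ← MemLp.toLp_sub, Lp.norm_toLp]
  exact ENNReal.toReal_lt_of_lt_ofReal hlt

theorem eq_zero_of_inner_boundedLp {f : Lp ℝ 2 P} (hf : ∀ h ∈ boundedLp P, inner ℝ f h = 0) :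
    f = 0 := by
  by_contra hne
  have hpos : 0 < ‖f‖ := norm_pos_iff.2 hne
  obtain ⟨h, hh, hlt⟩ := exists_mem_boundedLp_norm_sub_lt f hpos
  have h1 : ‖f‖ * ‖f‖ = inner ℝ f (f - h) := by
    rw [inner_sub_right, hf h hh, sub_zero, real_inner_self_eq_norm_mul_norm]
  have h2 := real_inner_le_norm f (f - h)
  nlinarith

theorem inner_const_one [IsFiniteMeasure P] (f : Lp ℝ 2 P) :
    inner ℝ (Lp.const 2 P (1 : ℝ)) f = ∫ z, f z ∂P := by
  rw [L2.inner_def]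
  refine integral_congr_ae ?_
  filter_upwards [Lp.coeFn_const 2 P (1 : ℝ)] with z hz
  rw [hz]
  simp

theorem inner_eq_integral_of_ae_eq {f h : Lp ℝ 2 P} {f' h' : Ω → ℝ} (hf : f =ᵐ[P] f')
    (hh : h =ᵐ[P] h') : inner ℝ f h = ∫ z, f' z * h' z ∂P := by
  rw [L2.inner_def]
  refine integral_congr_ae ?_
  filter_upwards [hf, hh] with z h1 h2
  simp [h1, h2, mul_comm]

end BoundedElements

/-! ### The tangent space of a system of conditional moment restrictions -/

section TangentSpace

theorem measurable_instrument {Ω X : Type*} [MeasurableSpace Ω] [MeasurableSpace X] {P : Measure Ω}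
    {π : Ω → X} (α : Lp ℝ 2 (P.map π)) :
    Measurable[MeasurableSpace.comap π inferInstance] fun z => α (π z) :=
  (Lp.stronglyMeasurable α).measurable.comp (comap_measurable π)

/-- The data that the geometry of the conditional moment model depends on: moment functions `G_x` with
mean zero given `π_x`, multiplication by which maps `L²` instruments to `L²(P)`, and a system of
bounded functions `w_y` that is dual to them after multiplication by instruments. -/
structure InstrumentedMoments {Ω κ : Type*} [MeasurableSpace Ω] [DecidableEq κ] {X : κ → Type*}
    [∀ x, MeasurableSpace (X x)] (P : Measure Ω) (π : ∀ x, Ω → X x) (G : κ → Ω → ℝ) where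
  measurable_proj : ∀ x, Measurable (π x)
  /-- Multiplication by the moment function. -/
  op : ∀ x, Lp ℝ 2 (P.map (π x)) →L[ℝ] Lp ℝ 2 P
  coeFn_op : ∀ x α, op x α =ᵐ[P] fun z => α (π x z) * G x z
  integral_op : ∀ x α, ∫ z, op x α z ∂P = 0
  /-- The dual functions. -/
  dual : κ → Ω → ℝ
  measurable_dual : ∀ y, Measurable (dual y)
  dual_bounded : ∃ K : ℝ, ∀ y z, |dual y z| ≤ K
  dual_pairing : ∀ x y (α ψ : Ω → ℝ), Measurable[MeasurableSpace.comap (π x) inferInstance] α →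
    Measurable[MeasurableSpace.comap (π y) inferInstance] ψ →
    Integrable (fun z => α z * ψ z) P →
    Integrable (fun z => (α z * ψ z) * (dual y z * G x z)) P ∧
    ∫ z, (α z * ψ z) * (dual y z * G x z) ∂P = if x = y then ∫ z, α z * ψ z ∂P else 0

namespace InstrumentedMoments

variable {Ω κ : Type*} [MeasurableSpace Ω] [DecidableEq κ] {X : κ → Type*}
  [∀ x, MeasurableSpace (X x)] {P : Measure Ω} {π : ∀ x, Ω → X x} {G : κ → Ω → ℝ}
  (S : InstrumentedMoments P π G)

/-- The map `β ↦ ∑_x β_x(π_x) G_x`. -/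
noncomputable def synthesis [Fintype κ] : (∀ x, Lp ℝ 2 (P.map (π x))) →ₗ[ℝ] Lp ℝ 2 P :=
  ∑ x, (S.op x).toLinearMap ∘ₗ LinearMap.proj x

theorem synthesis_apply [Fintype κ] (β : ∀ x, Lp ℝ 2 (P.map (π x))) :
    S.synthesis β = ∑ x, S.op x (β x) := by
  simp [synthesis, LinearMap.sum_apply]

/-- The space of the functions `r + ∑_x β_x(π_x) G_x`; its orthogonal complement will be the nuisance
tangent space. -/
noncomputable def normalSpace [Fintype κ] [IsFiniteMeasure P] : Submodule ℝ (Lp ℝ 2 P) :=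
  Submodule.span ℝ {Lp.const 2 P (1 : ℝ)} ⊔ LinearMap.range S.synthesis

theorem const_mem_normalSpace [Fintype κ] [IsFiniteMeasure P] :
    Lp.const 2 P (1 : ℝ) ∈ S.normalSpace :=
  Submodule.mem_sup_left (Submodule.mem_span_singleton_self _)

theorem synthesis_mem_normalSpace [Fintype κ] [IsFiniteMeasure P]
    (β : ∀ x, Lp ℝ 2 (P.map (π x))) : S.synthesis β ∈ S.normalSpace :=
  Submodule.mem_sup_right ⟨β, rfl⟩

theorem op_mem_normalSpace [Fintype κ] [IsFiniteMeasure P] (x : κ) (α : Lp ℝ 2 (P.map (π x))) :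
    S.op x α ∈ S.normalSpace := by
  have h : S.synthesis (Pi.single x α) = S.op x α := by
    rw [synthesis_apply, Finset.sum_eq_single x]
    · simp
    · intro y _ hy
      simp [Pi.single_eq_of_ne hy]
    · simp
  exact h ▸ S.synthesis_mem_normalSpace _

theorem mem_normalSpace_orthogonal [Fintype κ] [IsFiniteMeasure P] {h : Lp ℝ 2 P} :
    h ∈ S.normalSpaceᗮ ↔ ∫ z, h z ∂P = 0 ∧ ∀ x α, inner ℝ (S.op x α) h = 0 := by
  constructor
  · intro hh
    exact ⟨by rw [← inner_const_one]; exact hh _ S.const_mem_normalSpace,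
      fun x α => hh _ (S.op_mem_normalSpace x α)⟩
  · rintro ⟨h1, h2⟩ f hf
    obtain ⟨u, hu, v, ⟨β, rfl⟩, rfl⟩ := Submodule.mem_sup.1 hf
    obtain ⟨r, rfl⟩ := Submodule.mem_span_singleton.1 hu
    rw [inner_add_left, real_inner_smul_left, inner_const_one, h1, synthesis_apply, sum_inner]
    simp [h2]

theorem integral_synthesis [Fintype κ] [IsFiniteMeasure P] (β : ∀ x, Lp ℝ 2 (P.map (π x))) :
    ∫ z, S.synthesis β z ∂P = 0 := by
  rw [← inner_const_one, synthesis_apply, inner_sum]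
  exact Finset.sum_eq_zero fun x _ => by rw [inner_const_one, S.integral_op]

theorem coeFn_synthesis [Fintype κ] (β : ∀ x, Lp ℝ 2 (P.map (π x))) :
    S.synthesis β =ᵐ[P] fun z => ∑ x, β x (π x z) * G x z := by
  rw [synthesis_apply]
  filter_upwards [Lp.coeFn_finsetSum Finset.univ fun x => S.op x (β x),
    ae_all_iff.2 fun x => S.coeFn_op x (β x)] with z h1 h2
  rw [h1, Finset.sum_apply]
  simp [h2]

/-- Duality recovers the instruments `β_y` from `∑_x β_x(π_x) G_x`. -/
theorem integral_synthesis_mul_dual [Fintype κ] [IsFiniteMeasure P]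
    (β : ∀ x, Lp ℝ 2 (P.map (π x))) (y : κ) {ψ : Ω → ℝ}
    (hψ : Measurable[MeasurableSpace.comap (π y) inferInstance] ψ) (hψL : MemLp ψ 2 P) :
    Integrable (fun z => S.synthesis β z * (S.dual y z * ψ z)) P ∧
    ∫ z, S.synthesis β z * (S.dual y z * ψ z) ∂P = ∫ z, β y (π y z) * ψ z ∂P := by
  have hpair := fun x => S.dual_pairing x y (fun z => β x (π x z)) ψ
    (measurable_instrument (β x)) hψ
    (integrable_mul_of_memLp_two (memLp_comp (S.measurable_proj x) (β x)) hψL)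
  have hae : (fun z => S.synthesis β z * (S.dual y z * ψ z)) =ᵐ[P]
      fun z => ∑ x, (β x (π x z) * ψ z) * (S.dual y z * G x z) := by
    filter_upwards [S.coeFn_synthesis β] with z hz
    rw [hz, Finset.sum_mul]
    exact Finset.sum_congr rfl fun x _ => by ring
  refine ⟨(integrable_congr hae).2 (integrable_finsetSum _ fun x _ => (hpair x).1), ?_⟩
  rw [integral_congr_ae hae, integral_finsetSum _ fun x _ => (hpair x).1]
  simp only [(hpair _).2]
  simp

/-- Distinct systems of instruments give distinct moments. -/
theorem synthesis_injective [Fintype κ] [IsFiniteMeasure P] :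
    Function.Injective S.synthesis := by
  rw [injective_iff_map_eq_zero]
  intro β hβ
  ext1 y
  have h := (S.integral_synthesis_mul_dual β y (measurable_instrument (β y))
    (memLp_comp (S.measurable_proj y) (β y))).2
  rw [integral_congr_ae (g := fun _ => 0)] at h
  · rw [integral_zero] at h
    have hmap : ∫ u, β y u * β y u ∂(P.map (π y)) = ∫ z, β y (π y z) * β y (π y z) ∂P :=
      integral_map (S.measurable_proj y).aemeasurable ((Lp.stronglyMeasurable (β y)).mul
        (Lp.stronglyMeasurable (β y))).aestronglyMeasurable
    have hin : inner ℝ (β y) (β y) = (0 : ℝ) := by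
      rw [inner_eq_integral_of_ae_eq (ae_eq_refl _) (ae_eq_refl _), hmap, ← h]
    exact inner_self_eq_zero.1 hin
  · rw [hβ]
    filter_upwards [Lp.coeFn_zero ℝ 2 P] with z hz
    rw [hz]
    simp

/-- The conditional covariance given `π_x` of a moment function with a bounded function is
bounded. -/
theorem exists_bounded_condExp (S : InstrumentedMoments P π G) [IsProbabilityMeasure P] (x : κ)
    {h : Ω → ℝ} (hm : Measurable h) {K : ℝ} (hK : ∀ z, |h z| ≤ K) :
    ∃ b : Ω → ℝ, Measurable[MeasurableSpace.comap (π x) inferInstance] b ∧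
      (∃ L : ℝ, ∀ z, |b z| ≤ L) ∧
      ∀ α : Lp ℝ 2 (P.map (π x)),
        ∫ z, (α (π x z) * G x z) * h z ∂P = ∫ z, α (π x z) * b z ∂P := by
  have hle := (S.measurable_proj x).comap_le
  have hK0 : 0 ≤ K := (abs_nonneg _).trans (hK (Classical.choice
    (nonempty_of_isProbabilityMeasure P)))
  have hhL : MemLp h 2 P := memLp_two_of_bounded hm.aestronglyMeasurable hK
  have : IsProbabilityMeasure (P.map (π x)) :=
    Measure.isProbabilityMeasure_map (S.measurable_proj x).aemeasurable
  have hopL : ∀ α : Lp ℝ 2 (P.map (π x)), MemLp (fun z => α (π x z) * G x z) 2 P := fun α =>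
    (memLp_congr_ae (S.coeFn_op x α)).1 (Lp.memLp _)
  -- `G` itself is square-integrable: take the constant instrument
  have hGL : MemLp (G x) 2 P := by
    refine (memLp_congr_ae ?_).1 (hopL (Lp.const 2 _ (1 : ℝ)))
    filter_upwards [comp_ae_eq_comp (S.measurable_proj x) (Lp.coeFn_const 2 (P.map (π x)) (1 : ℝ))]
      with z hz
    rw [hz]
    simp
  have hGh : Integrable (fun z => G x z * h z) P := integrable_mul_of_memLp_two hGL hhL
  -- `|∫_B G h| ≤ ‖1_B G‖ ‖1_B h‖ ≤ C P(B)` for `B` in the sigma-algebra of `π_x`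
  set C : ℝ := ‖S.op x‖ * K with hC
  have hset : ∀ B, MeasurableSet[MeasurableSpace.comap (π x) inferInstance] B →
      |∫ z in B, G x z * h z ∂P| ≤ C * P.real B := by
    rintro _ ⟨B, hB, rfl⟩
    have hB' : MeasurableSet (π x ⁻¹' B) := S.measurable_proj x hB
    set e := indicatorConstLp 2 hB (measure_ne_top (P.map (π x)) B) (1 : ℝ) with he
    have h1 : ∫ z in π x ⁻¹' B, G x z * h z ∂P
        = ∫ z, (e (π x z) * G x z) * (π x ⁻¹' B).indicator h z ∂P := by
      rw [← integral_indicator hB']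
      refine integral_congr_ae ?_
      filter_upwards [comp_ae_eq_comp (S.measurable_proj x)
        (indicatorConstLp_coeFn (p := 2) (hs := hB) (hμs := measure_ne_top (P.map (π x)) B)
          (c := (1 : ℝ)))] with z hz
      rw [← he] at hz
      rw [hz]
      by_cases hzB : π x z ∈ B <;> simp [hzB]
    have h2 := abs_integral_mul_le (hopL e) (hhL.indicator hB')
    have h3 : (eLpNorm (fun z => e (π x z) * G x z) 2 P).toReal ≤ ‖S.op x‖ * ‖e‖ := by
      rw [← eLpNorm_congr_ae (S.coeFn_op x e), ← Lp.norm_def]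
      exact (S.op x).le_opNorm e
    have h4 : (eLpNorm ((π x ⁻¹' B).indicator h) 2 P).toReal ≤ K * ‖e‖ := by
      have h5 : ‖e‖ = (eLpNorm ((π x ⁻¹' B).indicator fun _ => (1 : ℝ)) 2 P).toReal := by
        rw [he, norm_indicatorConstLp (by norm_num) (by norm_num),
          eLpNorm_indicator_const hB' (by norm_num) (by norm_num),
          map_measureReal_apply (S.measurable_proj x) hB]
        simp [Measure.real, ENNReal.toReal_rpow]
      have h6 : eLpNorm ((π x ⁻¹' B).indicator h) 2 P ≤ ENNReal.ofReal K *
          eLpNorm ((π x ⁻¹' B).indicator fun _ => (1 : ℝ)) 2 P := by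
        refine eLpNorm_le_mul_eLpNorm_of_ae_le_mul (Eventually.of_forall fun z => ?_) 2
        by_cases hzB : z ∈ π x ⁻¹' B
        · simpa [Set.indicator_of_mem hzB] using hK z
        · simp [Set.indicator_of_notMem hzB]
      have h7 : eLpNorm ((π x ⁻¹' B).indicator fun _ => (1 : ℝ)) 2 P ≠ ∞ :=
        ((memLp_const (1 : ℝ)).indicator hB').2.ne
      rw [h5]
      have h8 := ENNReal.toReal_mono (ENNReal.mul_ne_top ENNReal.ofReal_ne_top h7) h6
      rwa [ENNReal.toReal_mul, ENNReal.toReal_ofReal hK0] at h8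
    have h9 : ‖e‖ * ‖e‖ = P.real (π x ⁻¹' B) := by
      rw [← real_inner_self_eq_norm_mul_norm, he, L2.inner_indicatorConstLp_one,
        integral_congr_ae (ae_restrict_of_ae indicatorConstLp_coeFn),
        setIntegral_indicator hB, Set.inter_self]
      simp [map_measureReal_apply (S.measurable_proj x) hB]
    rw [h1]
    calc _ ≤ _ := h2
      _ ≤ (‖S.op x‖ * ‖e‖) * (K * ‖e‖) := by gcongr
      _ = C * P.real (π x ⁻¹' B) := by rw [← h9, hC]; ring
  set b₀ := P[fun z => G x z * h z | MeasurableSpace.comap (π x) inferInstance] with hb₀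
  have hb₀m : StronglyMeasurable[MeasurableSpace.comap (π x) inferInstance] b₀ :=
    stronglyMeasurable_condExp
  have hb₀i : Integrable b₀ P := integrable_condExp
  have hbound : ∀ᵐ z ∂P, |b₀ z| ≤ C := by
    have hup : ∀ᵐ z ∂P, b₀ z ≤ C := by
      refine ae_of_ae_trim hle (ae_le_of_forall_setIntegral_le (hb₀i.trim hle hb₀m)
        (integrable_const C) fun B hB _ => ?_)
      rw [← setIntegral_trim hle hb₀m hB, setIntegral_condExp hle hGh hB, setIntegral_const,
        smul_eq_mul, measureReal_def, trim_measurableSet_eq hle hB, mul_comm]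
      exact (le_abs_self _).trans (hset B hB)
    have hlo : ∀ᵐ z ∂P, -C ≤ b₀ z := by
      refine ae_of_ae_trim hle (ae_le_of_forall_setIntegral_le (integrable_const (-C))
        (hb₀i.trim hle hb₀m) fun B hB _ => ?_)
      rw [← setIntegral_trim hle hb₀m hB, setIntegral_condExp hle hGh hB, setIntegral_const,
        smul_eq_mul, measureReal_def, trim_measurableSet_eq hle hB]
      have := (abs_le.1 (hset B hB)).1
      rw [measureReal_def] at this
      linarith
    filter_upwards [hup, hlo] with z h1 h2 using abs_le.2 ⟨h2, h1⟩
  obtain ⟨b, hbm, hbb, hbe⟩ := exists_bounded_representative (P := P) hb₀m.measurable hbound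
  refine ⟨b, hbm, ⟨_, hbb⟩, fun α => ?_⟩
  have h1 := integral_mul_condExp (P := P) hle (measurable_instrument α) hGh
    ((integrable_mul_of_memLp_two (hopL α) hhL).congr
      (Eventually.of_forall fun z => by ring))
  rw [integral_congr_ae (Eventually.of_forall fun z => mul_assoc _ _ _), h1]
  refine integral_congr_ae ?_
  filter_upwards [hbe] with z hz
  rw [hz]

/-- Whatever is orthogonal to the bounded functions in `normalSpaceᗮ` is a constant plus a combination
of moments. This is the step that rests on the dual system. -/
theorem orthogonal_bounded_le_normalSpace [Fintype κ] [IsProbabilityMeasure P] :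
    (S.normalSpaceᗮ ⊓ boundedLp P)ᗮ ≤ S.normalSpace := by
  intro f hf
  obtain ⟨K, hK⟩ := S.dual_bounded
  set one := Lp.const 2 P (1 : ℝ) with hone
  set r : ℝ := ∫ z, f z ∂P with hr
  set f₀ : Lp ℝ 2 P := f - r • one with hf₀
  -- the instruments `β_y = E[f₀ w_y | π_y]`
  have hfw : ∀ y, MemLp (fun z => f₀ z * S.dual y z) 2 P := fun y =>
    memLp_two_mul_bounded (Lp.memLp f₀) (S.measurable_dual y).aestronglyMeasurable (hK y)
  have hle := fun y => (S.measurable_proj y).comap_le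
  have hβ : ∀ y, ∃ β : Lp ℝ 2 (P.map (π y)), (fun z => β (π y z)) =ᵐ[P]
      P[fun z => f₀ z * S.dual y z | MeasurableSpace.comap (π y) inferInstance] := fun y =>
    exists_Lp_comp_ae_eq (S.measurable_proj y) stronglyMeasurable_condExp.measurable
      ((hfw y).condExp (by norm_num))
  choose β hβ using hβ
  set f' : Lp ℝ 2 P := f₀ - S.synthesis β with hf'
  have hf'1 : ∫ z, f' z ∂P = 0 := by
    rw [← inner_const_one, hf', inner_sub_right, hf₀, inner_sub_right, real_inner_smul_right,
      inner_const_one, inner_const_one, inner_const_one, S.integral_synthesis, ← hr]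
    have : ∫ z, one z ∂P = 1 := by
      rw [integral_congr_ae (Lp.coeFn_const 2 P (1 : ℝ))]
      simp
    rw [this]
    ring
  -- `f'` has no components along the `w_y ψ(π_y)`
  have hf'w : ∀ y (ψ : Ω → ℝ), Measurable[MeasurableSpace.comap (π y) inferInstance] ψ →
      (∃ L : ℝ, ∀ z, |ψ z| ≤ L) → ∫ z, f' z * (S.dual y z * ψ z) ∂P = 0 := by
    rintro y ψ hψ ⟨L, hL⟩
    have hψL : MemLp ψ 2 P :=
      memLp_two_of_bounded (hψ.mono (hle y) le_rfl).aestronglyMeasurable hL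
    have h1 := S.integral_synthesis_mul_dual β y hψ hψL
    have i1 : Integrable (fun z => f₀ z * (S.dual y z * ψ z)) P :=
      (integrable_mul_of_memLp_two (hfw y) hψL).congr (Eventually.of_forall fun z => by ring)
    have h2 : ∫ z, f₀ z * (S.dual y z * ψ z) ∂P = ∫ z, β y (π y z) * ψ z ∂P := by
      have h3 := integral_mul_condExp (P := P) (hle y) hψ ((hfw y).integrable (by norm_num))
        (i1.congr (Eventually.of_forall fun z => by ring))
      calc _ = ∫ z, ψ z * (f₀ z * S.dual y z) ∂P :=
            integral_congr_ae (Eventually.of_forall fun z => by ring)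
        _ = _ := h3
        _ = _ := integral_congr_ae (by
            filter_upwards [hβ y] with z hz
            rw [← hz, mul_comm])
    have h4 : (fun z => f' z * (S.dual y z * ψ z)) =ᵐ[P]
        fun z => f₀ z * (S.dual y z * ψ z) - S.synthesis β z * (S.dual y z * ψ z) := by
      filter_upwards [Lp.coeFn_sub f₀ (S.synthesis β)] with z hz
      rw [hf', hz, Pi.sub_apply, sub_mul]
    rw [integral_congr_ae h4, integral_sub i1 h1.1, h1.2, h2, sub_self]
  have hzero : f' = 0 := by
    refine eq_zero_of_inner_boundedLp fun h hh => ?_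
    obtain ⟨h₁, hm, ⟨L, hL⟩, he⟩ := hh
    choose b hbm hbb hbi using fun x => S.exists_bounded_condExp x hm hL
    choose Lb hLb using hbb
    have hbm' : ∀ x, Measurable (b x) := fun x => (hbm x).mono (hle x) le_rfl
    have hbL : ∀ x, MemLp (b x) 2 P := fun x =>
      memLp_two_of_bounded (hbm' x).aestronglyMeasurable (hLb x)
    -- the correction `∑_y w_y E[G_y h | π_y]` makes `h` orthogonal to all moments
    set k : Ω → ℝ := fun z => ∑ y, S.dual y z * b y z with hk
    have hkm : Measurable k := Finset.measurable_sum _ fun y _ => (S.measurable_dual y).mul (hbm' y)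
    have hkb : ∀ z, |k z| ≤ ∑ y, K * Lb y := fun z => by
      refine (Finset.abs_sum_le_sum_abs _ _).trans (Finset.sum_le_sum fun y _ => ?_)
      rw [abs_mul]
      exact mul_le_mul (hK y z) (hLb y z) (abs_nonneg _) ((abs_nonneg _).trans (hK y z))
    set e : ℝ := ∫ z, (h₁ z - k z) ∂P with he'
    set h' : Ω → ℝ := fun z => h₁ z - k z - e with hh'
    have hm' : Measurable h' := (hm.sub hkm).sub_const e
    have hb' : ∀ z, |h' z| ≤ L + (∑ y, K * Lb y) + |e| := fun z =>
      (abs_sub _ _).trans (add_le_add ((abs_sub _ _).trans (add_le_add (hL z) (hkb z))) le_rfl)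
    have hL' : MemLp h' 2 P := memLp_two_of_bounded hm'.aestronglyMeasurable hb'
    have hkL : MemLp k 2 P := memLp_two_of_bounded hkm.aestronglyMeasurable hkb
    have hh₁L : MemLp h₁ 2 P := memLp_two_of_bounded hm.aestronglyMeasurable hL
    have hmem : hL'.toLp h' ∈ S.normalSpaceᗮ := by
      rw [S.mem_normalSpace_orthogonal]
      constructor
      · have i5 : Integrable (fun z => h₁ z - k z) P := (hh₁L.sub hkL).integrable (by norm_num)
        rw [integral_congr_ae hL'.coeFn_toLp]
        simp only [hh']
        rw [integral_sub i5 (integrable_const e), ← he']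
        simp
      · intro x α
        have hopL : MemLp (fun z => α (π x z) * G x z) 2 P :=
          (memLp_congr_ae (S.coeFn_op x α)).1 (Lp.memLp _)
        have hop0 : ∫ z, α (π x z) * G x z ∂P = 0 := by
          rw [← integral_congr_ae (S.coeFn_op x α), S.integral_op]
        rw [inner_eq_integral_of_ae_eq (S.coeFn_op x α) hL'.coeFn_toLp]
        have hpair := fun y => S.dual_pairing x y (fun z => α (π x z)) (b y)
          (measurable_instrument α) (hbm y)
          (integrable_mul_of_memLp_two (memLp_comp (S.measurable_proj x) α) (hbL y))
        have i1 := integrable_mul_of_memLp_two hopL hh₁L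
        have i2 := (hopL.integrable (by norm_num)).mul_const e
        have i3 : Integrable (fun z => ∑ y, (α (π x z) * b y z) * (S.dual y z * G x z)) P :=
          integrable_finsetSum _ fun y _ => (hpair y).1
        have hexp : (fun z => (α (π x z) * G x z) * h' z) = fun z =>
            (α (π x z) * G x z) * h₁ z
              - ∑ y, (α (π x z) * b y z) * (S.dual y z * G x z)
              - (α (π x z) * G x z) * e := by
          ext z
          simp only [hh', hk, mul_sub, Finset.mul_sum]
          congr 2
          exact Finset.sum_congr rfl fun y _ => by ring
        have i4 : Integrable (fun z => (α (π x z) * G x z) * h₁ z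
              - ∑ y, (α (π x z) * b y z) * (S.dual y z * G x z)) P := i1.sub i3
        rw [hexp, integral_sub i4 i2, integral_sub i1 i3, integral_mul_const, hop0,
          integral_finsetSum _ fun y _ => (hpair y).1]
        simp only [(hpair _).2]
        rw [hbi x α]
        simp
    have hin : inner ℝ f' (hL'.toLp h') = 0 := by
      have h1 : inner ℝ f (hL'.toLp h') = 0 := by
        rw [real_inner_comm]
        exact hf _ ⟨hmem, ⟨h', hm', ⟨_, hb'⟩, hL'.coeFn_toLp⟩⟩
      have h2 : inner ℝ one (hL'.toLp h') = 0 := hmem _ S.const_mem_normalSpace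
      have h3 : inner ℝ (S.synthesis β) (hL'.toLp h') = 0 :=
        hmem _ (S.synthesis_mem_normalSpace β)
      rw [hf', hf₀, inner_sub_left, inner_sub_left, real_inner_smul_left, h1, h2, h3]
      ring
    rw [inner_eq_integral_of_ae_eq (ae_eq_refl _) hL'.coeFn_toLp] at hin
    rw [inner_eq_integral_of_ae_eq (ae_eq_refl _) he, ← hin]
    have hterm : ∀ y, Integrable (fun z => f' z * (S.dual y z * b y z)) P := fun y =>
      (integrable_mul_of_memLp_two (Lp.memLp f') (memLp_two_mul_bounded (hbL y)
        (S.measurable_dual y).aestronglyMeasurable (hK y))).congr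
        (Eventually.of_forall fun z => by ring)
    have hexp : (fun z => f' z * h' z) = fun z =>
        f' z * h₁ z - ∑ y, f' z * (S.dual y z * b y z) - f' z * e := by
      ext z
      simp only [hh', hk, mul_sub, Finset.mul_sum]
    have i1 := integrable_mul_of_memLp_two (Lp.memLp f') hh₁L
    have i2 := ((Lp.memLp f').integrable (by norm_num)).mul_const e
    have i3 : Integrable (fun z => ∑ y, f' z * (S.dual y z * b y z)) P :=
      integrable_finsetSum _ fun y _ => hterm y
    have i4 : Integrable (fun z => f' z * h₁ z - ∑ y, f' z * (S.dual y z * b y z)) P := i1.sub i3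
    rw [hexp, integral_sub i4 i2, integral_sub i1 i3, integral_mul_const, hf'1,
      integral_finsetSum _ fun y _ => hterm y,
      Finset.sum_eq_zero fun y _ => hf'w y (b y) (hbm y) ⟨_, hLb y⟩]
    ring
  have hfin : f = r • one + S.synthesis β := by
    have : f = r • one + S.synthesis β + f' := by rw [hf', hf₀]; abel
    rw [this, hzero, add_zero]
  rw [hfin]
  exact S.normalSpace.add_mem (S.normalSpace.smul_mem r S.const_mem_normalSpace)
    (S.synthesis_mem_normalSpace β)

theorem normalSpace_eq_orthogonal [Fintype κ] [IsProbabilityMeasure P] :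
    S.normalSpace = (S.normalSpaceᗮ ⊓ boundedLp P)ᗮ :=
  le_antisymm ((Submodule.le_orthogonal_orthogonal _).trans (Submodule.orthogonal_le inf_le_left))
    S.orthogonal_bounded_le_normalSpace

theorem isClosed_normalSpace [Fintype κ] [IsProbabilityMeasure P] :
    IsClosed (S.normalSpace : Set (Lp ℝ 2 P)) := by
  rw [S.normalSpace_eq_orthogonal]
  exact Submodule.isClosed_orthogonal _

/-- Bounded functions are dense in the orthogonal complement of the moments. -/
theorem exists_bounded_mem_orthogonal [Fintype κ] [IsProbabilityMeasure P] {h : Lp ℝ 2 P}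
    (hh : h ∈ S.normalSpaceᗮ) {ε : ℝ} (hε : 0 < ε) :
    ∃ h' ∈ S.normalSpaceᗮ, h' ∈ boundedLp P ∧ ‖h - h'‖ < ε := by
  have h1 : h ∈ (S.normalSpaceᗮ ⊓ boundedLp P).topologicalClosure := by
    rw [← Submodule.orthogonal_orthogonal_eq_closure, ← S.normalSpace_eq_orthogonal]
    exact hh
  obtain ⟨h', h2, h3⟩ := Metric.mem_closure_iff.1 h1 ε hε
  exact ⟨h', h2.1, h2.2, by rwa [← dist_eq_norm]⟩

end InstrumentedMoments

end TangentSpace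

/-! ### Information as a Gram matrix of projected scores -/

section Gram

variable {E : Type*} [NormedAddCommGroup E] [InnerProductSpace ℝ E] {d : ℕ}

/-- The Gram matrix of the orthogonal projections of the `ℓ_l` on `U`. -/
noncomputable def projectedGram (U : Submodule ℝ E) [U.HasOrthogonalProjection] (ℓ : Fin d → E) :
    Matrix (Fin d) (Fin d) ℝ :=
  Matrix.of fun k l => inner ℝ (U.starProjection (ℓ k)) (U.starProjection (ℓ l))

theorem dotProduct_projectedGram_mulVec (U : Submodule ℝ E) [U.HasOrthogonalProjection]
    (ℓ : Fin d → E) (a : Fin d → ℝ) :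
    a ⬝ᵥ (projectedGram U ℓ).mulVec a = ‖U.starProjection (∑ l, a l • ℓ l)‖ ^ 2 := by
  rw [← real_inner_self_eq_norm_sq, map_sum, sum_inner]
  simp only [dotProduct, Matrix.mulVec, projectedGram, Matrix.of_apply, inner_sum, map_smul,
    real_inner_smul_left, real_inner_smul_right, Finset.mul_sum]
  exact Finset.sum_congr rfl fun k _ => Finset.sum_congr rfl fun l _ => by ring

theorem isSymm_projectedGram (U : Submodule ℝ E) [U.HasOrthogonalProjection] (ℓ : Fin d → E) :
    (projectedGram U ℓ).IsSymm := by
  ext k l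
  simp [projectedGram, real_inner_comm]

theorem starProjection_starProjection_of_le {U V : Submodule ℝ E} [U.HasOrthogonalProjection]
    [V.HasOrthogonalProjection] (h : U ≤ V) (f : E) :
    U.starProjection (V.starProjection f) = U.starProjection f := by
  rw [← ContinuousLinearMap.comp_apply, Submodule.starProjection_comp_starProjection_of_le h]

theorem projectedGram_mono {U V : Submodule ℝ E} [U.HasOrthogonalProjection]
    [V.HasOrthogonalProjection] (h : U ≤ V) (ℓ : Fin d → E) :
    projectedGram U ℓ ≤ projectedGram V ℓ := by
  rw [Matrix.le_iff]
  refine Matrix.PosSemidef.of_dotProduct_mulVec_nonneg ?_ fun a => ?_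
  · rw [Matrix.IsHermitian, Matrix.conjTranspose_eq_transpose_of_trivial]
    exact (isSymm_projectedGram V ℓ).sub (isSymm_projectedGram U ℓ)
  · rw [star_trivial, Matrix.sub_mulVec, dotProduct_sub, dotProduct_projectedGram_mulVec,
      dotProduct_projectedGram_mulVec, sub_nonneg]
    rw [← starProjection_starProjection_of_le h]
    gcongr
    exact U.norm_starProjection_apply_le _

/-- Projecting on a smaller subspace that contains the projections does not change the Gram
matrix. -/
theorem projectedGram_eq_of_mem {U V : Submodule ℝ E} [U.HasOrthogonalProjection]
    [V.HasOrthogonalProjection] (h : U ≤ V) {ℓ : Fin d → E}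
    (hℓ : ∀ l, V.starProjection (ℓ l) ∈ U) : projectedGram U ℓ = projectedGram V ℓ := by
  have key : ∀ l, U.starProjection (ℓ l) = V.starProjection (ℓ l) := fun l => by
    rw [← starProjection_starProjection_of_le h]
    exact Submodule.starProjection_eq_self_iff.2 (hℓ l)
  ext k l
  simp only [projectedGram, Matrix.of_apply, key]

end Gram

section Information

variable {q d : ℕ} {ι : Type} {μ P₀ : Measure (Fin q → ℝ)} {Θ : Set (Fin d → ℝ)}
  {θ₀ : Fin d → ℝ} {R : (Fin d → ℝ) → Measure (Fin q → ℝ) → Prop}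
  {m : ι → (Fin q → ℝ) → (Fin d → ℝ) → ℝ}

theorem integral_sq_eq_norm_sq {Ω : Type*} [MeasurableSpace Ω] {P : Measure Ω} {s : Ω → ℝ}
    (hs : MemLp s 2 P) : ∫ z, s z ^ 2 ∂P = ‖hs.toLp s‖ ^ 2 := by
  rw [← real_inner_self_eq_norm_sq, inner_eq_integral_of_ae_eq hs.coeFn_toLp hs.coeFn_toLp]
  exact integral_congr_ae (Eventually.of_forall fun z => by ring)

/-- If the scores of the regular submodels in the direction `a` lie in `a'ℓ + Uᗮ` and are dense
there, the information is the Gram matrix of the projections of `ℓ` on `U`. -/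
theorem isFisherInformation_projectedGram (U : Submodule ℝ (Lp ℝ 2 P₀)) [U.HasOrthogonalProjection]
    (ℓ : Fin d → Lp ℝ 2 P₀)
    (hsub : ∀ θ P a s (h : IsRegularSubmodel μ P₀ Θ θ₀ R m θ P a s),
      h.score_memLp.toLp s - ∑ l, a l • ℓ l ∈ Uᗮ)
    (hdense : ∀ a, ∀ h ∈ Uᗮ, ∀ ε > 0, ∃ θ P s, ∃ H : IsRegularSubmodel μ P₀ Θ θ₀ R m θ P a s,
      ‖H.score_memLp.toLp s - (∑ l, a l • ℓ l + h)‖ < ε) :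
    IsFisherInformation μ P₀ Θ θ₀ R m (projectedGram U ℓ) := by
  refine ⟨isSymm_projectedGram U ℓ, fun a => ?_⟩
  rw [dotProduct_projectedGram_mulVec]
  set v := ∑ l, a l • ℓ l with hv
  constructor
  · rintro _ ⟨θ, P, s, H, rfl⟩
    rw [integral_sq_eq_norm_sq H.score_memLp]
    have h1 : U.starProjection v = U.starProjection (H.score_memLp.toLp s) := by
      have h2 := (Submodule.starProjection_apply_eq_zero_iff U).2 (hsub θ P a s H)
      rw [map_sub, sub_eq_zero] at h2
      exact h2.symm
    rw [h1]
    gcongr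
    exact U.norm_starProjection_apply_le _
  · intro b hb
    have hle : ∀ ε > (0 : ℝ), b ≤ (‖U.starProjection v‖ + ε) ^ 2 := fun ε hε => by
      obtain ⟨θ, P, s, H, hs⟩ := hdense a (U.starProjection v - v)
        (by rw [← neg_sub]; exact neg_mem (Submodule.sub_starProjection_mem_orthogonal v)) ε hε
      rw [← hv, add_sub_cancel] at hs
      refine (hb ⟨θ, P, s, H, rfl⟩).trans ?_
      rw [integral_sq_eq_norm_sq H.score_memLp]
      gcongr
      have := norm_add_le (H.score_memLp.toLp s - U.starProjection v) (U.starProjection v)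
      rw [sub_add_cancel] at this
      linarith
    have hlim : Tendsto (fun ε : ℝ => (‖U.starProjection v‖ + ε) ^ 2) (𝓝[>] 0)
        (𝓝 (‖U.starProjection v‖ ^ 2)) := by
      have : Continuous fun ε : ℝ => (‖U.starProjection v‖ + ε) ^ 2 := by fun_prop
      simpa using (this.tendsto 0).mono_left nhdsWithin_le_nhds
    exact ge_of_tendsto hlim (by filter_upwards [self_mem_nhdsWithin] with ε hε using hle ε hε)

/-! ### Scores and moment restrictions -/

/-- Along a regular submodel the moment restriction `E[f(Z, θ)] = 0` ties the covariance of the score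
with `f` to the derivative of the moment. -/
theorem IsRegularSubmodel.integral_mul_score [SigmaFinite μ] [IsProbabilityMeasure P₀]
    (hμ : P₀ ≪ μ) {θ : ℝ → Fin d → ℝ} {P : ℝ → Measure (Fin q → ℝ)} {a : Fin d → ℝ}
    {s : (Fin q → ℝ) → ℝ} (H : IsRegularSubmodel μ P₀ Θ θ₀ R m θ P a s)
    {f : (Fin q → ℝ) → (Fin d → ℝ) → ℝ} (hf : ∀ θ, Measurable fun z => f z θ)
    (hL : MemLp (fun z => f z θ₀) 2 P₀)
    (hc : Tendsto (fun θ => eLpNorm (fun z => f z θ - f z θ₀) 2 P₀) (𝓝 θ₀) (𝓝 0))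
    (hd : DifferentiableAt ℝ (fun θ => ∫ z, f z θ ∂P₀) θ₀)
    (h0 : ∀ᶠ t in 𝓝 (0 : ℝ), ∫ z, f z (θ t) ∂(P t) = 0)
    (hb : ∃ C : ℝ≥0, ∀ᶠ t in 𝓝 (0 : ℝ), eLpNorm (fun z => f z (θ t)) 2 (P t) ≤ C) :
    ∫ z, f z θ₀ * s z ∂P₀ = -fderiv ℝ (fun θ => ∫ z, f z θ ∂P₀) θ₀ a := by
  have hθc : Tendsto θ (𝓝 0) (𝓝 θ₀) := H.param_zero ▸ H.param_deriv.continuousAt.tendsto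
  have hne : 𝓝[≠] (0 : ℝ) ≤ 𝓝 0 := nhdsWithin_le_nhds
  obtain ⟨C, hC⟩ := hb
  have h1 := tendsto_integral_sub_div_of_quadratic_mean hμ (H.isProbability.filter_mono hne)
    (H.dominated.filter_mono hne) H.score_memLp H.quadratic_mean (f := fun t z => f z (θ t))
    (fun t => hf _) (hf θ₀) hL (hc.comp (hθc.mono_left hne)) ⟨C, hC.filter_mono hne⟩
  have hder : HasDerivAt (fun t => ∫ z, f z (θ t) ∂P₀)
      (fderiv ℝ (fun θ => ∫ z, f z θ ∂P₀) θ₀ a) 0 := by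
    have h2 : HasFDerivAt (fun θ => ∫ z, f z θ ∂P₀) (fderiv ℝ (fun θ => ∫ z, f z θ ∂P₀) θ₀)
        (θ 0) := by
      rw [H.param_zero]
      exact hd.hasFDerivAt
    exact h2.comp_hasDerivAt (0 : ℝ) H.param_deriv
  have hz : ∫ z, f z θ₀ ∂P₀ = 0 := by
    have := h0.self_of_nhds
    rwa [H.param_zero, H.law_zero] at this
  rw [hasDerivAt_iff_tendsto_slope] at hder
  refine tendsto_nhds_unique h1 (hder.neg.congr' ?_)
  filter_upwards [h0.filter_mono hne] with t ht
  rw [ht]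
  simp only [slope, H.param_zero, hz, vsub_eq_sub, smul_eq_mul, sub_zero]
  ring

theorem IsRegularSubmodel.integral_score [SigmaFinite μ] [IsProbabilityMeasure P₀]
    (hμ : P₀ ≪ μ) {θ : ℝ → Fin d → ℝ} {P : ℝ → Measure (Fin q → ℝ)} {a : Fin d → ℝ}
    {s : (Fin q → ℝ) → ℝ} (H : IsRegularSubmodel μ P₀ Θ θ₀ R m θ P a s) :
    ∫ z, s z ∂P₀ = 0 := by
  have hne : 𝓝[≠] (0 : ℝ) ≤ 𝓝 0 := nhdsWithin_le_nhds
  have h1 := tendsto_integral_sub_div_of_quadratic_mean hμ (H.isProbability.filter_mono hne)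
    (H.dominated.filter_mono hne) H.score_memLp H.quadratic_mean (f := fun _ _ => 1)
    (f₀ := fun _ => 1) (fun _ => measurable_const) measurable_const (memLp_const 1)
    (by simp) ⟨1, by
      filter_upwards [H.isProbability.filter_mono hne] with t ht
      rw [eLpNorm_const _ (by norm_num) (NeZero.ne _)]
      simp⟩
  have h2 : Tendsto (fun t => (∫ _z, (1 : ℝ) ∂(P t) - ∫ _z, (1 : ℝ) ∂P₀) / t) (𝓝[≠] 0) (𝓝 0) := by
    refine tendsto_const_nhds.congr' ?_
    filter_upwards [H.isProbability.filter_mono hne] with t ht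
    simp
  simpa using tendsto_nhds_unique h1 h2

end Information

/-! ### Unconditional moment models -/

section Marginal

theorem exists_bounded_mean_zero_norm_sub_lt {Ω : Type*} [MeasurableSpace Ω] {P : Measure Ω}
    [IsProbabilityMeasure P] {s : Lp ℝ 2 P} (hs : ∫ z, s z ∂P = 0) {ε : ℝ} (hε : 0 < ε) :
    ∃ h : Ω → ℝ, Measurable h ∧ (∃ K : ℝ, ∀ z, |h z| ≤ K) ∧ ∫ z, h z ∂P = 0 ∧
      ∃ hL : MemLp h 2 P, ‖s - hL.toLp h‖ < ε := by
  obtain ⟨f, ⟨h, hm, ⟨K, hK⟩, he⟩, hlt⟩ := exists_mem_boundedLp_norm_sub_lt s (half_pos hε)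
  set e : ℝ := ∫ z, f z ∂P with he'
  have hhL : MemLp h 2 P := memLp_two_of_bounded hm.aestronglyMeasurable hK
  have hb : ∀ z, |h z - e| ≤ K + |e| := fun z => (abs_sub _ _).trans (add_le_add (hK z) le_rfl)
  have hL : MemLp (fun z => h z - e) 2 P :=
    memLp_two_of_bounded (hm.sub_const e).aestronglyMeasurable hb
  refine ⟨fun z => h z - e, hm.sub_const e, ⟨_, hb⟩, ?_, hL, ?_⟩
  · rw [integral_sub (hhL.integrable (by norm_num)) (integrable_const e),
      ← integral_congr_ae he, ← he']
    simp
  · have h1 : hL.toLp (fun z => h z - e) = f - e • Lp.const 2 P (1 : ℝ) := by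
      refine Lp.ext ?_
      filter_upwards [hL.coeFn_toLp, he, Lp.coeFn_sub f (e • Lp.const 2 P (1 : ℝ)),
        Lp.coeFn_smul e (Lp.const 2 P (1 : ℝ)), Lp.coeFn_const 2 P (1 : ℝ)] with z e1 e2 e3 e4 e5
      rw [e1, e3, Pi.sub_apply, e4, Pi.smul_apply, e5, e2]
      simp
    have hone : ‖Lp.const 2 P (1 : ℝ)‖ ≤ 1 := by
      have := Lp.norm_const_le (p := 2) (μ := P) (c := (1 : ℝ))
      simpa using this
    have h2 : |e| ≤ ‖s - f‖ := by
      have h3 : e = inner ℝ (Lp.const 2 P (1 : ℝ)) (f - s) := by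
        rw [inner_sub_right, inner_const_one, inner_const_one, hs, sub_zero]
      rw [h3, norm_sub_rev]
      refine (abs_real_inner_le_norm _ _).trans ?_
      exact mul_le_of_le_one_left (norm_nonneg _) hone
    rw [h1, sub_sub_eq_add_sub, add_sub_right_comm]
    refine (norm_add_le _ _).trans_lt ?_
    rw [norm_smul, Real.norm_eq_abs]
    have := mul_le_of_le_one_right (abs_nonneg e) hone
    linarith

/-- Linearly independent elements of `L²` with mean zero have a dual system of bounded functions with
mean zero. -/
theorem exists_bounded_dual {Ω κ : Type*} [MeasurableSpace Ω] {P : Measure Ω}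
    [IsProbabilityMeasure P] [Fintype κ] [DecidableEq κ] {v : κ → Lp ℝ 2 P}
    (hv : LinearIndependent ℝ v) (hv0 : ∀ k, ∫ z, v k z ∂P = 0) :
    ∃ w : κ → Ω → ℝ, (∀ l, Measurable (w l)) ∧ (∃ K : ℝ, ∀ l z, |w l z| ≤ K) ∧
      (∀ l, ∫ z, w l z ∂P = 0) ∧ ∀ k l, ∫ z, v k z * w l z ∂P = if k = l then 1 else 0 := by
  -- bounded functions take all values on the `v_k`: a linear relation between these values would be
  -- one between the `v_k`, by density
  let Φ : boundedLp P →ₗ[ℝ] (κ → ℝ) :=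
    LinearMap.pi fun k => ((innerSL ℝ (v k)).toLinearMap).comp (boundedLp P).subtype
  have hsurj : LinearMap.range Φ = ⊤ := by
    by_contra hne
    obtain ⟨F, hF, hker⟩ := Submodule.exists_le_ker_of_lt_top _ (lt_top_iff_ne_top.2 hne)
    have hz : ∑ k, F (Pi.single k 1) • v k = 0 := by
      refine eq_zero_of_inner_boundedLp fun h hh => ?_
      have h1 : F (Φ ⟨h, hh⟩) = 0 := hker ⟨_, rfl⟩
      rw [LinearMap.pi_apply_eq_sum_univ F] at h1
      rw [sum_inner, ← h1]
      refine Finset.sum_congr rfl fun k _ => ?_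
      have h2 : Φ ⟨h, hh⟩ k = inner ℝ (v k) h := rfl
      have h3 : (fun j => if k = j then (1 : ℝ) else 0) = Pi.single k 1 := by
        ext j; simp [Pi.single_apply, eq_comm]
      rw [real_inner_smul_left, h2, smul_eq_mul, h3, mul_comm]
    have h0 := Fintype.linearIndependent_iff.1 hv _ hz
    apply hF
    refine LinearMap.pi_ext' fun k => LinearMap.ext_ring ?_
    simpa using h0 k
  have hex : ∀ l, ∃ w : Ω → ℝ, Measurable w ∧ (∃ K : ℝ, ∀ z, |w z| ≤ K) ∧ ∫ z, w z ∂P = 0 ∧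
      ∀ k, ∫ z, v k z * w z ∂P = if k = l then 1 else 0 := by
    intro l
    obtain ⟨⟨f, h, hm, ⟨K, hK⟩, he⟩, hf⟩ := LinearMap.range_eq_top.1 hsurj (Pi.single l 1)
    have hhL : MemLp h 2 P := memLp_two_of_bounded hm.aestronglyMeasurable hK
    -- centering does not change the values, as the `v_k` have mean zero
    set e : ℝ := ∫ z, h z ∂P with he'
    refine ⟨fun z => h z - e, hm.sub_const e, ⟨K + |e|, fun z => (abs_sub _ _).trans
      (add_le_add (hK z) le_rfl)⟩, ?_, fun k => ?_⟩
    · rw [integral_sub (hhL.integrable (by norm_num)) (integrable_const e), ← he']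
      simp
    · have h1 : inner ℝ (v k) f = (Pi.single l 1 : κ → ℝ) k := congrFun hf k
      rw [inner_eq_integral_of_ae_eq (ae_eq_refl _) he, Pi.single_apply] at h1
      simp only [mul_sub]
      rw [integral_sub (integrable_mul_of_memLp_two (Lp.memLp _) hhL)
        (((Lp.memLp (v k)).integrable (by norm_num)).mul_const e), integral_mul_const, hv0, h1]
      simp
  choose w hwm hwb hw0 hw using hex
  choose K hK using hwb
  exact ⟨w, hwm, ⟨∑ l, |K l|, fun l z => (hK l z).trans ((le_abs_self _).trans
    (Finset.single_le_sum (f := fun l => |K l|) (fun _ _ => abs_nonneg _) (Finset.mem_univ l)))⟩,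
    hw0, fun k l => hw l k⟩

variable {q d : ℕ}

/-- Correcting the path with density `1 + t h` by multiples of the dual functions `w_l`, determined
by a linear system of equations, makes it satisfy the restrictions `E[f_k(Z, θ₀ + t a)] = 0`; to first
order in `t` the multiples are `-(D_l a + E[f_l h])`. -/
theorem exists_density_path {κ : Type*} [Fintype κ] [DecidableEq κ]
    {P₀ : Measure (Fin q → ℝ)} [IsProbabilityMeasure P₀] {θ₀ : Fin d → ℝ}
    {f : κ → (Fin q → ℝ) → (Fin d → ℝ) → ℝ} (hf : ∀ k θ, Measurable fun z => f k z θ)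
    (hL : ∀ k, MemLp (fun z => f k z θ₀) 2 P₀)
    (hc : ∀ k, Tendsto (fun θ => eLpNorm (fun z => f k z θ - f k z θ₀) 2 P₀) (𝓝 θ₀) (𝓝 0))
    (hd : ∀ k, DifferentiableAt ℝ (fun θ => ∫ z, f k z θ ∂P₀) θ₀)
    (h0 : ∀ k, ∫ z, f k z θ₀ ∂P₀ = 0) {w : κ → (Fin q → ℝ) → ℝ} (hwm : ∀ l, Measurable (w l))
    {W : ℝ} (hwb : ∀ l z, |w l z| ≤ W) (hw0 : ∀ l, ∫ z, w l z ∂P₀ = 0)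
    (hw : ∀ k l, ∫ z, f k z θ₀ * w l z ∂P₀ = if k = l then 1 else 0)
    {h : (Fin q → ℝ) → ℝ} (hm : Measurable h) {K : ℝ} (hK : ∀ z, |h z| ≤ K)
    (hh0 : ∫ z, h z ∂P₀ = 0) (a : Fin d → ℝ) :
    ∃ (ρ : ℝ → (Fin q → ℝ) → ℝ) (ε : ℝ → ℝ), (∀ t, Measurable (ρ t)) ∧ (∀ z, ρ 0 z = 1) ∧
      (∀ t, ∫ z, ρ t z ∂P₀ = 1) ∧ Tendsto ε (𝓝[≠] 0) (𝓝 0) ∧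
      (∀ᶠ t in 𝓝[≠] 0, ∀ z, |(ρ t z - 1) / t - (h z - ∑ l,
        (fderiv ℝ (fun θ => ∫ z, f l z θ ∂P₀) θ₀ a + ∫ z, f l z θ₀ * h z ∂P₀) * w l z)| ≤ ε t) ∧
      ∀ᶠ t in 𝓝 (0 : ℝ), ∀ k, ∫ z, ρ t z * f k z (θ₀ + t • a) ∂P₀ = 0 := by
  set D : κ → ℝ := fun l => fderiv ℝ (fun θ => ∫ z, f l z θ ∂P₀) θ₀ a + ∫ z, f l z θ₀ * h z ∂P₀
    with hD
  have hhL : MemLp h 2 P₀ := memLp_two_of_bounded hm.aestronglyMeasurable hK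
  have hwL : ∀ l, MemLp (w l) 2 P₀ := fun l =>
    memLp_two_of_bounded (hwm l).aestronglyMeasurable (hwb l)
  have hpath : HasDerivAt (fun t : ℝ => θ₀ + t • a) a 0 := by
    simpa using ((hasDerivAt_id (0 : ℝ)).smul_const a).const_add θ₀
  have hpc : Tendsto (fun t : ℝ => θ₀ + t • a) (𝓝 0) (𝓝 θ₀) := by
    simpa using hpath.continuousAt.tendsto
  have hne : 𝓝[≠] (0 : ℝ) ≤ 𝓝 0 := nhdsWithin_le_nhds
  have hfm : ∀ k, ∀ᶠ t in 𝓝 (0 : ℝ), AEStronglyMeasurable (fun z => f k z (θ₀ + t • a)) P₀ :=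
    fun k => Eventually.of_forall fun t => (hf k _).aestronglyMeasurable
  have hcov : ∀ k {g : (Fin q → ℝ) → ℝ}, MemLp g 2 P₀ →
      Tendsto (fun t : ℝ => ∫ z, f k z (θ₀ + t • a) * g z ∂P₀) (𝓝 0)
        (𝓝 (∫ z, f k z θ₀ * g z ∂P₀)) := fun k g hg =>
    tendsto_integral_mul (hfm k) (Eventually.of_forall fun _ => hg.1) (hL k) hg
      ((hc k).comp hpc) (by simp)
  -- the linear system `A_t c_t = -y_t` for the coefficients of the correction
  set A : ℝ → Matrix κ κ ℝ := fun t => Matrix.of fun k l => ∫ z, f k z (θ₀ + t • a) * w l z ∂P₀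
    with hA
  set y : ℝ → κ → ℝ := fun t k => ∫ z, f k z (θ₀ + t • a) ∂P₀
    + t * ∫ z, f k z (θ₀ + t • a) * h z ∂P₀ with hy
  set c : ℝ → κ → ℝ := fun t => -((A t)⁻¹.mulVec (y t)) with hcdef
  have hA1 : Tendsto A (𝓝 0) (𝓝 1) := by
    refine tendsto_pi_nhds.2 fun k => tendsto_pi_nhds.2 fun l => ?_
    have := hcov k (hwL l)
    rw [hw] at this
    rwa [Matrix.one_apply]
  have hinv : Tendsto (fun t => (A t)⁻¹) (𝓝 0) (𝓝 1) := by
    have h1 : ContinuousAt (Inv.inv : Matrix κ κ ℝ → Matrix κ κ ℝ) 1 :=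
      continuousAt_matrix_inv _ (by
        rw [Ring.inverse_eq_inv', Matrix.det_one]
        exact continuousAt_inv₀ one_ne_zero)
    have h2 := h1.tendsto
    rw [inv_one] at h2
    exact h2.comp hA1
  have hdet : ∀ᶠ t in 𝓝 (0 : ℝ), IsUnit (A t).det := by
    have h1 : Tendsto (fun t => (A t).det) (𝓝 0) (𝓝 1) := by
      have := ((continuous_id (X := Matrix κ κ ℝ)).matrix_det.tendsto 1).comp hA1
      simp only [id, Matrix.det_one] at this
      exact this
    filter_upwards [h1.eventually_ne one_ne_zero] with t ht using ht.isUnit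
  have hy0 : y 0 = 0 := by
    ext k; simp [hy, h0]
  have hydiv : Tendsto (fun t => t⁻¹ • y t) (𝓝[≠] 0) (𝓝 D) := by
    rw [tendsto_pi_nhds]
    intro k
    have h1 : HasDerivAt (fun t : ℝ => ∫ z, f k z (θ₀ + t • a) ∂P₀)
        (fderiv ℝ (fun θ => ∫ z, f k z θ ∂P₀) θ₀ a) 0 := by
      have h2 : HasFDerivAt (fun θ => ∫ z, f k z θ ∂P₀)
          (fderiv ℝ (fun θ => ∫ z, f k z θ ∂P₀) θ₀) (θ₀ + (0 : ℝ) • a) := by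
        simpa using (hd k).hasFDerivAt
      exact h2.comp_hasDerivAt (0 : ℝ) hpath
    rw [hasDerivAt_iff_tendsto_slope] at h1
    refine (h1.add ((hcov k hhL).mono_left hne)).congr' ?_
    filter_upwards [self_mem_nhdsWithin] with t (ht : t ≠ 0)
    simp only [slope, hy, zero_smul, add_zero, h0, vsub_eq_sub, sub_zero, smul_eq_mul,
      Pi.smul_apply]
    field_simp
  have hcdiv : Tendsto (fun t => t⁻¹ • c t) (𝓝[≠] 0) (𝓝 (-D)) := by
    have h1 : Continuous fun x : Matrix κ κ ℝ × (κ → ℝ) => x.1.mulVec x.2 :=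
      continuous_fst.matrix_mulVec continuous_snd
    have h2 := (h1.tendsto (1, D)).comp ((hinv.mono_left hne).prodMk_nhds hydiv)
    simp only [Matrix.one_mulVec] at h2
    refine h2.neg.congr fun t => ?_
    simp [hcdef, Matrix.mulVec_smul]
  have hint : ∀ v : κ → ℝ, Integrable (fun z => ∑ l, v l * w l z) P₀ := fun v =>
    integrable_finsetSum _ fun l _ => ((hwL l).integrable (by norm_num)).const_mul _
  have hhi : ∀ t : ℝ, Integrable (fun z => t * h z) P₀ := fun t =>
    (hhL.integrable (by norm_num)).const_mul t
  refine ⟨fun t z => 1 + t * h z + ∑ l, c t l * w l z, fun t => ∑ l, |t⁻¹ * c t l + D l| * W,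
    fun t => ?_, fun z => ?_, fun t => ?_, ?_, ?_, ?_⟩
  · exact ((hm.const_mul t).const_add 1).add
      (Finset.measurable_sum _ fun l _ => (hwm l).const_mul _)
  · simp [hcdef, hy0]
  · have i1 : Integrable (fun z => 1 + t * h z) P₀ := (integrable_const 1).add (hhi t)
    rw [integral_add i1 (hint _), integral_add (integrable_const 1) (hhi t), integral_const_mul,
      hh0, integral_finsetSum _ fun l _ => ((hwL l).integrable (by norm_num)).const_mul _]
    simp [integral_const_mul, hw0]
  · have h1 : ∀ l, Tendsto (fun t => |t⁻¹ * c t l + D l| * W) (𝓝[≠] 0) (𝓝 0) := fun l => by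
      have h2 := ((tendsto_pi_nhds.1 hcdiv l).add_const (D l)).abs.mul_const W
      simpa using h2
    simpa using tendsto_finsetSum Finset.univ fun l _ => h1 l
  · filter_upwards [self_mem_nhdsWithin] with t (ht : t ≠ 0) z
    have e : (1 + t * h z + ∑ l, c t l * w l z - 1) / t - (h z - ∑ l, D l * w l z)
        = ∑ l, (t⁻¹ * c t l + D l) * w l z := by
      simp only [add_mul, Finset.sum_add_distrib, mul_assoc, ← Finset.mul_sum]
      field_simp
      ring
    rw [e]
    refine (Finset.abs_sum_le_sum_abs _ _).trans (Finset.sum_le_sum fun l _ => ?_)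
    rw [abs_mul]
    exact mul_le_mul_of_nonneg_left (hwb l z) (abs_nonneg _)
  · have hfL : ∀ᶠ t in 𝓝 (0 : ℝ), ∀ k, MemLp (fun z => f k z (θ₀ + t • a)) 2 P₀ :=
      eventually_all.2 fun k => eventually_memLp_of_tendsto (hfm k) (hL k) ((hc k).comp hpc)
    filter_upwards [hfL, hdet] with t h1 h2 k
    have i1 : Integrable (fun z => f k z (θ₀ + t • a)) P₀ := (h1 k).integrable (by norm_num)
    have i2 : Integrable (fun z => t * (f k z (θ₀ + t • a) * h z)) P₀ :=
      (integrable_mul_of_memLp_two (h1 k) hhL).const_mul t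
    have i3 : ∀ l, Integrable (fun z => c t l * (f k z (θ₀ + t • a) * w l z)) P₀ := fun l =>
      (integrable_mul_of_memLp_two (h1 k) (hwL l)).const_mul _
    have i12 : Integrable (fun z => f k z (θ₀ + t • a) + t * (f k z (θ₀ + t • a) * h z)) P₀ :=
      i1.add i2
    have e : (fun z => (1 + t * h z + ∑ l, c t l * w l z) * f k z (θ₀ + t • a)) = fun z =>
        (f k z (θ₀ + t • a) + t * (f k z (θ₀ + t • a) * h z))
          + ∑ l, c t l * (f k z (θ₀ + t • a) * w l z) := by
      ext z
      rw [add_mul, Finset.sum_mul]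
      congr 1
      · ring
      · exact Finset.sum_congr rfl fun l _ => by ring
    rw [e, integral_add i12 (integrable_finsetSum _ fun l _ => i3 l), integral_add i1 i2,
      integral_const_mul, integral_finsetSum _ fun l _ => i3 l]
    simp only [integral_const_mul]
    have hsys : (A t).mulVec (c t) = -y t := by
      rw [hcdef]
      simp only [Matrix.mulVec_neg, Matrix.mulVec_mulVec, Matrix.mul_nonsing_inv _ h2,
        Matrix.one_mulVec]
    have hk := congrFun hsys k
    simp only [Matrix.mulVec, dotProduct, hA, Matrix.of_apply, Pi.neg_apply, hy] at hk
    have hk' : ∑ l, c t l * ∫ z, f k z (θ₀ + t • a) * w l z ∂P₀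
        = ∑ l, (∫ z, f k z (θ₀ + t • a) * w l z ∂P₀) * c t l :=
      Finset.sum_congr rfl fun l _ => mul_comm _ _
    rw [hk', hk]
    ring

/-- The span of the constants and the `v_i`. -/
def momentSpan {Ω ι : Type*} [MeasurableSpace Ω] {P : Measure Ω} [IsFiniteMeasure P]
    (v : ι → Lp ℝ 2 P) : Submodule ℝ (Lp ℝ 2 P) :=
  Submodule.span ℝ (insert (Lp.const 2 P (1 : ℝ)) (Set.range v))

instance {Ω ι : Type*} [MeasurableSpace Ω] {P : Measure Ω} [IsFiniteMeasure P] [Finite ι]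
    (v : ι → Lp ℝ 2 P) : FiniteDimensional ℝ (momentSpan v) :=
  FiniteDimensional.span_of_finite ℝ ((Set.finite_range v).insert _)

theorem mem_momentSpan_orthogonal {Ω ι : Type*} [MeasurableSpace Ω] {P : Measure Ω}
    [IsFiniteMeasure P] {v : ι → Lp ℝ 2 P} {h : Lp ℝ 2 P} :
    h ∈ (momentSpan v)ᗮ ↔ ∫ z, h z ∂P = 0 ∧ ∀ i, inner ℝ (v i) h = 0 := by
  constructor
  · intro hh
    exact ⟨by rw [← inner_const_one]; exact hh _ (Submodule.subset_span (Set.mem_insert _ _)),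
      fun i => hh _ (Submodule.subset_span (Set.mem_insert_of_mem _ ⟨i, rfl⟩))⟩
  · rintro ⟨h1, h2⟩ f hf
    induction hf using Submodule.span_induction with
    | mem f hf =>
      rcases hf with rfl | ⟨i, rfl⟩
      · rw [inner_const_one, h1]
      · exact h2 i
    | zero => exact inner_zero_left _
    | add f f' _ _ e e' => rw [inner_add_left, e, e', add_zero]
    | smul r f _ e => rw [real_inner_smul_left, e, mul_zero]

variable {ι : Type} [Finite ι] {μ P₀ : Measure (Fin q → ℝ)} {Θ : Set (Fin d → ℝ)}
  {θ₀ : Fin d → ℝ} {m : ι → (Fin q → ℝ) → (Fin d → ℝ) → ℝ}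

theorem eventually_forall_eLpNorm_le [IsProbabilityMeasure P₀]
    (hm : ∀ i θ, Measurable fun z => m i z θ) (hL : ∀ i, MemLp (fun z => m i z θ₀) 2 P₀)
    (hc : ∀ i, Tendsto (fun θ => eLpNorm (fun z => m i z θ - m i z θ₀) 2 P₀) (𝓝 θ₀) (𝓝 0)) :
    ∃ C : ℝ≥0, ∀ᶠ θ in 𝓝 θ₀, ∀ i, eLpNorm (fun z => m i z θ) 2 P₀ ≤ C := by
  have := Fintype.ofFinite ι
  choose C hC using fun i => eventually_eLpNorm_le_of_tendsto
    (Eventually.of_forall fun θ => (hm i θ).aestronglyMeasurable) (hL i) (hc i)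
  refine ⟨∑ i, C i, (eventually_all.2 hC).mono fun θ h i => (h i).trans ?_⟩
  exact_mod_cast Finset.single_le_sum (f := C) (fun _ _ => bot_le) (Finset.mem_univ i)

theorem norm_sub_sum_inner_smul_sub_lt {E κ : Type*} [NormedAddCommGroup E] [InnerProductSpace ℝ E]
    [Fintype κ] (v w : κ → E) {s h : E} {ε : ℝ}
    (hlt : ‖s - h‖ < ε / (1 + ∑ l, ‖v l‖ * ‖w l‖)) :
    ‖h - ∑ l, (-inner ℝ (v l) (s - h)) • w l - s‖ < ε := by
  have hpos : 0 < 1 + ∑ l, ‖v l‖ * ‖w l‖ := by positivity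
  rw [lt_div_iff₀ hpos] at hlt
  have h2 : ‖∑ l, (-inner ℝ (v l) (s - h)) • w l‖ ≤ ∑ l, ‖v l‖ * ‖w l‖ * ‖s - h‖ := by
    refine (norm_sum_le _ _).trans (Finset.sum_le_sum fun l _ => ?_)
    rw [norm_smul, norm_neg]
    have := mul_le_mul_of_nonneg_right (norm_inner_le_norm (𝕜 := ℝ) (v l) (s - h))
      (norm_nonneg (w l))
    linarith
  rw [← Finset.sum_mul] at h2
  rw [sub_right_comm]
  have h3 := norm_sub_le (h - s) (∑ l, (-inner ℝ (v l) (s - h)) • w l)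
  rw [norm_sub_rev h s] at h3
  linarith

/-- Every square-integrable function with the covariances with the moment functions that a score has
is approximated by scores of regular submodels. Linear relations between the moment functions at `θ₀`
have to persist at other values of `θ`: otherwise they would be further restrictions. -/
theorem exists_regular_submodel_marginal [SigmaFinite μ] [IsProbabilityMeasure P₀] (hμ : P₀ ≪ μ)
    (hΘ : Θ ∈ 𝓝 θ₀) (hm : ∀ i θ, Measurable fun z => m i z θ)
    (hL : ∀ i, MemLp (fun z => m i z θ₀) 2 P₀)
    (hc : ∀ i, Tendsto (fun θ => eLpNorm (fun z => m i z θ - m i z θ₀) 2 P₀) (𝓝 θ₀) (𝓝 0))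
    (hd : ∀ i, DifferentiableAt ℝ (fun θ => ∫ z, m i z θ ∂P₀) θ₀)
    (h0 : ∀ i, ∫ z, m i z θ₀ ∂P₀ = 0)
    (hdep : ∀ (i : ι) (κ : Type) [Fintype κ] (b : κ → ι) (e : κ → ℝ),
      (fun z => m i z θ₀) =ᵐ[P₀] (fun z => ∑ k, e k * m (b k) z θ₀) →
      ∀ θ, (fun z => m i z θ) =ᵐ[P₀] fun z => ∑ k, e k * m (b k) z θ)
    (a : Fin d → ℝ) {s : Lp ℝ 2 P₀} (hs1 : ∫ z, s z ∂P₀ = 0)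
    (hs : ∀ i, ∫ z, m i z θ₀ * s z ∂P₀ = -fderiv ℝ (fun θ => ∫ z, m i z θ ∂P₀) θ₀ a)
    {ε : ℝ} (hε : 0 < ε) :
    ∃ θ P u, ∃ H : IsRegularSubmodel μ P₀ Θ θ₀ (MarginalRestriction m) m θ P a u,
      ‖H.score_memLp.toLp u - s‖ < ε := by
  classical
  obtain ⟨κ, b, hb, hspan, hind⟩ := exists_linearIndependent' ℝ fun i => (hL i).toLp
  have : Finite κ := Finite.of_injective b hb
  have := Fintype.ofFinite κ
  obtain ⟨w, hwm, ⟨W, hW⟩, hw0, hw⟩ := exists_bounded_dual hind fun k => by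
    exact (integral_congr_ae (hL (b k)).coeFn_toLp).trans (h0 _)
  have hw' : ∀ k l, ∫ z, m (b k) z θ₀ * w l z ∂P₀ = if k = l then 1 else 0 := fun k l => by
    rw [← hw k l]
    refine integral_congr_ae ?_
    filter_upwards [(hL (b k)).coeFn_toLp] with z hz
    simp only [Function.comp_apply]
    rw [hz]
  have hwL : ∀ l, MemLp (w l) 2 P₀ := fun l =>
    memLp_two_of_bounded (hwm l).aestronglyMeasurable (hW l)
  -- `B` bounds the effect on the score of the correction made by `exists_density_path`
  set B : ℝ := 1 + ∑ l, ‖(hL (b l)).toLp‖ * ‖(hwL l).toLp‖ with hB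
  have hBpos : 0 < B := by positivity
  obtain ⟨h, hhm, ⟨K, hK⟩, hh0, hhL, hlt⟩ :=
    exists_bounded_mean_zero_norm_sub_lt hs1 (div_pos hε hBpos)
  obtain ⟨ρ, δ, hρm, hρ0, hρ1, hδ, hρδ, hρR⟩ := exists_density_path (fun k => hm (b k))
    (fun k => hL (b k)) (fun k => hc (b k)) (fun k => hd (b k)) (fun k => h0 (b k)) hwm hW hw0 hw'
    hhm hK hh0 a
  set D : κ → ℝ := fun l => fderiv ℝ (fun θ => ∫ z, m (b l) z θ ∂P₀) θ₀ a
    + ∫ z, m (b l) z θ₀ * h z ∂P₀ with hD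
  have hpath : HasDerivAt (fun t : ℝ => θ₀ + t • a) a 0 := by
    simpa using ((hasDerivAt_id (0 : ℝ)).smul_const a).const_add θ₀
  have hpc : Tendsto (fun t : ℝ => θ₀ + t • a) (𝓝 0) (𝓝 θ₀) := by
    simpa using hpath.continuousAt.tendsto
  have hum : Measurable fun z => h z - ∑ l, D l * w l z :=
    hhm.sub (Finset.measurable_sum _ fun l _ => (hwm l).const_mul _)
  have hub : ∀ z, |h z - ∑ l, D l * w l z| ≤ K + ∑ l, |D l| * W := fun z => by
    refine (abs_sub _ _).trans (add_le_add (hK z) ((Finset.abs_sum_le_sum_abs _ _).trans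
      (Finset.sum_le_sum fun l _ => ?_)))
    rw [abs_mul]
    exact mul_le_mul_of_nonneg_left (hW l z) (abs_nonneg _)
  have H := isRegularSubmodel_withDensity (R := MarginalRestriction m) (m := m) hμ hΘ
    (θ := fun t : ℝ => θ₀ + t • a) (by simp) hpath hρm hρ0 hρ1 hum hub hδ hρδ
    (eventually_forall_eLpNorm_le hm hL hc) (by
      have hev : ∀ᶠ t in 𝓝 (0 : ℝ), ∀ i, MemLp (fun z => m i z (θ₀ + t • a)) 2 P₀ :=
        eventually_all.2 fun i => eventually_memLp_of_tendsto
          (Eventually.of_forall fun t => (hm i _).aestronglyMeasurable) (hL i) ((hc i).comp hpc)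
      filter_upwards [hρR, hev] with t h1 h2 h3 i
      have hpos : ∀ z, 0 ≤ ρ t z := fun z => by have := abs_le.1 (h3 z); linarith
      have hle : ∀ z, |ρ t z| ≤ 2 := fun z => by
        have := abs_le.1 (h3 z)
        rw [abs_le]
        constructor <;> linarith
      refine ⟨?_, ?_⟩
      · refine Integrable.mono_measure ?_ (withDensity_ofReal_le (C := 2)
          fun z => (le_abs_self _).trans (hle z))
        exact ((h2 i).integrable (by norm_num)).smul_measure ENNReal.ofReal_ne_top
      · rw [integral_withDensity_ofReal (hρm t) hpos]
        -- `m_i` is a combination of the chosen basis, at every value of `θ`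
        have hmem : (hL i).toLp ∈ Submodule.span ℝ (Set.range ((fun i => (hL i).toLp) ∘ b)) := by
          rw [hspan]
          exact Submodule.subset_span ⟨i, rfl⟩
        obtain ⟨e, he⟩ := (Submodule.mem_span_range_iff_exists_fun ℝ).1 hmem
        have hcomb : (fun z => m i z θ₀) =ᵐ[P₀] fun z => ∑ k, e k * m (b k) z θ₀ := by
          have h4 := Lp.coeFn_finsetSum (p := 2) (μ := P₀) Finset.univ
            fun k => e k • (hL (b k)).toLp
          filter_upwards [(hL i).coeFn_toLp, h4,
            ae_all_iff.2 fun k => Lp.coeFn_smul (e k) (hL (b k)).toLp,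
            ae_all_iff.2 fun k => (hL (b k)).coeFn_toLp] with z e1 e2 e3 e4
          have e5 : (∑ k, e k • (hL (b k)).toLp) = (hL i).toLp := he
          rw [← e1, ← e5, e2, Finset.sum_apply]
          refine Finset.sum_congr rfl fun k _ => ?_
          rw [e3, Pi.smul_apply, e4, smul_eq_mul]
        have hae : (fun z => ρ t z * m i z (θ₀ + t • a)) =ᵐ[P₀]
            fun z => ∑ k, e k * (ρ t z * m (b k) z (θ₀ + t • a)) := by
          filter_upwards [hdep i κ b e hcomb (θ₀ + t • a)] with z hz
          rw [hz, Finset.mul_sum]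
          exact Finset.sum_congr rfl fun k _ => by ring
        have hint : ∀ k, Integrable (fun z => e k * (ρ t z * m (b k) z (θ₀ + t • a))) P₀ :=
          fun k => ((((h2 (b k)).integrable (by norm_num)).bdd_mul
            (hρm t).aestronglyMeasurable (Eventually.of_forall hle))).const_mul _
        rw [integral_congr_ae hae, integral_finsetSum _ fun k _ => hint k]
        exact Finset.sum_eq_zero fun k _ => by rw [integral_const_mul, h1 k, mul_zero])
  refine ⟨_, _, _, H, ?_⟩
  have hDs : ∀ l, D l = -inner ℝ (hL (b l)).toLp (s - hhL.toLp h) := fun l => by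
    rw [inner_sub_right, inner_eq_integral_of_ae_eq (hL (b l)).coeFn_toLp (ae_eq_refl s),
      inner_eq_integral_of_ae_eq (hL (b l)).coeFn_toLp hhL.coeFn_toLp, hs]
    ring
  have hu : H.score_memLp.toLp (fun z => h z - ∑ l, D l * w l z)
      = hhL.toLp h - ∑ l, D l • (hwL l).toLp := by
    refine Lp.ext ?_
    filter_upwards [H.score_memLp.coeFn_toLp, hhL.coeFn_toLp,
      Lp.coeFn_sub (hhL.toLp h) (∑ l, D l • (hwL l).toLp),
      Lp.coeFn_finsetSum (p := 2) (μ := P₀) Finset.univ fun l => D l • (hwL l).toLp,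
      ae_all_iff.2 fun l => Lp.coeFn_smul (D l) (hwL l).toLp,
      ae_all_iff.2 fun l => (hwL l).coeFn_toLp] with z e1 e2 e3 e4 e5 e6
    rw [e1, e3, Pi.sub_apply, e2, e4, Finset.sum_apply]
    congr 1
    refine Finset.sum_congr rfl fun l _ => ?_
    rw [e5, Pi.smul_apply, e6, smul_eq_mul]
  rw [hu]
  simp only [hDs]
  exact norm_sub_sum_inner_smul_sub_lt _ _ hlt

/-- The information in an unconditional moment model. -/
theorem isFisherInformation_marginal [SigmaFinite μ] [IsProbabilityMeasure P₀] (hμ : P₀ ≪ μ)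
    (hΘ : Θ ∈ 𝓝 θ₀) (hm : ∀ i θ, Measurable fun z => m i z θ)
    (hL : ∀ i, MemLp (fun z => m i z θ₀) 2 P₀)
    (hc : ∀ i, Tendsto (fun θ => eLpNorm (fun z => m i z θ - m i z θ₀) 2 P₀) (𝓝 θ₀) (𝓝 0))
    (hd : ∀ i, DifferentiableAt ℝ (fun θ => ∫ z, m i z θ ∂P₀) θ₀)
    (h0 : ∀ i, ∫ z, m i z θ₀ ∂P₀ = 0)
    (hdep : ∀ (i : ι) (κ : Type) [Fintype κ] (b : κ → ι) (e : κ → ℝ),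
      (fun z => m i z θ₀) =ᵐ[P₀] (fun z => ∑ k, e k * m (b k) z θ₀) →
      ∀ θ, (fun z => m i z θ) =ᵐ[P₀] fun z => ∑ k, e k * m (b k) z θ)
    {ℓ : Fin d → Lp ℝ 2 P₀} (hℓ0 : ∀ a : Fin d → ℝ, ∫ z, (∑ l, a l • ℓ l : Lp ℝ 2 P₀) z ∂P₀ = 0)
    (hℓ : ∀ i (a : Fin d → ℝ), ∫ z, m i z θ₀ * (∑ l, a l • ℓ l : Lp ℝ 2 P₀) z ∂P₀
      = -fderiv ℝ (fun θ => ∫ z, m i z θ ∂P₀) θ₀ a) :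
    IsFisherInformation μ P₀ Θ θ₀ (MarginalRestriction m) m
      (projectedGram (momentSpan fun i => (hL i).toLp) ℓ) := by
  refine isFisherInformation_projectedGram _ ℓ (fun θ P a s H => ?_) fun a h hh ε hε => ?_
  · rw [mem_momentSpan_orthogonal]
    refine ⟨?_, fun i => ?_⟩
    · rw [← inner_const_one, inner_sub_right, inner_const_one, inner_const_one, hℓ0,
        integral_congr_ae H.score_memLp.coeFn_toLp, H.integral_score hμ, sub_zero]
    · obtain ⟨C, hC⟩ := H.bounded_moments
      have h1 := H.integral_mul_score hμ (hm i) (hL i) (hc i) (hd i)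
        (H.restriction.mono fun t ht => (ht i).2) ⟨C, hC.mono fun t ht => ht i⟩
      rw [inner_sub_right, inner_eq_integral_of_ae_eq (hL i).coeFn_toLp H.score_memLp.coeFn_toLp,
        inner_eq_integral_of_ae_eq (hL i).coeFn_toLp (ae_eq_refl _), hℓ, h1, sub_self]
  · obtain ⟨h1, h2⟩ := mem_momentSpan_orthogonal.1 hh
    refine exists_regular_submodel_marginal hμ hΘ hm hL hc hd h0 hdep a
      (s := ∑ l, a l • ℓ l + h) ?_ (fun i => ?_) hε
    · rw [← inner_const_one, inner_add_right, inner_const_one, inner_const_one, hℓ0, h1, add_zero]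
    · rw [← inner_eq_integral_of_ae_eq (hL i).coeFn_toLp (ae_eq_refl _), inner_add_right, h2,
        add_zero, inner_eq_integral_of_ae_eq (hL i).coeFn_toLp (ae_eq_refl _), hℓ]

end Marginal

/-! ### The conditional moment model -/

section Conditional

variable {q d : ℕ} {κ : Type} [DecidableEq κ] {X : κ → Type}
  [∀ x, MeasurableSpace (X x)] {π : ∀ x, (Fin q → ℝ) → X x}
  {g : κ → (Fin q → ℝ) → (Fin d → ℝ) → ℝ} {μ P₀ : Measure (Fin q → ℝ)} {Θ : Set (Fin d → ℝ)}
  {θ₀ : Fin d → ℝ}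

/-- The moments `α(π_x) g_x(·, θ)` are continuous in `L²` and differentiable in mean at `θ₀`, for all
square-integrable instruments `α`. -/
def SmoothInstrumented (P₀ : Measure (Fin q → ℝ)) (π : ∀ x, (Fin q → ℝ) → X x)
    (g : κ → (Fin q → ℝ) → (Fin d → ℝ) → ℝ) (θ₀ : Fin d → ℝ) : Prop :=
  ∀ x (α : Lp ℝ 2 (P₀.map (π x))),
    Tendsto (fun θ => eLpNorm (fun z => α (π x z) * g x z θ - α (π x z) * g x z θ₀) 2 P₀) (𝓝 θ₀)
      (𝓝 0) ∧
    DifferentiableAt ℝ (fun θ => ∫ z, α (π x z) * g x z θ ∂P₀) θ₀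

theorem measurable_instrumented (S : InstrumentedMoments P₀ π fun x z => g x z θ₀)
    (hg : ∀ x θ, Measurable fun z => g x z θ) (x : κ) (α : Lp ℝ 2 (P₀.map (π x)))
    (θ : Fin d → ℝ) : Measurable fun z => α (π x z) * g x z θ :=
  ((Lp.stronglyMeasurable α).measurable.comp (S.measurable_proj x)).mul (hg x θ)

theorem memLp_instrumented (S : InstrumentedMoments P₀ π fun x z => g x z θ₀) (x : κ)
    (α : Lp ℝ 2 (P₀.map (π x))) : MemLp (fun z => α (π x z) * g x z θ₀) 2 P₀ :=
  (memLp_congr_ae (S.coeFn_op x α)).1 (Lp.memLp _)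

theorem const_one_comp_ae_eq [IsProbabilityMeasure P₀]
    (S : InstrumentedMoments P₀ π fun x z => g x z θ₀) (x : κ) :
    (fun z => Lp.const 2 (P₀.map (π x)) (1 : ℝ) (π x z)) =ᵐ[P₀] fun _ => 1 :=
  comp_ae_eq_comp (S.measurable_proj x) (Lp.coeFn_const 2 (P₀.map (π x)) (1 : ℝ))

theorem memLp_moment [IsProbabilityMeasure P₀]
    (S : InstrumentedMoments P₀ π fun x z => g x z θ₀) (x : κ) :
    MemLp (fun z => g x z θ₀) 2 P₀ := by
  refine (memLp_congr_ae ?_).1 (memLp_instrumented S x (Lp.const 2 _ 1))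
  filter_upwards [const_one_comp_ae_eq S x] with z hz
  rw [hz, one_mul]

theorem tendsto_eLpNorm_moment [IsProbabilityMeasure P₀]
    (S : InstrumentedMoments P₀ π fun x z => g x z θ₀) (hreg : SmoothInstrumented P₀ π g θ₀)
    (x : κ) : Tendsto (fun θ => eLpNorm (fun z => g x z θ - g x z θ₀) 2 P₀) (𝓝 θ₀) (𝓝 0) := by
  refine (hreg x (Lp.const 2 _ 1)).1.congr fun θ => eLpNorm_congr_ae ?_
  filter_upwards [const_one_comp_ae_eq S x] with z hz
  rw [hz, one_mul, one_mul]

/-- The covariance of a score of the conditional model with an instrumented moment. The second moments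
of `α(π_x) g_x` need not stay bounded along a submodel unless `α` is bounded; both sides are
continuous in `α`, so that indicators suffice. -/
theorem inner_op_score [SigmaFinite μ] [IsProbabilityMeasure P₀] (hμ : P₀ ≪ μ)
    (S : InstrumentedMoments P₀ π fun x z => g x z θ₀) (hg : ∀ x θ, Measurable fun z => g x z θ)
    (hreg : SmoothInstrumented P₀ π g θ₀)
    (hS : ∀ x, ∀ᶠ θ in 𝓝 θ₀, ∃ T : Lp ℝ 2 (P₀.map (π x)) →L[ℝ] Lp ℝ 2 P₀,
      ∀ α, T α =ᵐ[P₀] fun z => α (π x z) * g x z θ)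
    {θ : ℝ → Fin d → ℝ} {P : ℝ → Measure (Fin q → ℝ)} {a : Fin d → ℝ} {s : (Fin q → ℝ) → ℝ}
    (H : IsRegularSubmodel μ P₀ Θ θ₀
      (ConditionalRestriction (fun x => MeasurableSpace.comap (π x) inferInstance) g) g θ P a s)
    (x : κ) (α : Lp ℝ 2 (P₀.map (π x))) :
    inner ℝ (S.op x α) (H.score_memLp.toLp s)
      = -fderiv ℝ (fun θ => ∫ z, α (π x z) * g x z θ ∂P₀) θ₀ a := by
  have : IsProbabilityMeasure (P₀.map (π x)) :=
    Measure.isProbabilityMeasure_map (S.measurable_proj x).aemeasurable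
  obtain ⟨D, hD⟩ := exists_derivative_functional (hS x) (fun α => (hreg x α).2) a
  set F : Lp ℝ 2 (P₀.map (π x)) →L[ℝ] ℝ :=
    (innerSL ℝ (H.score_memLp.toLp s)).comp (S.op x) + D with hF
  have hFapp : ∀ α, F α = inner ℝ (S.op x α) (H.score_memLp.toLp s) + D α := fun α => by
    rw [hF, add_apply, ContinuousLinearMap.comp_apply, innerSL_apply_apply,
      real_inner_comm]
  -- for indicators the restriction is an unconditional moment restriction
  have hF0 : F = 0 := by
    refine clm_eq_zero_of_indicator F fun B hB => ?_
    set e := indicatorConstLp 2 hB (measure_ne_top (P₀.map (π x)) B) (1 : ℝ) with he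
    have hB' : MeasurableSet (π x ⁻¹' B) := S.measurable_proj x hB
    have hee : (fun z => e (π x z)) =ᵐ[P₀] fun z => (π x ⁻¹' B).indicator (fun _ => 1) z := by
      have := comp_ae_eq_comp (S.measurable_proj x)
        (indicatorConstLp_coeFn (p := 2) (hs := hB) (hμs := measure_ne_top (P₀.map (π x)) B)
          (c := (1 : ℝ)))
      filter_upwards [this] with z hz
      rw [← he] at hz
      rw [hz]
      rfl
    have hmul : ∀ θ, (fun z => e (π x z) * g x z θ) =ᵐ[P₀]
        (π x ⁻¹' B).indicator fun z => g x z θ := fun θ => by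
      filter_upwards [hee] with z hz
      rw [hz]
      by_cases hzB : z ∈ π x ⁻¹' B <;> simp [hzB]
    have hint : (fun θ => ∫ z, e (π x z) * g x z θ ∂P₀)
        = fun θ => ∫ z, (π x ⁻¹' B).indicator (fun z => g x z θ) z ∂P₀ :=
      funext fun θ => integral_congr_ae (hmul θ)
    obtain ⟨C, hC⟩ := H.bounded_moments
    have h1 := H.integral_mul_score hμ
      (f := fun z θ => (π x ⁻¹' B).indicator (fun z => g x z θ) z)
      (fun θ => (hg x θ).indicator hB') ((memLp_moment S x).indicator hB')
      ((hreg x e).1.congr fun θ => eLpNorm_congr_ae ((hmul θ).sub (hmul θ₀)))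
      (hint ▸ (hreg x e).2)
      (by
        filter_upwards [H.restriction, H.isProbability] with t ht hp
        rw [integral_indicator hB', ← setIntegral_condExp (S.measurable_proj x).comap_le (ht x).1
          ⟨B, hB, rfl⟩, integral_congr_ae (ae_restrict_of_ae (ht x).2)]
        simp)
      ⟨C, hC.mono fun t ht => (eLpNorm_indicator_le _).trans (ht x)⟩
    rw [hFapp, hD, hint, inner_eq_integral_of_ae_eq ((S.coeFn_op x e).trans (hmul θ₀))
      H.score_memLp.coeFn_toLp, h1, neg_add_cancel]
  have h2 := hFapp α
  rw [hF0, hD, zero_apply] at h2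
  linarith

variable [Fintype κ]

/-- Bounded functions that are orthogonal to the instrumented moments are nuisance scores: the laws
with densities `1 + t h` satisfy the restrictions at `θ₀`. -/
theorem mem_nuisanceTangentSet_of_bounded [SigmaFinite μ] [IsProbabilityMeasure P₀] (hμ : P₀ ≪ μ)
    (hΘ : Θ ∈ 𝓝 θ₀) (S : InstrumentedMoments P₀ π fun x z => g x z θ₀)
    (hg : ∀ x θ, Measurable fun z => g x z θ) (hreg : SmoothInstrumented P₀ π g θ₀)
    {h : (Fin q → ℝ) → ℝ} (hm : Measurable h) {K : ℝ} (hK : ∀ z, |h z| ≤ K)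
    {f : Lp ℝ 2 P₀} (hf : f ∈ S.normalSpaceᗮ) (hfh : f =ᵐ[P₀] h) :
    h ∈ nuisanceTangentSet μ P₀ Θ θ₀
      (ConditionalRestriction (fun x => MeasurableSpace.comap (π x) inferInstance) g) g := by
  obtain ⟨hf0, hfop⟩ := S.mem_normalSpace_orthogonal.1 hf
  have hhL : MemLp h 2 P₀ := memLp_two_of_bounded hm.aestronglyMeasurable hK
  have hh0 : ∫ z, h z ∂P₀ = 0 := by rw [← integral_congr_ae hfh, hf0]
  have hρm : ∀ t : ℝ, Measurable fun z => 1 + t * h z := fun t => (hm.const_mul t).const_add 1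
  refine ⟨_, isRegularSubmodel_withDensity (ρ := fun t z => 1 + t * h z) (ε := fun _ => 0)
    hμ hΘ rfl (hasDerivAt_const _ _) hρm (by simp) (fun t => ?_) hm hK tendsto_const_nhds ?_
    (eventually_forall_eLpNorm_le hg (memLp_moment S) (tendsto_eLpNorm_moment S hreg))
    (Eventually.of_forall fun t ht x => ?_)⟩
  · rw [integral_add (integrable_const 1) ((hhL.integrable (by norm_num)).const_mul t),
      integral_const_mul, hh0]
    simp
  · filter_upwards [self_mem_nhdsWithin] with t (ht : t ≠ 0) z
    rw [add_sub_cancel_left, mul_div_cancel_left₀ _ ht, sub_self, abs_zero]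
  · have hpos : ∀ z, 0 ≤ 1 + t * h z := fun z => by have := abs_le.1 (ht z); linarith
    have hle : ∀ z, 1 + t * h z ≤ 2 := fun z => by have := abs_le.1 (ht z); linarith
    have hgL := memLp_moment S x
    have hint : Integrable (fun z => g x z θ₀)
        (P₀.withDensity fun z => ENNReal.ofReal (1 + t * h z)) :=
      ((hgL.integrable (by norm_num)).smul_measure ENNReal.ofReal_ne_top).mono_measure
        (withDensity_ofReal_le hle)
    have : IsProbabilityMeasure (P₀.withDensity fun z => ENNReal.ofReal (1 + t * h z)) :=
      isProbabilityMeasure_withDensity_ofReal hpos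
        ((integrable_const 1).add ((hhL.integrable (by norm_num)).const_mul t)) (by
          rw [integral_add (integrable_const 1) ((hhL.integrable (by norm_num)).const_mul t),
            integral_const_mul, hh0]
          simp)
    have hprob : IsProbabilityMeasure (P₀.map (π x)) :=
      Measure.isProbabilityMeasure_map (S.measurable_proj x).aemeasurable
    refine ⟨hint, (ae_eq_condExp_of_forall_setIntegral_eq (S.measurable_proj x).comap_le hint
      (fun _ _ _ => integrableOn_zero) ?_ stronglyMeasurable_zero.aestronglyMeasurable).symm⟩
    rintro _ ⟨B, hB, rfl⟩ -
    have hB' : MeasurableSet (π x ⁻¹' B) := S.measurable_proj x hB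
    set e := indicatorConstLp 2 hB (measure_ne_top (P₀.map (π x)) B) (1 : ℝ) with he
    have hmul : S.op x e =ᵐ[P₀] (π x ⁻¹' B).indicator fun z => g x z θ₀ := by
      have := comp_ae_eq_comp (S.measurable_proj x)
        (indicatorConstLp_coeFn (p := 2) (hs := hB) (hμs := measure_ne_top (P₀.map (π x)) B)
          (c := (1 : ℝ)))
      filter_upwards [S.coeFn_op x e, this] with z h1 h2
      rw [← he] at h2
      rw [h1, h2]
      by_cases hzB : π x z ∈ B <;> simp [hzB]
    have h1 : ∫ z in π x ⁻¹' B, g x z θ₀ ∂P₀ = 0 := by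
      rw [← integral_indicator hB', ← integral_congr_ae hmul, S.integral_op]
    have h2 : ∫ z in π x ⁻¹' B, h z * g x z θ₀ ∂P₀ = 0 := by
      rw [← integral_indicator hB', ← hfop x e, inner_eq_integral_of_ae_eq hmul hfh]
      refine integral_congr_ae (Eventually.of_forall fun z => ?_)
      by_cases hzB : z ∈ π x ⁻¹' B
      · simp only [Set.indicator_of_mem hzB, mul_comm]
      · simp only [Set.indicator_of_notMem hzB, zero_mul]
    have hexp : (fun z => (1 + t * h z) * g x z θ₀)
        = fun z => g x z θ₀ + t * (h z * g x z θ₀) := by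
      ext z
      ring
    simp only [integral_zero]
    symm
    rw [setIntegral_withDensity_ofReal (hρm t) hpos _ hB', hexp,
      integral_add (hgL.integrable (by norm_num)).integrableOn
      ((integrable_mul_of_memLp_two hhL hgL).const_mul t).integrableOn, integral_const_mul, h1, h2]
    simp

/-- The information in the conditional moment model, by means of a vector `ℓ` of scores for `θ` whose
covariances with all instrumented moments are those of a score. -/
theorem isFisherInformation_conditional [SigmaFinite μ] [IsProbabilityMeasure P₀] (hμ : P₀ ≪ μ)
    (hΘ : Θ ∈ 𝓝 θ₀) (S : InstrumentedMoments P₀ π fun x z => g x z θ₀)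
    [S.normalSpace.HasOrthogonalProjection] (hg : ∀ x θ, Measurable fun z => g x z θ)
    (hreg : SmoothInstrumented P₀ π g θ₀)
    (hS : ∀ x, ∀ᶠ θ in 𝓝 θ₀, ∃ T : Lp ℝ 2 (P₀.map (π x)) →L[ℝ] Lp ℝ 2 P₀,
      ∀ α, T α =ᵐ[P₀] fun z => α (π x z) * g x z θ)
    (hSP : HasSemiparametricScore μ P₀ Θ θ₀
      (ConditionalRestriction (fun x => MeasurableSpace.comap (π x) inferInstance) g) g) :
    ∃ ℓ : Fin d → Lp ℝ 2 P₀,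
      (∀ a : Fin d → ℝ, ∫ z, (∑ l, a l • ℓ l : Lp ℝ 2 P₀) z ∂P₀ = 0) ∧
      (∀ x (α : Lp ℝ 2 (P₀.map (π x))) (a : Fin d → ℝ), inner ℝ (S.op x α) (∑ l, a l • ℓ l)
        = -fderiv ℝ (fun θ => ∫ z, α (π x z) * g x z θ ∂P₀) θ₀ a) ∧
      IsFisherInformation μ P₀ Θ θ₀
        (ConditionalRestriction (fun x => MeasurableSpace.comap (π x) inferInstance) g) g
        (projectedGram S.normalSpace ℓ) := by
  obtain ⟨ℓ, hℓ, hpath⟩ := hSP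
  -- scores of submodels, written in `L²`
  have hpath' : ∀ (a : Fin d → ℝ) (f : Lp ℝ 2 P₀), f ∈ S.normalSpaceᗮ → f ∈ boundedLp P₀ →
      ∃ θ P s, ∃ H : IsRegularSubmodel μ P₀ Θ θ₀
        (ConditionalRestriction (fun x => MeasurableSpace.comap (π x) inferInstance) g) g θ P a s,
        H.score_memLp.toLp s = ∑ l, a l • (hℓ l).toLp + f := by
    rintro a f hf ⟨h, hm, ⟨K, hK⟩, hfh⟩
    obtain ⟨P, H⟩ := hpath a h (mem_nuisanceTangentSet_of_bounded hμ hΘ S hg hreg hm hK hf hfh)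
    refine ⟨_, _, _, H, Lp.ext ?_⟩
    filter_upwards [H.score_memLp.coeFn_toLp, Lp.coeFn_add (∑ l, a l • (hℓ l).toLp) f, hfh,
      Lp.coeFn_finsetSum (p := 2) (μ := P₀) Finset.univ fun l => a l • (hℓ l).toLp,
      ae_all_iff.2 fun l => Lp.coeFn_smul (a l) (hℓ l).toLp,
      ae_all_iff.2 fun l => (hℓ l).coeFn_toLp] with z e1 e2 e3 e4 e5 e6
    rw [e1, e2, Pi.add_apply, e4, Finset.sum_apply, e3]
    congr 1
    refine Finset.sum_congr rfl fun l _ => ?_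
    rw [e5, Pi.smul_apply, e6, smul_eq_mul]
  have hscore : ∀ θ P a s (H : IsRegularSubmodel μ P₀ Θ θ₀
      (ConditionalRestriction (fun x => MeasurableSpace.comap (π x) inferInstance) g) g θ P a s),
      ∫ z, H.score_memLp.toLp s z ∂P₀ = 0 := fun θ P a s H => by
    rw [integral_congr_ae H.score_memLp.coeFn_toLp, H.integral_score hμ]
  have hℓ0 : ∀ a : Fin d → ℝ, ∫ z, (∑ l, a l • (hℓ l).toLp : Lp ℝ 2 P₀) z ∂P₀ = 0 := fun a => by
    obtain ⟨θ, P, s, H, e⟩ := hpath' a 0 (zero_mem _) (zero_mem _)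
    rw [← hscore θ P a s H, e, add_zero]
  have hℓop : ∀ x (α : Lp ℝ 2 (P₀.map (π x))) (a : Fin d → ℝ),
      inner ℝ (S.op x α) (∑ l, a l • (hℓ l).toLp)
        = -fderiv ℝ (fun θ => ∫ z, α (π x z) * g x z θ ∂P₀) θ₀ a := fun x α a => by
    obtain ⟨θ, P, s, H, e⟩ := hpath' a 0 (zero_mem _) (zero_mem _)
    rw [← inner_op_score hμ S hg hreg hS H x α, e, add_zero]
  refine ⟨fun l => (hℓ l).toLp, hℓ0, hℓop, isFisherInformation_projectedGram _ _
    (fun θ P a s H => ?_) fun a h hh ε hε => ?_⟩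
  · rw [S.mem_normalSpace_orthogonal]
    refine ⟨?_, fun x α => ?_⟩
    · rw [← inner_const_one, inner_sub_right, inner_const_one, inner_const_one, hℓ0,
        hscore θ P a s H, sub_zero]
    · rw [inner_sub_right, hℓop, inner_op_score hμ S hg hreg hS H, sub_self]
  · obtain ⟨h', h1, h2, h3⟩ := S.exists_bounded_mem_orthogonal hh hε
    obtain ⟨θ, P, s, H, e⟩ := hpath' a h' h1 h2
    refine ⟨θ, P, s, H, ?_⟩
    rw [e, add_sub_add_left_eq_sub, norm_sub_rev]
    exact h3

/-! ### Instrumented models -/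

/-- The information in the unconditional model whose moment functions are combinations
`∑_x A_i,x(π_x) g_x` of the moment functions of the conditional model. -/
theorem isFisherInformation_instrumented [SigmaFinite μ] [IsProbabilityMeasure P₀] (hμ : P₀ ≪ μ)
    (hΘ : Θ ∈ 𝓝 θ₀) (S : InstrumentedMoments P₀ π fun x z => g x z θ₀)
    (hg : ∀ x θ, Measurable fun z => g x z θ) (hreg : SmoothInstrumented P₀ π g θ₀)
    {ℓ : Fin d → Lp ℝ 2 P₀} (hℓ0 : ∀ a : Fin d → ℝ, ∫ z, (∑ l, a l • ℓ l : Lp ℝ 2 P₀) z ∂P₀ = 0)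
    (hℓ : ∀ x (α : Lp ℝ 2 (P₀.map (π x))) (a : Fin d → ℝ), inner ℝ (S.op x α) (∑ l, a l • ℓ l)
      = -fderiv ℝ (fun θ => ∫ z, α (π x z) * g x z θ ∂P₀) θ₀ a)
    {ι : Type} [Finite ι] {m : ι → (Fin q → ℝ) → (Fin d → ℝ) → ℝ}
    (hm : ∀ i θ, Measurable fun z => m i z θ) (A : ι → ∀ x, Lp ℝ 2 (P₀.map (π x)))
    (hA : ∀ i θ, (fun z => m i z θ) =ᵐ[P₀] fun z => ∑ x, A i x (π x z) * g x z θ) :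
    IsFisherInformation μ P₀ Θ θ₀ (MarginalRestriction m) m
      (projectedGram (momentSpan fun i => S.synthesis (A i)) ℓ) := by
  have hsyn : ∀ i, (fun z => m i z θ₀) =ᵐ[P₀] S.synthesis (A i) := fun i =>
    (hA i θ₀).trans (S.coeFn_synthesis (A i)).symm
  have hL : ∀ i, MemLp (fun z => m i z θ₀) 2 P₀ := fun i =>
    (memLp_congr_ae (hsyn i)).2 (Lp.memLp _)
  have htoLp : (fun i => (hL i).toLp) = fun i => S.synthesis (A i) := funext fun i =>
    Lp.ext ((hL i).coeFn_toLp.trans (hsyn i))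
  have hc : ∀ i, Tendsto (fun θ => eLpNorm (fun z => m i z θ - m i z θ₀) 2 P₀) (𝓝 θ₀)
      (𝓝 0) := fun i => by
    have h1 : Tendsto (fun θ => ∑ x, eLpNorm (fun z => A i x (π x z) * g x z θ
        - A i x (π x z) * g x z θ₀) 2 P₀) (𝓝 θ₀) (𝓝 0) := by
      simpa using tendsto_finsetSum Finset.univ fun x _ => (hreg x (A i x)).1
    refine tendsto_of_tendsto_of_tendsto_of_le_of_le tendsto_const_nhds h1 (fun _ => bot_le)
      fun θ => ?_
    have h2 : (fun z => m i z θ - m i z θ₀) =ᵐ[P₀]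
        ∑ x, fun z => A i x (π x z) * g x z θ - A i x (π x z) * g x z θ₀ := by
      filter_upwards [hA i θ, hA i θ₀] with z e1 e2
      rw [e1, e2, Finset.sum_apply, Finset.sum_sub_distrib]
    rw [eLpNorm_congr_ae h2]
    exact eLpNorm_sum_le (fun x _ => ((measurable_instrumented S hg x _ θ).sub
      (measurable_instrumented S hg x _ θ₀)).aestronglyMeasurable) (by norm_num)
  -- the moments are sums of instrumented moments, as functions of `θ` near `θ₀`
  have hint : ∀ i, (fun θ => ∫ z, m i z θ ∂P₀) =ᶠ[𝓝 θ₀]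
      fun θ => ∑ x, ∫ z, A i x (π x z) * g x z θ ∂P₀ := fun i => by
    have h1 : ∀ᶠ θ in 𝓝 θ₀, ∀ x, MemLp (fun z => A i x (π x z) * g x z θ) 2 P₀ :=
      eventually_all.2 fun x => eventually_memLp_of_tendsto
        (Eventually.of_forall fun θ => (measurable_instrumented S hg x _ θ).aestronglyMeasurable)
        (memLp_instrumented S x _) (hreg x _).1
    filter_upwards [h1] with θ hθ
    rw [integral_congr_ae (hA i θ), integral_finsetSum _ fun x _ => (hθ x).integrable (by norm_num)]
  have hsum : ∀ i, HasFDerivAt (fun θ => ∑ x, ∫ z, A i x (π x z) * g x z θ ∂P₀)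
      (∑ x, fderiv ℝ (fun θ => ∫ z, A i x (π x z) * g x z θ ∂P₀) θ₀) θ₀ := fun i =>
    HasFDerivAt.fun_sum fun x _ => (hreg x (A i x)).2.hasFDerivAt
  have hder := fun i => (hsum i).congr_of_eventuallyEq (hint i)
  have hmain := isFisherInformation_marginal (ℓ := ℓ) hμ hΘ hm hL hc
    (fun i => (hder i).differentiableAt)
    (fun i => by rw [integral_congr_ae (hsyn i), S.integral_synthesis])
    (fun i ν _ b e he θ => ?_) hℓ0 (fun i a => ?_)
  · convert hmain using 3
    exact htoLp.symm
  · -- the instruments are determined by the moment functions at `θ₀`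
    have hAe : A i = ∑ k, e k • A (b k) := by
      refine S.synthesis_injective (Lp.ext ?_)
      rw [map_sum]
      filter_upwards [hsyn i, he, Lp.coeFn_finsetSum (p := 2) (μ := P₀) Finset.univ
        fun k => S.synthesis (e k • A (b k)),
        ae_all_iff.2 fun k => Lp.coeFn_smul (e k) (S.synthesis (A (b k))),
        ae_all_iff.2 fun k => hsyn (b k)] with z e1 e2 e3 e4 e5
      rw [← e1, e2, e3, Finset.sum_apply]
      refine Finset.sum_congr rfl fun k _ => ?_
      rw [map_smul, e4, Pi.smul_apply, ← e5, smul_eq_mul]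
    have hcomp : ∀ x, (fun z => A i x (π x z)) =ᵐ[P₀] fun z => ∑ k, e k * A (b k) x (π x z) := by
      intro x
      refine comp_ae_eq_comp (β := fun u => ∑ k, e k * A (b k) x u) (S.measurable_proj x) ?_
      rw [hAe, Finset.sum_apply]
      filter_upwards [Lp.coeFn_finsetSum (p := 2) (μ := P₀.map (π x)) Finset.univ
        fun k => (e k • A (b k)) x,
        ae_all_iff.2 fun k => Lp.coeFn_smul (e k) (A (b k) x)] with u e1 e2
      rw [e1, Finset.sum_apply]
      refine Finset.sum_congr rfl fun k _ => ?_
      rw [Pi.smul_apply, e2, Pi.smul_apply, smul_eq_mul]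
    filter_upwards [hA i θ, ae_all_iff.2 fun k => hA (b k) θ, ae_all_iff.2 hcomp] with z e1 e2 e3
    rw [e1]
    simp only [e2, e3, Finset.sum_mul, Finset.mul_sum]
    rw [Finset.sum_comm]
    exact Finset.sum_congr rfl fun k _ => Finset.sum_congr rfl fun x _ => mul_assoc _ _ _
  · rw [(hder i).fderiv, ← inner_eq_integral_of_ae_eq (hsyn i).symm (ae_eq_refl _),
      S.synthesis_apply, sum_inner, sum_apply, ← Finset.sum_neg_distrib]
    exact Finset.sum_congr rfl fun x _ => hℓ x (A i x) a

theorem momentSpan_le_normalSpace [IsProbabilityMeasure P₀] {ι : Type*}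
    (S : InstrumentedMoments P₀ π fun x z => g x z θ₀) (A : ι → ∀ x, Lp ℝ 2 (P₀.map (π x))) :
    momentSpan (fun i => S.synthesis (A i)) ≤ S.normalSpace := by
  refine Submodule.span_le.2 (Set.insert_subset S.const_mem_normalSpace ?_)
  rintro _ ⟨i, rfl⟩
  exact S.synthesis_mem_normalSpace _


/-- Unconditional models that come from instruments have an information below the information of the
conditional model; if all combinations of moments occur, it is the greatest of them. -/
theorem exists_information_isLUB [SigmaFinite μ] [IsProbabilityMeasure P₀] (hμ : P₀ ≪ μ)
    (hΘ : Θ ∈ 𝓝 θ₀) (S : InstrumentedMoments P₀ π fun x z => g x z θ₀)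
    [S.normalSpace.HasOrthogonalProjection]
    (hg : ∀ x θ, Measurable fun z => g x z θ) (hreg : SmoothInstrumented P₀ π g θ₀)
    {ℓ : Fin d → Lp ℝ 2 P₀} (hℓ0 : ∀ a : Fin d → ℝ, ∫ z, (∑ l, a l • ℓ l : Lp ℝ 2 P₀) z ∂P₀ = 0)
    (hℓ : ∀ x (α : Lp ℝ 2 (P₀.map (π x))) (a : Fin d → ℝ), inner ℝ (S.op x α) (∑ l, a l • ℓ l)
      = -fderiv ℝ (fun θ => ∫ z, α (π x z) * g x z θ ∂P₀) θ₀ a)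
    {ι 𝓑 : Type} [Finite ι] {B : Set 𝓑} {m : 𝓑 → ι → (Fin q → ℝ) → (Fin d → ℝ) → ℝ}
    (hm : ∀ b ∈ B, ∀ i θ, Measurable fun z => m b i z θ)
    (A : ∀ b ∈ B, ι → ∀ x, Lp ℝ 2 (P₀.map (π x)))
    (hA : ∀ b (hb : b ∈ B) i θ,
      (fun z => m b i z θ) =ᵐ[P₀] fun z => ∑ x, A b hb i x (π x z) * g x z θ)
    (hB : ∀ β : Fin d → ∀ x, Lp ℝ 2 (P₀.map (π x)), ∃ b, ∃ hb : b ∈ B, ∀ l,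
      S.synthesis (β l) ∈ momentSpan fun i => S.synthesis (A b hb i)) :
    ∃ Ib : 𝓑 → Matrix (Fin d) (Fin d) ℝ,
      (∀ b ∈ B, IsFisherInformation μ P₀ Θ θ₀ (MarginalRestriction (m b)) (m b) (Ib b)) ∧
      IsLUB (Ib '' B) (projectedGram S.normalSpace ℓ) := by
  classical
  refine ⟨fun b => if hb : b ∈ B then projectedGram (momentSpan fun i => S.synthesis (A b hb i)) ℓ
    else 0, fun b hb => ?_, IsGreatest.isLUB ⟨?_, ?_⟩⟩
  · simp only [dif_pos hb]
    exact isFisherInformation_instrumented hμ hΘ S hg hreg hℓ0 hℓ (hm b hb) (A b hb) (hA b hb)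
  · -- instruments for the projections of the score attain the bound
    have hproj : ∀ l, ∃ β : ∀ x, Lp ℝ 2 (P₀.map (π x)), ∃ r : ℝ,
        S.normalSpace.starProjection (ℓ l) = r • Lp.const 2 P₀ (1 : ℝ) + S.synthesis β := fun l => by
      obtain ⟨u, hu, v, ⟨β, rfl⟩, h⟩ :=
        Submodule.mem_sup.1 (S.normalSpace.starProjection_apply_mem (ℓ l))
      obtain ⟨r, rfl⟩ := Submodule.mem_span_singleton.1 hu
      exact ⟨β, r, h.symm⟩
    choose β r hβ using hproj
    obtain ⟨b, hb, hmem⟩ := hB β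
    refine ⟨b, hb, ?_⟩
    simp only [dif_pos hb]
    refine projectedGram_eq_of_mem (momentSpan_le_normalSpace S _) fun l => ?_
    rw [hβ]
    exact add_mem (Submodule.smul_mem _ _ (Submodule.subset_span (Set.mem_insert _ _))) (hmem l)
  · rintro _ ⟨b, hb, rfl⟩
    simp only [dif_pos hb]
    exact projectedGram_mono (momentSpan_le_normalSpace S _) ℓ

end Conditional

/-! ### Instruments that are subvectors -/

section Subvectors

variable {q d J : ℕ} {p : Fin J → ℕ} {c : Fin J → Finset (Fin q)}
  {g : (j : Fin J) → (Fin q → ℝ) → (Fin d → ℝ) → Fin (p j) → ℝ}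
  {P₀ : Measure (Fin q → ℝ)} {θ₀ : Fin d → ℝ}

theorem eventually_exists_subvector_multiplier [IsProbabilityMeasure P₀]
    (hg : ∀ j θ k, Measurable fun z => g j z θ k) (hreg : RegularMoments c g P₀ θ₀)
    (x : Σ j, Fin (p j)) :
    ∀ᶠ θ in 𝓝 θ₀, ∃ T : Lp ℝ 2 (P₀.map (subvector (c x.1))) →L[ℝ] Lp ℝ 2 P₀,
      ∀ α, T α =ᵐ[P₀] fun z => α (subvector (c x.1) z) * momentComponents g x z θ :=
  eventually_exists_multiplier (G := fun θ z => momentComponents g x z θ)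
    (measurable_subvector (c x.1)) (fun θ => hg x.1 θ x.2)
    fun α hα hαL => ⟨(hreg x.1 x.2 α hα hαL).1, (hreg x.1 x.2 α hα hαL).2.1⟩

theorem RegularMoments.smoothInstrumented (hreg : RegularMoments c g P₀ θ₀) :
    SmoothInstrumented P₀ (fun x : Σ j, Fin (p j) => subvector (c x.1)) (momentComponents g) θ₀ :=
  fun x α => (hreg x.1 x.2 α (Lp.stronglyMeasurable α).measurable (Lp.memLp α)).2

/-- The moment functions of the conditional model, with the dual system given by the non-degeneracy
condition. -/
theorem nonempty_instrumentedMoments [IsProbabilityMeasure P₀]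
    (hg : ∀ j θ k, Measurable fun z => g j z θ k) (h0 : conditionalModel c g θ₀ P₀)
    (hreg : RegularMoments c g P₀ θ₀) (hT : AssumptionT c g P₀ θ₀) :
    Nonempty (InstrumentedMoments P₀ (fun x : Σ j, Fin (p j) => subvector (c x.1))
      fun x z => momentComponents g x z θ₀) := by
  choose T hTα using fun x => (eventually_exists_subvector_multiplier hg hreg x).self_of_nhds
  obtain ⟨w, hwm, hwb, hw⟩ := hT.exists_dual_system hg
  refine ⟨⟨fun x => measurable_subvector _, T, hTα, fun x α => ?_, w, hwm, hwb, hw⟩⟩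
  -- the moments have mean zero given the subvector, hence are orthogonal to the instruments
  have hint : Integrable (fun z => α (subvector (c x.1) z) * momentComponents g x z θ₀) P₀ :=
    (integrable_congr (hTα x α)).1 ((Lp.memLp _).integrable (by norm_num))
  rw [integral_congr_ae (hTα x α), integral_mul_condExp (subvectorSigma_le (c x.1))
    (measurable_instrument α) (h0 x).1 hint]
  refine (integral_congr_ae (g := fun _ => 0) ?_).trans (integral_zero _ _)
  filter_upwards [(h0 x).2] with z hz
  rw [hz, Pi.zero_apply, mul_zero]

/-- The rows of an instrument matrix, as elements of `L²`. -/
noncomputable def instrumentRow (b : (j : Fin J) → (c j → ℝ) → Matrix (Fin d) (Fin (p j)) ℝ)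
    (hb : b ∈ instruments d p c P₀) (l : Fin d) (x : Σ j, Fin (p j)) :
    Lp ℝ 2 (P₀.map (subvector (c x.1))) :=
  (hb x.1 l x.2).2.toLp

theorem instrumentRow_comp_ae_eq (b : (j : Fin J) → (c j → ℝ) → Matrix (Fin d) (Fin (p j)) ℝ)
    (hb : b ∈ instruments d p c P₀) (l : Fin d) (x : Σ j, Fin (p j)) :
    (fun z => instrumentRow b hb l x (subvector (c x.1) z)) =ᵐ[P₀]
      fun z => b x.1 (subvector (c x.1) z) l x.2 :=
  comp_ae_eq_comp (measurable_subvector _) (hb x.1 l x.2).2.coeFn_toLp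

theorem measurable_blockMoments (hg : ∀ j θ k, Measurable fun z => g j z θ k)
    {b : (j : Fin J) → (c j → ℝ) → Matrix (Fin d) (Fin (p j)) ℝ} (hb : b ∈ instruments d p c P₀)
    (i : Fin J × Fin d) (θ : Fin d → ℝ) : Measurable fun z => blockMoments c g b i z θ := by
  simp only [blockMoments, Matrix.mulVec, dotProduct]
  exact Finset.measurable_sum _ fun k _ =>
    ((hb i.1 i.2 k).1.comp (measurable_subvector (c i.1))).mul (hg i.1 θ k)

theorem compactMoments_ae_eq {b : (j : Fin J) → (c j → ℝ) → Matrix (Fin d) (Fin (p j)) ℝ}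
    (hb : b ∈ instruments d p c P₀) (l : Fin d) (θ : Fin d → ℝ) :
    (fun z => compactMoments c g b l z θ) =ᵐ[P₀] fun z => ∑ x,
      instrumentRow b hb l x (subvector (c x.1) z) * momentComponents g x z θ := by
  filter_upwards [ae_all_iff.2 (instrumentRow_comp_ae_eq b hb l)] with z hz
  simp only [hz, Fintype.sum_sigma]
  rfl

theorem blockMoments_ae_eq {b : (j : Fin J) → (c j → ℝ) → Matrix (Fin d) (Fin (p j)) ℝ}
    (hb : b ∈ instruments d p c P₀) (i : Fin J × Fin d) (θ : Fin d → ℝ) :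
    (fun z => blockMoments c g b i z θ) =ᵐ[P₀] fun z => ∑ x,
      (if x.1 = i.1 then instrumentRow b hb i.2 x else 0 : Lp ℝ 2 (P₀.map (subvector (c x.1))))
        (subvector (c x.1) z) * momentComponents g x z θ := by
  have h0 : ∀ x : Σ j, Fin (p j), (fun z =>
      (0 : Lp ℝ 2 (P₀.map (subvector (c x.1)))) (subvector (c x.1) z)) =ᵐ[P₀] fun _ => 0 :=
    fun x => comp_ae_eq_comp (measurable_subvector _) (Lp.coeFn_zero _ _ _)
  filter_upwards [ae_all_iff.2 (instrumentRow_comp_ae_eq b hb i.2), ae_all_iff.2 h0]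
    with z hz hz0
  rw [Fintype.sum_sigma, Finset.sum_eq_single i.1]
  · refine (Finset.sum_congr rfl fun k _ => ?_ :
      ∑ k, b i.1 (subvector (c i.1) z) i.2 k * g i.1 z θ k = _)
    rw [if_pos rfl, hz]
    rfl
  · intro j _ hj
    refine Finset.sum_eq_zero fun (k : Fin (p j)) _ => ?_
    rw [if_neg hj, hz0, zero_mul]
  · simp

/-- Any system of square-integrable instruments is the row system of an instrument matrix. -/
theorem exists_instruments (β : Fin d → ∀ x : Σ j, Fin (p j), Lp ℝ 2 (P₀.map (subvector (c x.1)))) :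
    ∃ b, ∃ hb : b ∈ instruments d p c P₀, ∀ l, instrumentRow b hb l = β l :=
  ⟨fun j u => Matrix.of fun l k => β l ⟨j, k⟩ u,
    fun j l k => ⟨(Lp.stronglyMeasurable (β l ⟨j, k⟩)).measurable, Lp.memLp (β l ⟨j, k⟩)⟩,
    fun l => funext fun x => Lp.toLp_coeFn (β l x) _⟩

end Subvectors

theorem corollary1 {q d J : ℕ} {p : Fin J → ℕ} (c : Fin J → Finset (Fin q))
    (hc : ∀ j, c j ≠ Finset.univ)
    (g : (j : Fin J) → (Fin q → ℝ) → (Fin d → ℝ) → Fin (p j) → ℝ)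
    (hg : ∀ j θ k, Measurable fun z => g j z θ k)
    (μ P₀ : Measure (Fin q → ℝ)) [SigmaFinite μ] [IsProbabilityMeasure P₀] (hμ : P₀ ≪ μ)
    (Θ : Set (Fin d → ℝ)) (θ₀ : Fin d → ℝ) (hθ₀ : θ₀ ∈ interior Θ)
    (h₀ : ∀ θ ∈ Θ, conditionalModel c g θ P₀ ↔ θ = θ₀)
    (hreg : RegularMoments c g P₀ θ₀)
    (hT : AssumptionT c g P₀ θ₀)
    (hSP : HasSemiparametricScore μ P₀ Θ θ₀ (conditionalModel c g) (momentComponents g)) :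
    ∃ I : Matrix (Fin d) (Fin d) ℝ,
      IsFisherInformation μ P₀ Θ θ₀ (conditionalModel c g) (momentComponents g) I ∧
      -- restrictions `E[b_j(X^(j)) g_j(Z, θ)] = 0` for every `j`
      (∃ Ib : ((j : Fin J) → (c j → ℝ) → Matrix (Fin d) (Fin (p j)) ℝ) → Matrix (Fin d) (Fin d) ℝ,
        (∀ b ∈ instruments d p c P₀, IsFisherInformation μ P₀ Θ θ₀
          (MarginalRestriction (blockMoments c g b)) (blockMoments c g b) (Ib b)) ∧
        IsLUB (Ib '' instruments d p c P₀) I) ∧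
      -- the compact form `E[b(X) g(Z, θ)] = 0`
      (∃ Ib : ((j : Fin J) → (c j → ℝ) → Matrix (Fin d) (Fin (p j)) ℝ) → Matrix (Fin d) (Fin d) ℝ,
        (∀ b ∈ instruments d p c P₀, IsFisherInformation μ P₀ Θ θ₀
          (MarginalRestriction (compactMoments c g b)) (compactMoments c g b) (Ib b)) ∧
        IsLUB (Ib '' instruments d p c P₀) I) := by
  have hΘ : Θ ∈ 𝓝 θ₀ := mem_interior_iff_mem_nhds.1 hθ₀
  have hg' : ∀ x θ, Measurable fun z => momentComponents g x z θ := fun x θ => hg x.1 θ x.2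
  obtain ⟨S⟩ :=
    nonempty_instrumentedMoments hg ((h₀ θ₀ (mem_of_mem_nhds hΘ)).2 rfl) hreg hT
  have : CompleteSpace S.normalSpace := S.isClosed_normalSpace.completeSpace_coe
  obtain ⟨ℓ, hℓ0, hℓ, hinfo⟩ := isFisherInformation_conditional hμ hΘ S hg' hreg.smoothInstrumented
    (eventually_exists_subvector_multiplier hg hreg) hSP
  refine ⟨projectedGram S.normalSpace ℓ, hinfo,
    exists_information_isLUB hμ hΘ S hg' hreg.smoothInstrumented hℓ0 hℓ
      (fun b hb => measurable_blockMoments hg hb)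
      (fun b hb i x => if x.1 = i.1 then instrumentRow b hb i.2 x else 0)
      (fun b hb => blockMoments_ae_eq hb) fun β => ?_,
    exists_information_isLUB hμ hΘ S hg' hreg.smoothInstrumented hℓ0 hℓ
      (fun b hb l θ => Finset.measurable_sum _ fun j _ => measurable_blockMoments hg hb (j, l) θ)
      (fun b hb l => instrumentRow b hb l) (fun b hb => compactMoments_ae_eq hb) fun β => ?_⟩
  · obtain ⟨b, hb, hβ⟩ := exists_instruments β
    refine ⟨b, hb, fun l => ?_⟩
    -- the compact moments are the sums of the blocks
    have hsum : β l = ∑ j, fun x => if x.1 = j then instrumentRow b hb l x else 0 := by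
      ext1 x
      simp [hβ l]
    rw [hsum, map_sum]
    exact sum_mem fun j _ =>
      Submodule.subset_span (Set.mem_insert_of_mem _ ⟨(j, l), rfl⟩)
  · obtain ⟨b, hb, hβ⟩ := exists_instruments β
    refine ⟨b, hb, fun l => ?_⟩
    rw [← hβ l]
    exact Submodule.subset_span (Set.mem_insert_of_mem _ ⟨l, rfl⟩)
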